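/- Let $R=\mathbb{Z}_2$ be the ring of 2-adic integers, $G=A_4$, $a_1=(1,2)(3,4)$, $a_2=(1,4)(2,3)$, $b=(1,2,3)$ and $H=\langle a_1,a_2\rangle\cong C_2\times C_2$ the Sylow 2-subgroup of $G$. Modules are free of finite rank over $R$, $\otimes$ is $\otimes_R$ with the diagonal action of $G$, and $M^*=\mathrm{Hom}_R(M,R)$ is the contragredient module. Let $\Gamma=RG$, $w_0=\frac13(1+b+b^2)$, $w_1=1-w_0$, $P_0=RGw_0$ and $P_1=RGw_1$. For an $RH$-module $M$ let $\Theta(M)$ be the kernel of an epimorphism $F\to M$, where $F$ is a free $RH$-module of smallest possible rank. Put $\Delta^H_0=R$ (the trivial module), $\Delta^H_n=\Theta(\Delta^H_{n-1})$ and $\Delta^H_{-n}=(\Delta^H_n)^*$ for $n\ge 1$. For every $n\in\mathbb{Z}$ the $RG$-module induced from $\Delta^H_n$ decomposes as $\Delta_{n}\oplus\Delta_{1,n}$, where $\Delta_n$ and $\Delta_{1,n}$ are indecomposable $RG$-modules with $\mathrm{rank}\,\Delta_n=\mathrm{rank}\,\Delta^H_n$ and $\mathrm{rank}\,\Delta_{1,n}=2\,\mathrm{rank}\,\Delta^H_n$.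 For any choice of such decompositions the following hold. (1) There are short exact sequences of $RG$-modules $$0\to\Delta_{3k}\to\Gamma^k\to\Delta_{3k-1}\to0\quad(k\ge1),$$ $$0\to\Delta_{3k+1}\to P_0\oplus\Gamma^k\to\Delta_{3k}\to0\quad(k\ge0),$$ $$0\to\Delta_{3k+2}\to P_1\oplus\Gamma^k\to\Delta_{3k+1}\to0\quad(k\ge0).$$ (2) For every $k\ge0$ $$\Delta_{3k}\otimes\Delta_1\cong\Delta_{3k+1}\oplus\Gamma^k,\qquad \Delta_{3k+1}\otimes\Delta_1\cong\Delta_{3k+2}\oplus P_0\oplus\Gamma^k,\qquad \Delta_{3k+2}\otimes\Delta_1\cong\Delta_{3k+3}\oplus P_1\oplus\Gamma^k.$$ (3) Let $\mathfrak a(RG)$ be the representation ring, i.e. the ring of formal differences of isomorphism classes $[M]$ of $RG$-modules with $[M]+[N]=[M\oplus N]$ and $[M][N]=[M\otimes N]$, let $\mathfrak A(RG)=\mathfrak a(RG)\otimes_{\mathbb Z}\mathbb Q$, $\mathfrak f_1=\frac1{12}[\Gamma]$ and $\mathfrak f_3=(1-[P_0])(1-\mathfrak f_1)$. Then in $\mathfrak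 A(RG)$ $$[\Delta_n][\Delta_m]\,\mathfrak f_3=[\Delta_{n+m}]\,\mathfrak f_3\quad\text{for all } n,m\in\mathbb Z,\qquad [\Delta_{1,0}][\Delta_{1,0}]=2[\Delta_0]+[\Delta_{1,0}].$$ -/

import Mathlib

open scoped TensorProduct MonoidAlgebra

noncomputable section

/-- A module of an `R`-representation of `G`: a free `R`-module of finite rank with a linear
action of `G`. -/
structure RepLattice (R : Type) (G : Type) [CommRing R] [Group G] where
  /-- The underlying module. -/
  V : Type
  [addCommGroup : AddCommGroup V]
  [module : Module R V]
  [free : Module.Free R V]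
  [finite : Module.Finite R V]
  /-- The action of `G`. -/
  ρ : Representation R G V

namespace RepLattice

attribute [instance] addCommGroup module free finite

section General

variable {R : Type} {G : Type} [CommRing R] [Group G]

/-- Isomorphism of `RG`-modules. -/
def Iso (M N : RepLattice R G) : Prop := Nonempty (M.ρ.Equiv N.ρ)

/-- There is a short exact sequence `0 → A → B → C → 0` of `RG`-modules. -/
def IsShortExact (A B C : RepLattice R G) : Prop :=
  ∃ (f : A.ρ.IntertwiningMap B.ρ) (g : B.ρ.IntertwiningMap C.ρ),
    Function.Injective f ∧ Function.Exact f g ∧ Function.Surjective g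

/-- The direct sum. -/
abbrev sum (M N : RepLattice R G) : RepLattice R G where
  V := M.V × N.V
  ρ := M.ρ.prod N.ρ

/-- The tensor product over `R`, with the diagonal action `g (m ⊗ n) = g m ⊗ g n`. -/
abbrev tensor (M N : RepLattice R G) : RepLattice R G where
  V := M.V ⊗[R] N.V
  ρ := M.ρ.tprod N.ρ

/-- The contragredient module `Hom_R(M, R)`, with `(g φ) m = φ (g⁻¹ m)`. -/
abbrev dual (M : RepLattice R G) : RepLattice R G where
  V := Module.Dual R M.V
  ρ := M.ρ.dual

variable (R G) in
/-- The zero module. -/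
abbrev zero : RepLattice R G where
  V := PUnit
  ρ := Representation.trivial R G PUnit

variable (R G) in
/-- The trivial module `R`. -/
abbrev triv : RepLattice R G where
  V := R
  ρ := Representation.trivial R G R

variable (R G) in
/-- The free module `(RG)^k`, the direct sum of `k` copies of the left regular module. -/
abbrev freeMod [Finite G] (k : ℕ) : RepLattice R G where
  V := Fin k →₀ R[G]
  free := inferInstance
  finite := by
    have : Module.Finite R R[G] := Module.Finite.of_basis (MonoidAlgebra.basis G R)
    infer_instance
  ρ := Representation.free R G (Fin k)

/-- An indecomposable module: nonzero and not a direct sum of two nonzero modules. -/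
def IsIndecomposable (M : RepLattice R G) : Prop :=
  Nontrivial M.V ∧
    ∀ A B : RepLattice R G, M.Iso (A.sum B) → Subsingleton A.V ∨ Subsingleton B.V

/-! ### The Heller operator -/

/-- `M` is a homomorphic image of the free module of rank `d`. -/
def IsImageOfFree [Finite G] (M : RepLattice R G) (d : ℕ) : Prop :=
  ∃ f : (freeMod R G d).ρ.IntertwiningMap M.ρ, Function.Surjective f

lemma exists_isImageOfFree [Finite G] (M : RepLattice R G) : ∃ d, M.IsImageOfFree d := by
  obtain ⟨d, s, hs⟩ := Module.Finite.exists_fin (R := R) (M := M.V)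
  refine ⟨d, Representation.freeLift M.ρ s, fun x => ?_⟩
  have hx : x ∈ Submodule.span R (Set.range s) := hs ▸ Submodule.mem_top
  have hle : Submodule.span R (Set.range s) ≤
      LinearMap.range (Representation.freeLift M.ρ s).toLinearMap := by
    rw [Submodule.span_le]
    rintro _ ⟨i, rfl⟩
    exact ⟨Finsupp.single i (MonoidAlgebra.single 1 1),
      (Representation.freeLift_single_single M.ρ i 1 1 s).trans (by simp)⟩
  exact hle hx

/-- The smallest rank of a free `RG`-module that maps onto `M`. -/
def coverRank [Finite G] (M : RepLattice R G) : ℕ := sInf {d | M.IsImageOfFree d}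

lemma isImageOfFree_coverRank [Finite G] (M : RepLattice R G) :
    M.IsImageOfFree M.coverRank := Nat.sInf_mem M.exists_isImageOfFree

/-- An epimorphism onto `M` from a free `RG`-module of smallest rank. -/
def cover [Finite G] (M : RepLattice R G) :
    (freeMod R G M.coverRank).ρ.IntertwiningMap M.ρ := M.isImageOfFree_coverRank.choose

lemma cover_surjective [Finite G] (M : RepLattice R G) : Function.Surjective M.cover :=
  M.isImageOfFree_coverRank.choose_spec

/-- The kernel `Θ(M)` of an epimorphism onto `M` from a free `RG`-module of smallest rank. -/
def theta [Finite G] [IsDomain R] [IsPrincipalIdealRing R] (M : RepLattice R G) :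
    RepLattice R G where
  V := M.cover.ker.toSubmodule
  free := inferInstance
  finite := inferInstance
  ρ := M.cover.ker.toRepresentation

variable (R G) in
/-- The Heller modules `Δ_n = Θ^n(R)` for `n ≥ 0`. -/
def hellerNat [Finite G] [IsDomain R] [IsPrincipalIdealRing R] : ℕ → RepLattice R G
  | 0 => triv R G
  | n + 1 => (hellerNat n).theta

variable (R G) in
/-- The Heller modules `Δ_n`, `n ∈ ℤ`, where `Δ_{-n}` is the contragredient module of `Δ_n`. -/
def heller [Finite G] [IsDomain R] [IsPrincipalIdealRing R] : ℤ → RepLattice R G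
  | Int.ofNat n => hellerNat R G n
  | Int.negSucc n => (hellerNat R G (n + 1)).dual

/-- The submodule `RG w` of the left regular module `RG`. -/
abbrev principal [Finite G] [IsDomain R] [IsPrincipalIdealRing R] (w : R[G]) : RepLattice R G where
  V := LinearMap.range (LinearMap.mulRight R w)
  free := by
    have : Module.Finite R R[G] := Module.Finite.of_basis (MonoidAlgebra.basis G R)
    infer_instance
  finite := by
    have : Module.Finite R R[G] := Module.Finite.of_basis (MonoidAlgebra.basis G R)
    infer_instance
  ρ := Subrepresentation.toRepresentation (ρ := Representation.leftRegular R G)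
    { toSubmodule := LinearMap.range (LinearMap.mulRight R w)
      apply_mem_toSubmodule := by
        rintro g _ ⟨x, rfl⟩
        refine ⟨MonoidAlgebra.single g 1 * x, ?_⟩
        have h : ∀ y : R[G], Representation.leftRegular R G g y = MonoidAlgebra.single g 1 * y := by
          intro y
          induction y using MonoidAlgebra.induction_linear with
          | zero => simp
          | add => simp [*, mul_add]
          | single => simp
        rw [h]
        simp [mul_assoc] }

/-! ### The ring and the algebra of representations -/

section Equivs

variable {U V W V' W' : Type} [AddCommGroup U] [Module R U] [AddCommGroup V] [Module R V]
  [AddCommGroup W] [Module R W] [AddCommGroup V'] [Module R V'] [AddCommGroup W'] [Module R W']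
  {π : Representation R G U} {ρ : Representation R G V} {σ : Representation R G W}
  {ρ' : Representation R G V'} {σ' : Representation R G W'}

def prodCongr (e : ρ.Equiv ρ') (f : σ.Equiv σ') : (ρ.prod σ).Equiv (ρ'.prod σ') :=
  .mk (e.toLinearEquiv.prodCongr f.toLinearEquiv) fun g => by
    refine LinearMap.ext fun x => Prod.ext ?_ ?_
    · exact Representation.IntertwiningMap.isIntertwining _ _ e.toIntertwiningMap g x.1
    · exact Representation.IntertwiningMap.isIntertwining _ _ f.toIntertwiningMap g x.2

def tensorCongr (e : ρ.Equiv ρ') (f : σ.Equiv σ') : (ρ.tprod σ).Equiv (ρ'.tprod σ') :=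
  .mk (TensorProduct.congr e.toLinearEquiv f.toLinearEquiv) fun g => by
    refine TensorProduct.ext' fun x y => ?_
    exact congrArg₂ (fun a b => a ⊗ₜ[R] b) (Representation.IntertwiningMap.isIntertwining _ _ e.toIntertwiningMap g x)
      (Representation.IntertwiningMap.isIntertwining _ _ f.toIntertwiningMap g y)

def prodComm : (ρ.prod σ).Equiv (σ.prod ρ) :=
  .mk (LinearEquiv.prodComm R V W) fun _ => rfl

def prodAssoc : ((π.prod ρ).prod σ).Equiv (π.prod (ρ.prod σ)) :=
  .mk (LinearEquiv.prodAssoc R U V W) fun _ => rfl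

def zeroProd : ((Representation.trivial R G PUnit).prod ρ).Equiv ρ :=
  .mk LinearEquiv.uniqueProd fun _ => rfl

def zeroTensor : ((Representation.trivial R G PUnit).tprod ρ).Equiv
    (Representation.trivial R G PUnit) :=
  .mk (LinearEquiv.ofBijective 0 ⟨Function.injective_of_subsingleton _,
    fun _ => ⟨0, rfl⟩⟩) fun _ => rfl

def tensorProd : (π.tprod (ρ.prod σ)).Equiv ((π.tprod ρ).prod (π.tprod σ)) :=
  .mk (TensorProduct.prodRight R R U V W) fun g => by
    refine TensorProduct.ext' fun x y => ?_
    rfl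

end Equivs

variable (R G) in
/-- Isomorphism as an equivalence relation. -/
instance isoSetoid : Setoid (RepLattice R G) where
  r := Iso
  iseqv :=
    { refl := fun M => ⟨.refl M.ρ⟩
      symm := fun ⟨e⟩ => ⟨e.symm⟩
      trans := fun ⟨e⟩ ⟨f⟩ => ⟨e.trans f⟩ }

variable (R G) in
/-- The type of isomorphism classes of modules of `R`-representations of `G`. -/
def IsoClass : Type 1 := Quotient (isoSetoid R G)

/-- The isomorphism class of `M`. -/
def isoClass (M : RepLattice R G) : IsoClass R G := Quotient.mk _ M

lemma isoClass_eq_iff {M N : RepLattice R G} : M.isoClass = N.isoClass ↔ M.Iso N :=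
  Quotient.eq

instance : Add (IsoClass R G) := ⟨Quotient.map₂ sum fun _ _ ⟨e⟩ _ _ ⟨f⟩ => ⟨prodCongr e f⟩⟩

instance : Mul (IsoClass R G) := ⟨Quotient.map₂ tensor fun _ _ ⟨e⟩ _ _ ⟨f⟩ => ⟨tensorCongr e f⟩⟩

instance : Zero (IsoClass R G) := ⟨(zero R G).isoClass⟩

instance : One (IsoClass R G) := ⟨(triv R G).isoClass⟩

/-- The semiring of isomorphism classes: `[M] + [N] = [M ⊕ N]`, `[M] [N] = [M ⊗ N]`. -/
instance : CommSemiring (IsoClass R G) where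
  nsmul := nsmulRec
  add_assoc := by
    rintro ⟨A⟩ ⟨B⟩ ⟨C⟩
    exact Quotient.sound ⟨prodAssoc⟩
  zero_add := by
    rintro ⟨A⟩
    exact Quotient.sound ⟨zeroProd⟩
  add_zero := by
    rintro ⟨A⟩
    exact Quotient.sound ⟨prodComm.trans zeroProd⟩
  add_comm := by
    rintro ⟨A⟩ ⟨B⟩
    exact Quotient.sound ⟨prodComm⟩
  left_distrib := by
    rintro ⟨A⟩ ⟨B⟩ ⟨C⟩
    exact Quotient.sound ⟨tensorProd⟩
  right_distrib := by
    rintro ⟨A⟩ ⟨B⟩ ⟨C⟩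
    exact Quotient.sound ⟨(Representation.TensorProduct.comm _ _).trans (tensorProd.trans
      (prodCongr (Representation.TensorProduct.comm _ _)
        (Representation.TensorProduct.comm _ _)))⟩
  zero_mul := by
    rintro ⟨A⟩
    exact Quotient.sound ⟨zeroTensor⟩
  mul_zero := by
    rintro ⟨A⟩
    exact Quotient.sound ⟨(Representation.TensorProduct.comm _ _).trans zeroTensor⟩
  mul_assoc := by
    rintro ⟨A⟩ ⟨B⟩ ⟨C⟩
    exact Quotient.sound ⟨Representation.TensorProduct.assoc _ _ _⟩
  one_mul := by
    rintro ⟨A⟩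
    exact Quotient.sound ⟨Representation.TensorProduct.lid _ _⟩
  mul_one := by
    rintro ⟨A⟩
    exact Quotient.sound ⟨Representation.TensorProduct.rid _ _⟩
  mul_comm := by
    rintro ⟨A⟩ ⟨B⟩
    exact Quotient.sound ⟨Representation.TensorProduct.comm _ _⟩

lemma isoClass_sum (M N : RepLattice R G) : (M.sum N).isoClass = M.isoClass + N.isoClass := rfl

lemma isoClass_tensor (M N : RepLattice R G) :
    (M.tensor N).isoClass = M.isoClass * N.isoClass := rfl

variable (R G) in
/-- The representation ring: the ring of differences of isomorphism classes, that is, the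
extension of scalars of the semiring of isomorphism classes from `ℕ` to `ℤ`. -/
def RepRing : Type 1 := ℤ ⊗[ℕ] IsoClass R G

instance : CommRing (RepRing R G) := inferInstanceAs (CommRing (ℤ ⊗[ℕ] IsoClass R G))

variable (R G) in
/-- The homomorphism that sends an isomorphism class to its class in the representation ring. -/
def toRepRing : IsoClass R G →+* RepRing R G :=
  (Algebra.TensorProduct.includeRight : IsoClass R G →ₐ[ℕ] ℤ ⊗[ℕ] IsoClass R G).toRingHom

variable (R G) in
/-- The representation algebra over `ℚ`. -/
abbrev RepAlgebra : Type 1 := RepRing R G ⊗[ℤ] ℚ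

/-- The class `[M]` in the representation algebra. -/
def cls (M : RepLattice R G) : RepAlgebra R G := toRepRing R G M.isoClass ⊗ₜ[ℤ] (1 : ℚ)

end General

end RepLattice

/-! ### The alternating group of degree four over the 2-adic integers -/

namespace AltFour

open RepLattice

/-- The alternating group of degree four. -/
abbrev G : Type := alternatingGroup (Fin 4)

/-- The element `(1,2)(3,4)`. -/
def a₁ : G := ⟨Equiv.swap 0 1 * Equiv.swap 2 3, by
  rw [Equiv.Perm.mem_alternatingGroup]; decide⟩

/-- The element `(1,4)(2,3)`. -/
def a₂ : G := ⟨Equiv.swap 0 3 * Equiv.swap 1 2, by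
  rw [Equiv.Perm.mem_alternatingGroup]; decide⟩

/-- The element `(1,2,3)`. -/
def b : G := ⟨Equiv.swap 0 1 * Equiv.swap 1 2, by
  rw [Equiv.Perm.mem_alternatingGroup]; decide⟩

/-- The Klein four-group, which is the Sylow 2-subgroup of `G`. -/
abbrev H : Subgroup G := Subgroup.closure {a₁, a₂}

/-- The ring of 2-adic integers. -/
abbrev R : Type := ℤ_[2]

/-- The 2-adic integer `1/3`. -/
def third : R := Ring.inverse 3

lemma three_mul_third : 3 * third = 1 := by
  refine Ring.mul_inverse_cancel _ ?_
  rw [PadicInt.isUnit_iff]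
  exact_mod_cast (PadicInt.norm_natCast_eq_one_iff (p := 2) (n := 3)).2 (by decide)

/-- The idempotent `w₀ = (1 + b + b²) / 3` of the group algebra. -/
def w₀ : R[G] :=
  third • (MonoidAlgebra.single 1 1 + MonoidAlgebra.single b 1 + MonoidAlgebra.single (b ^ 2) 1)

/-- The idempotent `w₁ = 1 - w₀`. -/
def w₁ : R[G] := 1 - w₀

/-- The left regular module `Γ = RG`. -/
def Γ : RepLattice R G where
  V := R[G]
  finite := Module.Finite.of_basis (MonoidAlgebra.basis G R)
  ρ := Representation.leftRegular R G

/-- The projective module `P₀ = RG w₀`. -/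
def P₀ : RepLattice R G := principal w₀

/-- The projective module `P₁ = RG w₁`. -/
def P₁ : RepLattice R G := principal w₁

/-- `IsHellerPair n D E`: the module induced from the Heller module `Δ_n` of `H` decomposes as the
direct sum of the indecomposable `RG`-modules `D`, of the same rank as `Δ_n`, and `E`, of twice
that rank. So `D` is the lift of `Δ_n` to `G`, and `E` is the complement. -/
structure IsHellerPair (n : ℤ) (D E : RepLattice R G) : Prop where
  indecomposable_left : D.IsIndecomposable
  indecomposable_right : E.IsIndecomposable
  rank_left : Module.finrank R D.V = Module.finrank R (heller R H n).V
  rank_right : Module.finrank R E.V = 2 * Module.finrank R (heller R H n).V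
  decomposition : Nonempty ((Representation.ind H.subtype (heller R H n).ρ).Equiv (D.sum E).ρ)

/-- The idempotent `𝔣₁ = [Γ] / 12` of the representation algebra. -/
def f₁ : RepAlgebra R G := cls Γ * (1 ⊗ₜ[ℤ] (1 / 12 : ℚ))

/-- The idempotent `𝔣₃ = (1 - [P₀]) (1 - 𝔣₁)` of the representation algebra. -/
def f₃ : RepAlgebra R G := (1 - cls P₀) * (1 - f₁)

end AltFour

end

open RepLattice AltFour

/-!
The lifts `Δ n` are built over `A₄` itself: starting from the trivial lattice, `liftNat (n + 1)` is
the kernel of a projective cover `coverMod n → liftNat n`, where `coverMod n` is one of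
`P₀ ⊕ Γ ^ k`, `P₁ ⊕ Γ ^ k`, `Γ ^ (k + 1)`. This gives the short exact sequences. Which cover occurs
is decided by numerical invariants that can be carried along the recursion (`IsHellerLift`): the
orders of `M / 2 M`, of the head `M / rad M` for the Klein four-group `H`, and of the parts of both
on which `b` acts trivially, together with the facts that the norm of `H` acts as zero and
`a₂ - 1` maps into the image of `a₁ - 1` modulo two. The recursion step is `IsHellerLift.step`, an
index computation in which the head of the kernel is identified through the norm map. Restricted to
`H`, the kernel is the Heller module, by Schanuel's lemma and cancellation: a larger free cover would
give a free summand, on which the norm is not zero modulo two.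

Cancellation and the uniqueness of the summands of the induced lattice are the Krull-Schmidt theorem
over the 2-adic integers. It rests on the completeness of `ℤ_[2]`: an endomorphism of an
indecomposable lattice generates a finite commutative algebra without nontrivial idempotents,
which is therefore local (`IsIndecomposable.bijective_or`).

The lattice induced from the restriction of `D` is `D ⊗ R[G/H] = D ⊕ D ⊗ O`, where `O` (`twoMod`) has
rank two. Both summands are indecomposable for the Heller lifts. Indeed, being stably local, that is,
having no nontrivial idempotents in the endomorphism ring modulo traces, passes between the ends of a
short exact sequence with projective middle term (`isStablyLocal_iff`), so it holds for all integers
once it holds for the trivial lattice and for `O`; and no nonzero idempotent is a trace, since the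
norm of `H` is divisible by two (`eq_zero_of_isTrace`).

The tensor product formulas compare `0 → Δ (n + 1) → coverMod n → Δ n → 0` with the sequence
`0 → Δ 1 → P₀ → R → 0` tensored with `Δ n`, again by Schanuel's lemma. In the representation algebra
the class of every projective lattice is annihilated by `f₃`, so the same comparison gives
`[Δ (n + 1)] f₃ = [Δ n] [Δ 1] f₃` for all integers `n`, the negative ones through the dual sequences,
and the general product formula follows by induction. Finally `O ⊗ O = R² ⊕ O` follows from
`R[G/H] ⊗ R[G/H] = R[G/H]³` by cancellation.
-/

noncomputable section

/-! ### Idempotents in finite algebras over the 2-adic integers -/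

lemma exists_pow_isIdempotentElem {S : Type*} [Monoid S] [Finite S] (x : S) :
    ∃ n, n ≠ 0 ∧ IsIdempotentElem (x ^ n) := by
  obtain ⟨a, b, hab, h⟩ : ∃ a b : ℕ, a < b ∧ x ^ a = x ^ b := by
    by_contra! hne
    exact not_injective_infinite_finite (fun n : ℕ => x ^ n) fun a b hab => by
      rcases lt_trichotomy a b with h | h | h
      · exact (hne _ _ h hab).elim
      · exact h
      · exact (hne _ _ h hab.symm).elim
  obtain ⟨p, rfl⟩ := Nat.exists_eq_add_of_lt hab
  have key : ∀ k m, a ≤ m → x ^ (m + k * (p + 1)) = x ^ m := by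
    intro k
    induction k with
    | zero => simp
    | succ k ih =>
      intro m hm
      obtain ⟨c, rfl⟩ := Nat.exists_eq_add_of_le hm
      have h1 : a + c + (k + 1) * (p + 1) = (a + p + 1) + (c + k * (p + 1)) := by ring
      rw [h1, pow_add, ← h, ← pow_add, ← add_assoc, ih _ hm]
  refine ⟨(a + 1) * (p + 1), by positivity, ?_⟩
  rw [IsIdempotentElem, ← pow_add]
  exact key (a + 1) _ (by nlinarith)

/-- A finite module over a complete local ring is complete. -/
lemma isAdicComplete_of_finite (V : Type*) [AddCommGroup V] [Module R V] [Module.Finite R V] :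
    IsAdicComplete (IsLocalRing.maximalIdeal R) V := by
  set I := IsLocalRing.maximalIdeal R
  have : IsPrecomplete I V := by
    rw [← AdicCompletion.of_surjective_iff]
    intro z
    obtain ⟨t, rfl⟩ := AdicCompletion.ofTensorProduct_surjective_of_finite I V z
    induction t with
    | zero => exact ⟨0, by simp⟩
    | add s t hs ht =>
      obtain ⟨a, ha⟩ := hs
      obtain ⟨b, hb⟩ := ht
      exact ⟨a + b, by simp [ha, hb]⟩
    | tmul r v =>
      obtain ⟨r, rfl⟩ := AdicCompletion.of_surjective I R r
      refine ⟨r • v, ?_⟩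
      rw [AdicCompletion.ofTensorProduct_tmul]
      ext n
      rfl
  exact { }

/-- A finite commutative algebra over the 2-adic integers whose only idempotents are `0` and `1`
is local: some power of `x` is idempotent modulo 2, and this idempotent lifts. -/
lemma isUnit_or_isUnit_one_sub_of_idempotents (A : Type*) [CommRing A] [Algebra R A]
    [Module.Finite R A] (hA : ∀ e : A, IsIdempotentElem e → e = 0 ∨ e = 1) (x : A) :
    IsUnit x ∨ IsUnit (1 - x) := by
  set m := IsLocalRing.maximalIdeal R
  set I : Ideal A := m.map (algebraMap R A)
  have hc : IsAdicComplete I A := by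
    have := isAdicComplete_of_finite A
    have hI : ∀ n, (m ^ n • ⊤ : Submodule R A) = (I ^ n • ⊤ : Submodule A A).restrictScalars R := by
      intro n
      rw [← Ideal.map_pow, smul_eq_mul, Ideal.mul_top, Ideal.smul_top_eq_map]
    refine { haus' := fun x hx => ?_, prec' := fun f hf => ?_ }
    · refine IsHausdorff.haus (I := m) inferInstance x fun n => ?_
      have := hx n
      rw [SModEq.zero] at this ⊢
      rw [hI]
      exact this
    · obtain ⟨L, hL⟩ := IsPrecomplete.prec (I := m) inferInstance (f := f) (fun {a b} hab => by
        have := hf hab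
        rw [SModEq.sub_mem] at this ⊢
        rw [hI]
        exact this)
      refine ⟨L, fun n => ?_⟩
      have := hL n
      rw [SModEq.sub_mem] at this ⊢
      rw [hI] at this
      exact this
  have hfin : Finite (A ⧸ I) := Module.finite_of_finite (R ⧸ m)
  obtain ⟨n, hn, hidem⟩ := exists_pow_isIdempotentElem (Ideal.Quotient.mk I x)
  have hsq : x ^ n * x ^ n - x ^ n ∈ I := by
    rw [← Ideal.Quotient.eq_zero_iff_mem]
    simpa [sub_eq_zero, IsIdempotentElem] using hidem
  obtain ⟨e, he, hex⟩ := HenselianRing.is_henselian (I := I) (Polynomial.X ^ 2 - Polynomial.X)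
    (by monicity!) (x ^ n) (by simpa [pow_two] using hsq) (by
      refine .of_mul_eq_one (Ideal.Quotient.mk I (2 * x ^ n - 1)) ?_
      rw [← map_mul, ← map_one (Ideal.Quotient.mk I), Ideal.Quotient.eq]
      simp only [Polynomial.derivative_sub, Polynomial.derivative_X_pow, Polynomial.derivative_X,
        Polynomial.eval_sub, Polynomial.eval_mul, Polynomial.eval_pow, Polynomial.eval_X,
        Polynomial.eval_one, Polynomial.eval_C]
      convert I.mul_mem_left 4 hsq using 1
      push_cast
      ring)
  have hjac : ∀ z ∈ I, IsUnit (1 + z) := fun z hz => by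
    have := HenselianRing.jac (I := I) hz
    rw [Ideal.mem_jacobson_bot] at this
    simpa [add_comm] using this 1
  have he' : IsIdempotentElem e := by
    have : e ^ 2 - e = 0 := by simpa [Polynomial.IsRoot] using he
    rw [IsIdempotentElem]
    linear_combination this
  rcases hA e he' with rfl | rfl
  · right
    have h1 : IsUnit (1 - x ^ n) := by
      convert hjac _ hex using 1
      ring
    refine isUnit_of_dvd_unit ?_ h1
    simpa using sub_dvd_pow_sub_pow 1 x n
  · left
    have h1 : IsUnit (x ^ n) := by
      convert hjac _ (I.neg_mem hex) using 1
      ring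
    exact (isUnit_pow_iff hn).1 h1

lemma LinearMap.isUnit_or_isUnit_one_sub {V : Type*} [AddCommGroup V] [Module R V]
    [Module.Finite R V] (f : V →ₗ[R] V)
    (h : ∀ e ∈ Algebra.adjoin R {f}, IsIdempotentElem e → e = 0 ∨ e = 1) :
    IsUnit f ∨ IsUnit (1 - f) := by
  have : IsMulCommutative (Algebra.adjoin R {f}) :=
    Algebra.isMulCommutative_adjoin R (by simp)
  have hfin : Module.Finite R (Algebra.adjoin R {f}) :=
    inferInstanceAs (Module.Finite R (Subalgebra.toSubmodule (Algebra.adjoin R {f})))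
  let x : Algebra.adjoin R {f} := ⟨f, Algebra.self_mem_adjoin_singleton R f⟩
  have key := isUnit_or_isUnit_one_sub_of_idempotents (Algebra.adjoin R {f}) (fun e he => by
    have h1 := h e e.2 (by
      have := congrArg Subtype.val he.eq
      exact this)
    exact h1.imp (fun h => Subtype.ext h) (fun h => Subtype.ext h)) x
  exact key.imp (fun h => h.map (Algebra.adjoin R {f}).val) fun h =>
    h.map (Algebra.adjoin R {f}).val

namespace RepLattice

/-! ### Unique decomposition of lattices -/

section Basic

variable {A : Type} {G' : Type} [CommRing A] [Group G']

lemma iso_refl (M : RepLattice A G') : M.Iso M := ⟨.refl _⟩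

lemma Iso.symm {M N : RepLattice A G'} (h : M.Iso N) : N.Iso M := h.map fun e => e.symm

lemma Iso.trans {L M N : RepLattice A G'} (h : L.Iso M) (h' : M.Iso N) : L.Iso N :=
  h.elim fun e => h'.map fun f => e.trans f

lemma Iso.sum {M N M' N' : RepLattice A G'} (h : M.Iso M') (h' : N.Iso N') :
    (M.sum N).Iso (M'.sum N') := h.elim fun e => h'.map fun f => prodCongr e f

lemma Iso.tensor {M N M' N' : RepLattice A G'} (h : M.Iso M') (h' : N.Iso N') :
    (M.tensor N).Iso (M'.tensor N') := h.elim fun e => h'.map fun f => tensorCongr e f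

lemma Iso.finrank_eq {M N : RepLattice A G'} (h : M.Iso N) :
    Module.finrank A M.V = Module.finrank A N.V := h.elim fun e => e.toLinearEquiv.finrank_eq

lemma iso_of_inverse {M N : RepLattice A G'} (f : M.ρ.IntertwiningMap N.ρ)
    (g : N.ρ.IntertwiningMap M.ρ) (hgf : ∀ x, g (f x) = x) (hfg : ∀ y, f (g y) = y) :
    M.Iso N :=
  ⟨.mk (LinearEquiv.ofLinearMap f.toLinearMap g.toLinearMap (LinearMap.ext hfg) (LinearMap.ext hgf))
    f.isIntertwining'⟩

lemma iso_of_bijective {M N : RepLattice A G'} (f : M.ρ.IntertwiningMap N.ρ)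
    (hf : Function.Bijective f) : M.Iso N :=
  ⟨.mk (LinearEquiv.ofBijective f.toLinearMap hf) f.isIntertwining'⟩

/-- The intertwining map given by a linear map that commutes with the actions. -/
def hom {M N : RepLattice A G'} (f : M.V →ₗ[A] N.V) (hf : ∀ g x, f (M.ρ g x) = N.ρ g (f x)) :
    M.ρ.IntertwiningMap N.ρ := ⟨f, fun g => LinearMap.ext (hf g)⟩

/-- The lattice of an invariant submodule. -/
abbrev ofSub [IsDomain A] [IsPrincipalIdealRing A] (M : RepLattice A G')
    (W : Subrepresentation M.ρ) : RepLattice A G' where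
  V := W.toSubmodule
  ρ := W.toRepresentation

end Basic

variable {G' : Type} [Group G']

lemma iso_of_surjective {M N : RepLattice R G'} (f : M.ρ.IntertwiningMap N.ρ)
    (hf : Function.Surjective f) (h : Module.finrank R M.V = Module.finrank R N.V) : M.Iso N := by
  refine iso_of_bijective f ⟨?_, hf⟩
  have e : N.V ≃ₗ[R] M.V := LinearEquiv.ofFinrankEq _ _ h.symm
  have h1 : Function.Injective (e.toLinearMap ∘ₗ f.toLinearMap) :=
    OrzechProperty.injective_of_surjective_endomorphism _ (e.surjective.comp hf)
  exact Function.Injective.of_comp (f := e) h1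

/-- An idempotent endomorphism splits a lattice. -/
lemma iso_range_sum_ker {M : RepLattice R G'} (e : M.ρ.IntertwiningMap M.ρ)
    (he : ∀ x, e (e x) = e x) : M.Iso ((M.ofSub e.range).sum (M.ofSub e.ker)) := by
  have hker : ∀ x, x - e x ∈ e.ker.toSubmodule := fun x => by
    change e (x - e x) = 0
    rw [map_sub, he, sub_self]
  let r : M.V →ₗ[R] e.range.toSubmodule := e.toLinearMap.codRestrict _ fun x => ⟨x, rfl⟩
  let s : M.V →ₗ[R] e.ker.toSubmodule := (LinearMap.id - e.toLinearMap).codRestrict _ hker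
  refine iso_of_inverse (N := (M.ofSub e.range).sum (M.ofSub e.ker)) (hom (r.prod s) fun g x => ?_)
    (hom (LinearMap.coprod e.range.toSubmodule.subtype e.ker.toSubmodule.subtype) fun g x => ?_)
    (fun x => ?_) fun y => ?_
  · refine Prod.ext (Subtype.ext ?_) (Subtype.ext ?_)
    · exact e.isIntertwining _ _ g x
    · change M.ρ g x - e (M.ρ g x) = M.ρ g (x - e x)
      rw [e.isIntertwining, map_sub]
  · exact (map_add (M.ρ g) _ _).symm
  · change e x + (x - e x) = x
    abel
  · obtain ⟨⟨_, a, rfl⟩, ⟨c, hc⟩⟩ := y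
    have hc : e c = 0 := hc
    have h1 : e (e a + c) = e a := by rw [map_add, he, hc, add_zero]
    refine Prod.ext (Subtype.ext ?_) (Subtype.ext ?_)
    · exact h1
    · change (e a + c) - e (e a + c) = c
      rw [h1]
      abel

lemma IsIndecomposable.idempotent {M : RepLattice R G'} (hM : M.IsIndecomposable)
    (e : M.ρ.IntertwiningMap M.ρ) (he : ∀ x, e (e x) = e x) :
    (∀ x, e x = 0) ∨ (∀ x, e x = x) := by
  rcases hM.2 _ _ (iso_range_sum_ker e he) with h | h
  · left
    intro x
    have := h.elim ⟨e x, x, rfl⟩ (0 : e.range.toSubmodule)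
    exact congrArg Subtype.val this
  · right
    intro x
    have := h.elim ⟨x - e x, by change e (x - e x) = 0; rw [map_sub, he, sub_self]⟩
      (0 : e.ker.toSubmodule)
    exact (sub_eq_zero.1 (congrArg Subtype.val this)).symm

/-- The endomorphism ring of an indecomposable lattice is local. -/
lemma IsIndecomposable.bijective_or {M : RepLattice R G'} (hM : M.IsIndecomposable)
    (f : M.ρ.IntertwiningMap M.ρ) :
    Function.Bijective f ∨ Function.Bijective (fun x => x - f x) := by
  have key := LinearMap.isUnit_or_isUnit_one_sub f.toLinearMap (fun e he hidem => by
    have hcomm : ∀ g, M.ρ g * e = e * M.ρ g := by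
      have hle : Algebra.adjoin R {f.toLinearMap} ≤
          Subalgebra.centralizer R (Set.range M.ρ) := by
        rw [Algebra.adjoin_le_iff, Set.singleton_subset_iff, SetLike.mem_coe,
          Subalgebra.mem_centralizer_iff]
        rintro _ ⟨g, rfl⟩
        exact (f.isIntertwining' g).symm
      intro g
      exact (Subalgebra.mem_centralizer_iff R).1 (hle he) _ ⟨g, rfl⟩
    rcases hM.idempotent (hom e fun g x => (LinearMap.congr_fun (hcomm g) x).symm)
      (fun x => LinearMap.congr_fun hidem.eq x) with h | h
    · exact Or.inl (LinearMap.ext h)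
    · exact Or.inr (LinearMap.ext h))
  rw [Module.End.isUnit_iff, Module.End.isUnit_iff] at key
  exact key

lemma IsIndecomposable.iso_of_retract {D M : RepLattice R G'} (hM : M.IsIndecomposable)
    [Nontrivial D.V] (i : D.ρ.IntertwiningMap M.ρ) (p : M.ρ.IntertwiningMap D.ρ)
    (h : Function.Bijective fun x => p (i x)) : D.Iso M := by
  obtain ⟨q, hq⟩ : ∃ q : M.ρ.IntertwiningMap D.ρ, ∀ x, q (i x) = x := by
    let e : D.ρ.Equiv D.ρ := .mk (LinearEquiv.ofBijective (p.comp i).toLinearMap h)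
      (p.comp i).isIntertwining'
    exact ⟨e.symm.toIntertwiningMap.comp p, fun x => e.symm_apply_apply x⟩
  rcases hM.idempotent (i.comp q) (fun x => by simp [hq]) with h0 | h1
  · obtain ⟨x, hx⟩ := exists_ne (0 : D.V)
    have : i x = 0 := by simpa [hq] using h0 (i x)
    exact absurd (by rw [← hq x, this, map_zero]) hx
  · exact iso_of_inverse i q hq h1

/-- An indecomposable summand of a sum of two indecomposable lattices is one of them. -/
lemma IsIndecomposable.iso_or_iso {D E M N : RepLattice R G'} (hD : D.IsIndecomposable)
    (hM : M.IsIndecomposable) (hN : N.IsIndecomposable) (h : (D.sum E).Iso (M.sum N)) :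
    D.Iso M ∨ D.Iso N := by
  obtain ⟨φ⟩ := h
  have := hD.1
  let i := φ.toIntertwiningMap.comp (.inl R D.ρ E.ρ)
  let p := (Representation.IntertwiningMap.fst R D.ρ E.ρ).comp φ.symm.toIntertwiningMap
  have hpi : ∀ x, p (i x) = x := fun x => by
    change (φ.symm (φ (x, 0))).1 = x
    rw [φ.symm_apply_apply]
  let i₁ := (Representation.IntertwiningMap.fst R M.ρ N.ρ).comp i
  let i₂ := (Representation.IntertwiningMap.snd R M.ρ N.ρ).comp i
  let p₁ := p.comp (.inl R M.ρ N.ρ)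
  let p₂ := p.comp (.inr R M.ρ N.ρ)
  have hsum : ∀ x, p₁ (i₁ x) + p₂ (i₂ x) = x := fun x => by
    change p ((i x).1, 0) + p (0, (i x).2) = x
    rw [← map_add, Prod.mk_add_mk, add_zero, zero_add, Prod.mk.eta, hpi]
  rcases hD.bijective_or (p₁.comp i₁) with h | h
  · exact Or.inl (hM.iso_of_retract i₁ p₁ h)
  · refine Or.inr (hN.iso_of_retract i₂ p₂ ?_)
    convert h using 2 with x
    exact eq_sub_of_add_eq' (hsum x)

/-- The Schur complement: an isomorphism `A ⊕ X ≅ B ⊕ X` whose component `X → X` is invertible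
gives `A ≅ B`. -/
lemma iso_of_sum_iso_of_bijective {M N X : RepLattice R G'} (φ : (M.sum X).ρ.Equiv (N.sum X).ρ)
    (h : Function.Bijective fun x : X.V => (φ (0, x)).2) : M.Iso N := by
  let d : X.ρ.Equiv X.ρ := .mk (LinearEquiv.ofBijective
    ((Representation.IntertwiningMap.snd R N.ρ X.ρ).comp
      (φ.toIntertwiningMap.comp (.inr R M.ρ X.ρ))).toLinearMap h)
      ((Representation.IntertwiningMap.snd R N.ρ X.ρ).comp
      (φ.toIntertwiningMap.comp (.inr R M.ρ X.ρ))).isIntertwining'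
  have hd : ∀ x, d x = (φ (0, x)).2 := fun _ => rfl
  let z : M.ρ.IntertwiningMap X.ρ := -(d.symm.toIntertwiningMap.comp
    ((Representation.IntertwiningMap.snd R N.ρ X.ρ).comp
      (φ.toIntertwiningMap.comp (.inl R M.ρ X.ρ))))
  have hsplit : ∀ m x, φ (m, x) = φ (m, 0) + φ (0, x) := fun m x => by
    rw [← map_add]; simp
  have hz : ∀ m, (φ (m, z m)).2 = 0 := fun m => by
    rw [hsplit, Prod.snd_add, ← hd]
    change _ + d (-(d.symm (φ (m, 0)).2)) = 0
    rw [map_neg, d.apply_symm_apply, add_neg_cancel]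
  have hz' : ∀ m x, (φ (m, x)).2 = 0 → x = z m := fun m x hx => by
    have h1 := hz m
    rw [hsplit, Prod.snd_add, ← hd] at h1 hx
    exact d.injective (add_left_cancel (hx.trans h1.symm))
  refine iso_of_inverse
    ((Representation.IntertwiningMap.fst R N.ρ X.ρ).comp (φ.toIntertwiningMap.comp
      (Representation.IntertwiningMap.prod (.id _) z)))
    ((Representation.IntertwiningMap.fst R M.ρ X.ρ).comp (φ.symm.toIntertwiningMap.comp
      (.inl R N.ρ X.ρ))) (fun m => ?_) fun n => ?_
  · change (φ.symm ((φ (m, z m)).1, 0)).1 = m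
    rw [← hz m, Prod.mk.eta, φ.symm_apply_apply]
  · change (φ ((φ.symm (n, 0)).1, z (φ.symm (n, 0)).1)).1 = n
    rw [← hz' (φ.symm (n, 0)).1 (φ.symm (n, 0)).2 (by rw [Prod.mk.eta, φ.apply_symm_apply]),
      Prod.mk.eta, φ.apply_symm_apply]

lemma IsIndecomposable.cancel {M N X : RepLattice R G'} (hX : X.IsIndecomposable)
    (h : (M.sum X).Iso (N.sum X)) : M.Iso N := by
  obtain ⟨φ⟩ := h
  by_cases hd : Function.Bijective fun x : X.V => (φ (0, x)).2
  · exact iso_of_sum_iso_of_bijective φ hd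
  let c := (Representation.IntertwiningMap.snd R N.ρ X.ρ).comp
      (φ.toIntertwiningMap.comp (.inl R M.ρ X.ρ))
  let d := (Representation.IntertwiningMap.snd R N.ρ X.ρ).comp
      (φ.toIntertwiningMap.comp (.inr R M.ρ X.ρ))
  let t := (Representation.IntertwiningMap.fst R M.ρ X.ρ).comp
      (φ.symm.toIntertwiningMap.comp (.inr R N.ρ X.ρ))
  let s := (Representation.IntertwiningMap.snd R M.ρ X.ρ).comp
      (φ.symm.toIntertwiningMap.comp (.inr R N.ρ X.ρ))
  have hsplit : ∀ m x, φ (m, x) = φ (m, 0) + φ (0, x) := fun m x => by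
    rw [← map_add]; simp
  have hsum : ∀ x, c (t x) + d (s x) = x := fun x => by
    change (φ ((φ.symm (0, x)).1, 0)).2 + (φ (0, (φ.symm (0, x)).2)).2 = x
    rw [← Prod.snd_add, ← hsplit, Prod.mk.eta, φ.apply_symm_apply]
  have hd' : ¬ Function.Surjective d := fun h =>
    hd ⟨OrzechProperty.injective_of_surjective_endomorphism d.toLinearMap h, h⟩
  have hct : Function.Bijective (c.comp t) := by
    rcases hX.bijective_or (d.comp s) with h | h
    · exact absurd (fun y => (h.2 y).imp' s fun _ hx => hx) hd'
    · convert h using 1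
      funext x
      exact eq_sub_of_add_eq (hsum x)
  let e : X.ρ.Equiv X.ρ := .mk (LinearEquiv.ofBijective (c.comp t).toLinearMap hct)
    (c.comp t).isIntertwining'
  have hunit : Function.Bijective fun x => c (t x) + d x := by
    rcases hX.bijective_or (-(e.symm.toIntertwiningMap.comp d)) with h | h
    · refine absurd (fun y => ?_) hd'
      obtain ⟨x, hx⟩ := h.2 (e.symm y)
      refine ⟨-x, ?_⟩
      have hx : -(e.symm (d x)) = e.symm y := hx
      rw [← map_neg, ← map_neg] at hx
      exact e.symm.injective hx
    · convert e.bijective.comp h using 1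
      funext x
      change e x + d x = e (x - -(e.symm (d x)))
      rw [sub_neg_eq_add, map_add, e.apply_symm_apply]
  -- composing with an elementary automorphism of `M ⊕ X` makes the component `X → X` invertible
  let ε : (M.sum X).ρ.Equiv (M.sum X).ρ := .mk
    (LinearEquiv.ofLinearMap
      ((LinearMap.fst R M.V X.V + t.toLinearMap ∘ₗ LinearMap.snd R M.V X.V).prod
        (LinearMap.snd R M.V X.V))
      ((LinearMap.fst R M.V X.V - t.toLinearMap ∘ₗ LinearMap.snd R M.V X.V).prod
        (LinearMap.snd R M.V X.V))
      (by ext <;> simp) (by ext <;> simp)) (fun g => by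
        refine LinearMap.ext fun x => Prod.ext ?_ rfl
        change M.ρ g x.1 + t (X.ρ g x.2) = M.ρ g (x.1 + t x.2)
        rw [t.isIntertwining, map_add])
  refine iso_of_sum_iso_of_bijective (ε.trans φ) ?_
  convert hunit using 1
  funext y
  change (φ (0 + t y, y)).2 = _
  rw [zero_add, hsplit]
  rfl

lemma iso_sum_of_subsingleton (M X : RepLattice R G') [Subsingleton X.V] : (M.sum X).Iso M :=
  iso_of_inverse (.fst R M.ρ X.ρ) (.inl R M.ρ X.ρ)
    (fun _ => Prod.ext rfl (Subsingleton.elim _ _)) fun _ => rfl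

lemma sum_cancel (X : RepLattice R G') :
    ∀ {M N : RepLattice R G'}, (M.sum X).Iso (N.sum X) → M.Iso N := by
  induction h : Module.finrank R X.V using Nat.strong_induction_on generalizing X with
  | _ r ih =>
  intro M N hMN
  subst h
  rcases subsingleton_or_nontrivial X.V with hs | hs
  · exact ((iso_sum_of_subsingleton M X).symm.trans hMN).trans (iso_sum_of_subsingleton N X)
  by_cases hX : X.IsIndecomposable
  · exact hX.cancel hMN
  · rw [IsIndecomposable, not_and] at hX
    have := hX hs
    push Not at this
    obtain ⟨A, B, hAB, hA, hB⟩ := this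
    have hr : Module.finrank R X.V = Module.finrank R A.V + Module.finrank R B.V := by
      rw [hAB.finrank_eq, Module.finrank_prod]
    have hA' : 0 < Module.finrank R A.V := Module.finrank_pos
    have hB' : 0 < Module.finrank R B.V := Module.finrank_pos
    refine ih _ (by omega) A rfl (ih _ (by omega) B rfl ?_)
    rw [← isoClass_eq_iff] at hMN hAB ⊢
    simp only [isoClass_sum] at hMN hAB ⊢
    rw [add_assoc, add_assoc, ← hAB, hMN]

/-- Lattices over the 2-adic integers may be cancelled from direct sums. -/
instance : IsCancelAdd (IsoClass R G') :=
  have : IsRightCancelAdd (IsoClass R G') := ⟨by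
    rintro ⟨X⟩ ⟨M⟩ ⟨N⟩ h
    exact Quotient.sound (sum_cancel X (Quotient.exact h))⟩
  AddCommMagma.IsRightCancelAdd.toIsCancelAdd _

end RepLattice

namespace RepLattice

/-! ### Short exact sequences and projective lattices -/

section Exact

variable {k : Type} {G' : Type} [CommRing k] [Group G']

/-- A short exact sequence of lattices splits over the ground ring. -/
lemma IsShortExact.split {M Q N : RepLattice k G'} (h : IsShortExact M Q N) :
    ∃ (i : M.ρ.IntertwiningMap Q.ρ) (p : Q.ρ.IntertwiningMap N.ρ) (r : Q.V →ₗ[k] M.V)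
      (s : N.V →ₗ[k] Q.V), (∀ x, r (i x) = x) ∧ (∀ x, p (s x) = x) ∧
      (∀ x, i (r x) + s (p x) = x) ∧ ∀ x, p (i x) = 0 := by
  obtain ⟨i, p, hi, hip, hp⟩ := h
  obtain ⟨s, hs⟩ := Module.projective_lifting_property p.toLinearMap LinearMap.id hp
  have hs : ∀ x, p (s x) = x := fun x => LinearMap.congr_fun hs x
  have hr : ∀ x, ∃ y, i y = x - s (p x) := fun x => by
    rw [← Set.mem_range, ← hip, map_sub, hs, sub_self]
  choose r hr using hr
  refine ⟨i, p, ⟨⟨r, fun x y => hi ?_⟩, fun c x => hi ?_⟩, s, fun x => hi ?_, hs, fun x => ?_,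
    fun x => (hip _).2 ⟨x, rfl⟩⟩
  · simp only [map_add, hr]; abel
  · simp only [map_smul, hr, smul_sub, RingHom.id_apply]
  · change i (r (i x)) = _
    rw [hr, (hip (i x)).2 ⟨x, rfl⟩, map_zero, sub_zero]
  · change i (r x) + _ = _
    rw [hr, sub_add_cancel]

lemma isShortExact_of_split {M Q N : RepLattice k G'} (i : M.ρ.IntertwiningMap Q.ρ)
    (p : Q.ρ.IntertwiningMap N.ρ) (r : Q.V →ₗ[k] M.V) (s : N.V →ₗ[k] Q.V)
    (hr : ∀ x, r (i x) = x) (hs : ∀ x, p (s x) = x) (hrs : ∀ x, i (r x) + s (p x) = x)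
    (hpi : ∀ x, p (i x) = 0) : IsShortExact M Q N :=
  ⟨i, p, fun x y h => by rw [← hr x, h, hr], fun x => ⟨fun h => ⟨r x, by
    simpa [h] using hrs x⟩, fun ⟨y, hy⟩ => hy ▸ hpi y⟩, fun x => ⟨s x, hs x⟩⟩

lemma IsShortExact.congr {M Q N M' Q' N' : RepLattice k G'} (h : IsShortExact M Q N)
    (hM : M.Iso M') (hQ : Q.Iso Q') (hN : N.Iso N') : IsShortExact M' Q' N' := by
  obtain ⟨i, p, hi, hip, hp⟩ := h
  obtain ⟨a⟩ := hM
  obtain ⟨b⟩ := hQ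
  obtain ⟨c⟩ := hN
  refine ⟨b.toIntertwiningMap.comp (i.comp a.symm.toIntertwiningMap),
    c.toIntertwiningMap.comp (p.comp b.symm.toIntertwiningMap),
    b.injective.comp (hi.comp a.symm.injective), fun x => ?_,
    c.surjective.comp (hp.comp b.symm.surjective)⟩
  change c (p (b.symm x)) = 0 ↔ ∃ y, b (i (a.symm y)) = x
  rw [map_eq_zero_iff c c.injective, hip]
  constructor
  · rintro ⟨y, hy⟩
    exact ⟨a y, by rw [a.symm_apply_apply, hy, b.apply_symm_apply]⟩
  · rintro ⟨y, rfl⟩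
    exact ⟨a.symm y, by rw [b.symm_apply_apply]⟩

lemma IsShortExact.tensor {M Q N : RepLattice k G'} (h : IsShortExact M Q N)
    (X : RepLattice k G') : IsShortExact (M.tensor X) (Q.tensor X) (N.tensor X) := by
  obtain ⟨i, p, r, s, hr, hs, hrs, hpi⟩ := h.split
  have key : ∀ {U W : Type} [AddCommGroup U] [AddCommGroup W] [Module k U] [Module k W]
      (f g : U ⊗[k] X.V →ₗ[k] W), (∀ u x, f (u ⊗ₜ x) = g (u ⊗ₜ x)) → ∀ t, f t = g t :=
    fun f g hfg t => LinearMap.congr_fun (TensorProduct.ext' hfg) t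
  refine isShortExact_of_split (i.tensor (.id X.ρ)) (p.tensor (.id X.ρ)) (r.rTensor X.V)
    (s.rTensor X.V) (key (r.rTensor X.V ∘ₗ i.toLinearMap.rTensor X.V) LinearMap.id fun u x => ?_)
    (key (p.toLinearMap.rTensor X.V ∘ₗ s.rTensor X.V) LinearMap.id fun u x => ?_)
    (key (i.toLinearMap.rTensor X.V ∘ₗ r.rTensor X.V + s.rTensor X.V ∘ₗ p.toLinearMap.rTensor X.V)
      LinearMap.id fun u x => ?_)
    (key (p.toLinearMap.rTensor X.V ∘ₗ i.toLinearMap.rTensor X.V) 0 fun u x => ?_)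
  · exact congrArg (· ⊗ₜ x) (hr u)
  · exact congrArg (· ⊗ₜ x) (hs u)
  · change i (r u) ⊗ₜ x + s (p u) ⊗ₜ x = u ⊗ₜ x
    rw [← TensorProduct.add_tmul, hrs]
  · change p (i u) ⊗ₜ x = 0
    rw [hpi, TensorProduct.zero_tmul]

/-- The transpose of an intertwining map. -/
def transpose {M N : RepLattice k G'} (f : M.ρ.IntertwiningMap N.ρ) :
    N.dual.ρ.IntertwiningMap M.dual.ρ :=
  hom (M := N.dual) (N := M.dual) f.toLinearMap.dualMap fun g φ => LinearMap.ext fun x =>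
    congrArg φ (f.isIntertwining _ _ g⁻¹ x).symm

lemma IsShortExact.dual {M Q N : RepLattice k G'} (h : IsShortExact M Q N) :
    IsShortExact N.dual Q.dual M.dual := by
  obtain ⟨i, p, r, s, hr, hs, hrs, hpi⟩ := h.split
  refine isShortExact_of_split (transpose p) (transpose i) s.dualMap r.dualMap
    (fun φ => LinearMap.ext fun x => ?_) (fun φ => LinearMap.ext fun x => ?_)
    (fun φ => LinearMap.ext fun x => ?_) (fun φ => LinearMap.ext fun x => ?_)
  · exact congrArg φ (hs x)
  · exact congrArg φ (hr x)
  · change φ (s (p x)) + φ (i (r x)) = φ x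
    rw [← map_add, add_comm, hrs]
  · change φ (p (i x)) = 0
    rw [hpi, map_zero]

lemma Iso.dual {M N : RepLattice k G'} (h : M.Iso N) : M.dual.Iso N.dual := by
  obtain ⟨e⟩ := h
  refine iso_of_inverse (M := M.dual) (N := N.dual) (transpose e.symm.toIntertwiningMap)
    (transpose e.toIntertwiningMap) (fun φ => LinearMap.ext fun x => ?_)
    fun φ => LinearMap.ext fun x => ?_
  · exact congrArg φ (e.symm_apply_apply x)
  · exact congrArg φ (e.apply_symm_apply x)

lemma dual_sum (M N : RepLattice k G') : (M.sum N).dual.Iso (M.dual.sum N.dual) := by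
  refine iso_of_inverse (M := (M.sum N).dual) (N := M.dual.sum N.dual)
    ((transpose (.inl k M.ρ N.ρ)).prod (transpose (.inr k M.ρ N.ρ)))
    ((transpose (.fst k M.ρ N.ρ)).comp (.fst k M.dual.ρ N.dual.ρ) +
      (transpose (.snd k M.ρ N.ρ)).comp (.snd k M.dual.ρ N.dual.ρ))
    (fun φ => LinearMap.ext fun x => ?_)
    fun φ => Prod.ext (LinearMap.ext fun x => ?_) (LinearMap.ext fun x => ?_)
  · change φ (x.1, 0) + φ (0, x.2) = φ x
    rw [← map_add]
    simp
  · change φ.1 x + φ.2 0 = φ.1 x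
    rw [map_zero, add_zero]
  · change φ.1 0 + φ.2 x = φ.2 x
    rw [map_zero, zero_add]

/-- A lattice is projective if homomorphisms from it lift along epimorphisms of lattices. -/
def IsProj (P : RepLattice k G') : Prop :=
  ∀ (M N : RepLattice k G') (f : M.ρ.IntertwiningMap N.ρ), Function.Surjective f →
    ∀ g : P.ρ.IntertwiningMap N.ρ, ∃ h : P.ρ.IntertwiningMap M.ρ, ∀ x, f (h x) = g x

lemma IsProj.of_retract {P Q : RepLattice k G'} (hQ : IsProj Q) (i : P.ρ.IntertwiningMap Q.ρ)
    (p : Q.ρ.IntertwiningMap P.ρ) (h : ∀ x, p (i x) = x) : IsProj P := fun M N f hf g => by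
  obtain ⟨t, ht⟩ := hQ M N f hf (g.comp p)
  refine ⟨t.comp i, fun x => ?_⟩
  change f (t (i x)) = g x
  rw [ht]
  exact congrArg g (h x)

lemma IsProj.of_iso {P Q : RepLattice k G'} (hQ : IsProj Q) (h : P.Iso Q) : IsProj P := by
  obtain ⟨e⟩ := h
  exact hQ.of_retract e.toIntertwiningMap e.symm.toIntertwiningMap e.symm_apply_apply

lemma IsProj.sum {P Q : RepLattice k G'} (hP : IsProj P) (hQ : IsProj Q) : IsProj (P.sum Q) :=
    fun M N f hf g => by
  obtain ⟨s, hs⟩ := hP M N f hf (g.comp (.inl k P.ρ Q.ρ))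
  obtain ⟨t, ht⟩ := hQ M N f hf (g.comp (.inr k P.ρ Q.ρ))
  refine ⟨s.comp (.fst k P.ρ Q.ρ) + t.comp (.snd k P.ρ Q.ρ), fun x => ?_⟩
  change f (s x.1 + t x.2) = g x
  rw [map_add, hs, ht]
  change g (x.1, 0) + g (0, x.2) = g x
  rw [← map_add]
  simp

lemma isProj_freeMod [Finite G'] (d : ℕ) : IsProj (freeMod k G' d) := fun M N f hf g => by
  choose s hs using fun i : Fin d => hf (g (Finsupp.single i (MonoidAlgebra.single 1 1)))
  refine ⟨Representation.freeLift M.ρ s, fun x => ?_⟩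
  have : f.comp (Representation.freeLift M.ρ s) = g := by
    ext i a
    have h1 := Representation.freeLift_single_single M.ρ i a 1 s
    have h2 : (Finsupp.single i (MonoidAlgebra.single a 1) : Fin d →₀ k[G']) =
        (freeMod k G' d).ρ a (Finsupp.single i (MonoidAlgebra.single 1 1)) := by
      simp
    change f (Representation.freeLift M.ρ s (Finsupp.single i (MonoidAlgebra.single a 1))) =
      g (Finsupp.single i (MonoidAlgebra.single a 1))
    rw [h1, one_smul, f.isIntertwining, hs, h2, g.isIntertwining]
  exact congrArg (fun h => h x) this

/-- Schanuel's lemma. -/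
lemma schanuel {A Q A' Q' M : RepLattice k G'} (hQ : IsProj Q) (hQ' : IsProj Q')
    (h : IsShortExact A Q M) (h' : IsShortExact A' Q' M) : (A.sum Q').Iso (A'.sum Q) := by
  obtain ⟨i, p, hi, hip, hp⟩ := h
  obtain ⟨i', p', hi', hip', hp'⟩ := h'
  obtain ⟨s, hs⟩ := hQ Q' M p' hp' p
  obtain ⟨s', hs'⟩ := hQ' Q M p hp p'
  have hpi : ∀ a, p (i a) = 0 := fun a => (hip _).2 ⟨a, rfl⟩
  have hpi' : ∀ a, p' (i' a) = 0 := fun a => (hip' _).2 ⟨a, rfl⟩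
  -- the pullback of `Q` and `Q'` over `M` is isomorphic to both sums
  have key : ∀ {B P B' P' : RepLattice k G'} (j : B.ρ.IntertwiningMap P.ρ)
      (q : P.ρ.IntertwiningMap M.ρ) (j' : B'.ρ.IntertwiningMap P'.ρ)
      (q' : P'.ρ.IntertwiningMap M.ρ), Function.Injective j' → Function.Exact j' q' →
      (∀ b, q (j b) = 0) → ∀ (t : P.ρ.IntertwiningMap P'.ρ) (t' : P'.ρ.IntertwiningMap P.ρ),
      (∀ x, q' (t x) = q x) → (∀ x, q (t' x) = q' x) →
      ∃ F : (B.sum P').ρ.IntertwiningMap (B'.sum P).ρ,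
        ∀ x, j' (F x).1 = x.2 - t (j x.1 + t' x.2) ∧ (F x).2 = j x.1 + t' x.2 := by
    intro B P B' P' j q j' q' hj' hjq' hqj t t' ht ht'
    have h1 : ∀ x : B.V × P'.V, ∃ y, j' y = x.2 - t (j x.1 + t' x.2) := fun x => by
      rw [← Set.mem_range, ← hjq', map_sub, ht, map_add, hqj, ht', zero_add, sub_self]
    choose y hy using h1
    let Y : B.V × P'.V →ₗ[k] B'.V := ⟨⟨y, fun a b => hj' (by
      simp only [map_add, hy, Prod.fst_add, Prod.snd_add]; abel)⟩, fun c a => hj' (by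
      simp only [map_add, map_smul, hy, Prod.smul_fst, Prod.smul_snd, RingHom.id_apply, smul_sub,
        smul_add])⟩
    refine ⟨hom (M := B.sum P') (N := B'.sum P)
      (Y.prod (j.toLinearMap.coprod t'.toLinearMap)) fun g x => Prod.ext (hj' ?_) ?_,
      fun x => ⟨hy x, rfl⟩⟩
    · change j' (y (B.ρ g x.1, P'.ρ g x.2)) = j' (B'.ρ g (y x))
      rw [j'.isIntertwining, hy, hy]
      simp only [map_sub, map_add, j.isIntertwining, t'.isIntertwining, t.isIntertwining]
    · change j (B.ρ g x.1) + t' (P'.ρ g x.2) = P.ρ g (j x.1 + t' x.2)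
      rw [j.isIntertwining, t'.isIntertwining, map_add]
  obtain ⟨F, hF⟩ := key i p i' p' hi' hip' hpi s s' hs hs'
  obtain ⟨F', hF'⟩ := key i' p' i p hi hip hpi' s' s hs' hs
  refine iso_of_inverse F F' (fun x => Prod.ext (hi ?_) ?_) fun x => Prod.ext (hi' ?_) ?_
  · rw [(hF' _).1, (hF x).1, (hF x).2]; simp
  · rw [(hF' _).2, (hF x).1, (hF x).2]; simp
  · rw [(hF _).1, (hF' x).1, (hF' x).2]; simp
  · rw [(hF _).2, (hF' x).1, (hF' x).2]; simp

end Exact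

/-! ### Traces and stable idempotents -/

section Trace

variable {k : Type} {G' : Type} [CommRing k] [Group G'] [Fintype G']

/-- The trace `∑ g ψ g⁻¹` of a linear map. -/
def tr {M N : RepLattice k G'} (ψ : M.V →ₗ[k] N.V) : M.ρ.IntertwiningMap N.ρ :=
  hom (∑ g, N.ρ g ∘ₗ ψ ∘ₗ M.ρ g⁻¹) fun h x => by
    simp only [LinearMap.sum_apply, LinearMap.comp_apply, map_sum]
    refine Fintype.sum_equiv (Equiv.mulLeft h⁻¹) _ _ fun g => ?_
    simp only [Equiv.coe_mulLeft, ← Module.End.mul_apply, ← map_mul]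
    simp

lemma tr_apply {M N : RepLattice k G'} (ψ : M.V →ₗ[k] N.V) (x : M.V) :
    tr ψ x = ∑ g, N.ρ g (ψ (M.ρ g⁻¹ x)) := by
  change (∑ g, N.ρ g ∘ₗ ψ ∘ₗ M.ρ g⁻¹) x = _
  simp

lemma comp_tr {L M N : RepLattice k G'} (f : M.ρ.IntertwiningMap N.ρ) (ψ : L.V →ₗ[k] M.V)
    (x : L.V) : f (tr ψ x) = tr (f.toLinearMap ∘ₗ ψ) x := by
  simp only [tr_apply, map_sum, f.isIntertwining]
  rfl

lemma tr_comp {L M N : RepLattice k G'} (ψ : M.V →ₗ[k] N.V) (f : L.ρ.IntertwiningMap M.ρ)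
    (x : L.V) : tr ψ (f x) = tr (ψ ∘ₗ f.toLinearMap) x := by
  simp only [tr_apply, ← f.isIntertwining]
  rfl

lemma tr_zero {M N : RepLattice k G'} (x : M.V) : tr (0 : M.V →ₗ[k] N.V) x = 0 := by
  simp [tr_apply]

/-- The maps that are zero in the stable category: those of the form `∑ g ψ g⁻¹`. -/
def IsTrace {M N : RepLattice k G'} (f : M.ρ.IntertwiningMap N.ρ) : Prop :=
  ∃ ψ : M.V →ₗ[k] N.V, ∀ x, f x = tr ψ x

lemma IsTrace.comp_left {L M N : RepLattice k G'} {f : L.ρ.IntertwiningMap M.ρ} (hf : IsTrace f)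
    (g : M.ρ.IntertwiningMap N.ρ) : IsTrace (g.comp f) := by
  obtain ⟨ψ, hψ⟩ := hf
  refine ⟨g.toLinearMap ∘ₗ ψ, fun x => ?_⟩
  rw [Representation.IntertwiningMap.comp_apply, hψ, comp_tr]

lemma IsTrace.comp_right {L M N : RepLattice k G'} {f : M.ρ.IntertwiningMap N.ρ} (hf : IsTrace f)
    (g : L.ρ.IntertwiningMap M.ρ) : IsTrace (f.comp g) := by
  obtain ⟨ψ, hψ⟩ := hf
  refine ⟨ψ ∘ₗ g.toLinearMap, fun x => ?_⟩
  rw [Representation.IntertwiningMap.comp_apply, hψ, tr_comp]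

/-- A lattice is relatively projective if its identity map is a trace. -/
def IsRelProj (Q : RepLattice k G') : Prop := IsTrace (.id Q.ρ)

lemma IsRelProj.isTrace {M Q N : RepLattice k G'} (hQ : IsRelProj Q)
    (f : Q.ρ.IntertwiningMap N.ρ) (g : M.ρ.IntertwiningMap Q.ρ) : IsTrace (f.comp g) :=
  (hQ.comp_left f).comp_right g

lemma isRelProj_freeMod (d : ℕ) : IsRelProj (freeMod k G' d) := by
  let c : k[G'] →ₗ[k] k[G'] := MonoidAlgebra.lsingle 1 ∘ₗ Finsupp.lapply 1 ∘ₗ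
    (MonoidAlgebra.coeffLinearEquiv k).toLinearMap
  refine ⟨Finsupp.mapRange.linearMap c, fun x => ?_⟩
  suffices h : Representation.IntertwiningMap.id (freeMod k G' d).ρ =
      tr (M := freeMod k G' d) (N := freeMod k G' d) (Finsupp.mapRange.linearMap c) by
    exact congrArg (fun h => h x) h
  ext i a : 4
  change (Finsupp.single i (MonoidAlgebra.single a 1) : Fin d →₀ k[G']) =
    tr (M := freeMod k G' d) (N := freeMod k G' d) (Finsupp.mapRange.linearMap c)
      (Finsupp.single i (MonoidAlgebra.single a 1))
  rw [tr_apply, Finset.sum_eq_single a]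
  · simp [c]
  · intro g _ hg
    have : g⁻¹ * a ≠ 1 := fun h => hg (by rw [← mul_left_cancel_iff (a := g⁻¹), h, inv_mul_cancel])
    simp [c, this]
  · simp

lemma IsProj.isRelProj {Q : RepLattice k G'} (hQ : IsProj Q) : IsRelProj Q := by
  obtain ⟨d, f, hf⟩ := Q.exists_isImageOfFree
  obtain ⟨s, hs⟩ := hQ _ _ f hf (.id _)
  obtain ⟨ψ, hψ⟩ := (isRelProj_freeMod (k := k) (G' := G') d).isTrace f s
  exact ⟨ψ, fun x => by rw [← hψ, ← hs x]; rfl⟩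

lemma IsRelProj.tensor {Q : RepLattice k G'} (hQ : IsRelProj Q) (X : RepLattice k G') :
    IsRelProj (Q.tensor X) := by
  obtain ⟨ψ, hψ⟩ := hQ
  refine ⟨ψ.rTensor X.V, fun t => ?_⟩
  induction t using TensorProduct.induction_on with
  | zero => simp
  | add a b ha hb => rw [map_add, map_add, ha, hb]
  | tmul q x =>
    have h1 := hψ q
    rw [tr_apply] at h1 ⊢
    have : ∀ g, (Q.tensor X).ρ g (ψ.rTensor X.V ((Q.tensor X).ρ g⁻¹ (q ⊗ₜ x))) =
        Q.ρ g (ψ (Q.ρ g⁻¹ q)) ⊗ₜ x := fun g => by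
      change Q.ρ g (ψ (Q.ρ g⁻¹ q)) ⊗ₜ (X.ρ g (X.ρ g⁻¹ x)) = _
      rw [← Module.End.mul_apply (X.ρ g), ← map_mul, mul_inv_cancel, map_one,
        Module.End.one_apply]
    simp only [this, ← TensorProduct.sum_tmul, ← h1]
    rfl

/-- Every endomorphism that is stably idempotent is stably zero or one. -/
def IsStablyLocal (M : RepLattice k G') : Prop :=
  ∀ f : M.ρ.IntertwiningMap M.ρ, IsTrace (f.comp f - f) → IsTrace f ∨ IsTrace (.id M.ρ - f)

/-- Endomorphisms of the ends of a short exact sequence with relatively projective middle term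
determine each other stably. -/
lemma isStablyLocal_iff {M Q N : RepLattice k G'} (hQ : IsRelProj Q) (h : IsShortExact M Q N) :
    IsStablyLocal M ↔ IsStablyLocal N := by
  obtain ⟨i, p, r, s, hr, hs, hrs, hpi⟩ := h.split
  have hi : Function.Injective i := fun x y h => by rw [← hr x, h, hr]
  have hlift : ∀ {C : RepLattice k G'} (g : C.ρ.IntertwiningMap Q.ρ), (∀ x, p (g x) = 0) →
      ∃ h : C.ρ.IntertwiningMap M.ρ, ∀ x, i (h x) = g x := fun {C} g hg => by
    have h1 : ∀ x, i (r (g x)) = g x := fun x => by simpa [hg] using hrs (g x)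
    refine ⟨hom (r ∘ₗ g.toLinearMap) fun a x => hi ?_, h1⟩
    change i (r (g (C.ρ a x))) = i (M.ρ a (r (g x)))
    rw [i.isIntertwining, h1, h1, g.isIntertwining]
  have hfac : ∀ {C : RepLattice k G'} (g : Q.ρ.IntertwiningMap C.ρ), (∀ x, g (i x) = 0) →
      ∃ h : N.ρ.IntertwiningMap C.ρ, ∀ x, h (p x) = g x := fun {C} g hg => by
    have h1 : ∀ x, g (s (p x)) = g x := fun x => by
      conv_rhs => rw [← hrs x, map_add, hg, zero_add]
    refine ⟨hom (g.toLinearMap ∘ₗ s) fun a x => ?_, h1⟩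
    obtain ⟨x, rfl⟩ : ∃ y, p y = x := ⟨s x, hs x⟩
    change g (s (N.ρ a (p x))) = C.ρ a (g (s (p x)))
    rw [← p.isIntertwining, h1, h1, g.isIntertwining]
  -- `f` and `f'` are linked if they are induced by one endomorphism of `Q`
  let Linked (f : M.ρ.IntertwiningMap M.ρ) (f' : N.ρ.IntertwiningMap N.ρ) : Prop :=
    ∃ F : Q.ρ.IntertwiningMap Q.ρ, (∀ x, F (i x) = i (f x)) ∧ ∀ x, p (F x) = f' (p x)
  have hsub : ∀ f f' e e', Linked f f' → Linked e e' → Linked (f - e) (f' - e') := by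
    rintro f f' e e' ⟨F, h1, h2⟩ ⟨E, h3, h4⟩
    exact ⟨F - E, fun x => by simp [h1, h3], fun x => by simp [h2, h4]⟩
  have hcomp : ∀ f f', Linked f f' → Linked (f.comp f) (f'.comp f') := by
    rintro f f' ⟨F, h1, h2⟩
    exact ⟨F.comp F, fun x => by simp [h1], fun x => by simp [h2]⟩
  have hid : Linked (.id _) (.id _) := ⟨.id _, fun _ => rfl, fun _ => rfl⟩
  have hex : ∀ f, ∃ f', Linked f f' := fun f => by
    obtain ⟨π, hπ⟩ := hQ
    let F : Q.ρ.IntertwiningMap Q.ρ := tr (π ∘ₗ i.toLinearMap ∘ₗ f.toLinearMap ∘ₗ r)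
    have hF : ∀ x, F (i x) = i (f x) := fun x => by
      rw [tr_comp]
      have : (π ∘ₗ i.toLinearMap ∘ₗ f.toLinearMap ∘ₗ r) ∘ₗ i.toLinearMap =
          π ∘ₗ (i.comp f).toLinearMap := LinearMap.ext fun y =>
        congrArg (fun z => π (i (f z))) (hr y)
      rw [this, ← tr_comp, ← hπ]
      rfl
    obtain ⟨f', hf'⟩ := hfac (p.comp F) fun x => by simp [hF, hpi]
    exact ⟨f', F, hF, fun x => (hf' x).symm⟩
  have hex' : ∀ f', ∃ f, Linked f f' := fun f' => by
    obtain ⟨π, hπ⟩ := hQ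
    let F : Q.ρ.IntertwiningMap Q.ρ := tr (s ∘ₗ f'.toLinearMap ∘ₗ p.toLinearMap ∘ₗ π)
    have hF : ∀ x, p (F x) = f' (p x) := fun x => by
      rw [comp_tr]
      have : p.toLinearMap ∘ₗ (s ∘ₗ f'.toLinearMap ∘ₗ p.toLinearMap ∘ₗ π) =
          (f'.comp p).toLinearMap ∘ₗ π := LinearMap.ext fun y => hs _
      rw [this, ← comp_tr, ← hπ]
      rfl
    obtain ⟨f, hf⟩ := hlift (F.comp i) fun x => by simp [hF, hpi]
    exact ⟨f, F, fun x => (hf x).symm, hF⟩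
  have htr : ∀ f f', Linked f f' → (IsTrace f ↔ IsTrace f') := by
    rintro f f' ⟨F, h1, h2⟩
    constructor
    · rintro ⟨ψ, hψ⟩
      obtain ⟨h, hh⟩ := hfac (F - tr (i.toLinearMap ∘ₗ ψ ∘ₗ r)) fun x => by
        have : (i.toLinearMap ∘ₗ ψ ∘ₗ r) ∘ₗ i.toLinearMap = i.toLinearMap ∘ₗ ψ :=
          LinearMap.ext fun y => congrArg (fun z => i (ψ z)) (hr y)
        simp only [Representation.IntertwiningMap.coe_sub, Pi.sub_apply]
        rw [h1, tr_comp, this, ← comp_tr, hψ, sub_self]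
      obtain ⟨χ, hχ⟩ := hQ.isTrace p h
      refine ⟨χ, fun y => ?_⟩
      obtain ⟨x, rfl⟩ : ∃ x, p x = y := ⟨s y, hs y⟩
      have : p.toLinearMap ∘ₗ (i.toLinearMap ∘ₗ ψ ∘ₗ r) = 0 := LinearMap.ext fun y => hpi _
      rw [← hχ, Representation.IntertwiningMap.comp_apply, hh]
      simp only [Representation.IntertwiningMap.coe_sub, Pi.sub_apply, map_sub]
      rw [h2, comp_tr, this, tr_zero, sub_zero]
    · rintro ⟨ψ, hψ⟩
      obtain ⟨h, hh⟩ := hlift (F - tr (s ∘ₗ ψ ∘ₗ p.toLinearMap)) fun x => by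
        have : p.toLinearMap ∘ₗ (s ∘ₗ ψ ∘ₗ p.toLinearMap) = ψ ∘ₗ p.toLinearMap :=
          LinearMap.ext fun y => hs _
        simp only [Representation.IntertwiningMap.coe_sub, Pi.sub_apply, map_sub]
        rw [h2, comp_tr, this, ← tr_comp, hψ, sub_self]
      obtain ⟨χ, hχ⟩ := hQ.isTrace h i
      refine ⟨χ, fun x => hi ?_⟩
      have : (s ∘ₗ ψ ∘ₗ p.toLinearMap) ∘ₗ i.toLinearMap = 0 := LinearMap.ext fun y => by
        change s (ψ (p (i y))) = 0
        rw [hpi, map_zero, map_zero]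
      rw [← hχ, Representation.IntertwiningMap.comp_apply, hh]
      simp only [Representation.IntertwiningMap.coe_sub, Pi.sub_apply]
      rw [h1, tr_comp, this, tr_zero, sub_zero]
  constructor
  · intro hM f' hf'
    obtain ⟨f, hl⟩ := hex' f'
    rw [← htr _ _ hl, ← htr _ _ (hsub _ _ _ _ hid hl)]
    exact hM f ((htr _ _ (hsub _ _ _ _ (hcomp _ _ hl) hl)).2 hf')
  · intro hN f hf
    obtain ⟨f', hl⟩ := hex f
    rw [htr _ _ hl, htr _ _ (hsub _ _ _ _ hid hl)]
    exact hN f' ((htr _ _ (hsub _ _ _ _ (hcomp _ _ hl) hl)).1 hf)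

end Trace

/-- An indecomposable lattice is stably local, since the traces form an ideal of its local
endomorphism ring. -/
lemma IsIndecomposable.isStablyLocal {G' : Type} [Group G'] [Fintype G'] {X : RepLattice R G'}
    (hX : X.IsIndecomposable) : IsStablyLocal X := by
  intro f hf
  rcases hX.bijective_or f with h | h
  · right
    let e : X.ρ.Equiv X.ρ := .mk (LinearEquiv.ofBijective f.toLinearMap h) f.isIntertwining'
    obtain ⟨ψ, hψ⟩ := hf.comp_left (-e.symm.toIntertwiningMap)
    refine ⟨ψ, fun x => ?_⟩
    rw [← hψ]
    change x - f x = -(e.symm (f (f x) - f x))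
    have : e (f x - x) = f (f x) - f x := map_sub f (f x) x
    rw [← this, e.symm_apply_apply]
    abel
  · left
    let e : X.ρ.Equiv X.ρ := .mk (LinearEquiv.ofBijective
      (Representation.IntertwiningMap.id X.ρ - f).toLinearMap h)
      (Representation.IntertwiningMap.id X.ρ - f).isIntertwining'
    obtain ⟨ψ, hψ⟩ := hf.comp_left (-e.symm.toIntertwiningMap)
    refine ⟨ψ, fun x => ?_⟩
    rw [← hψ]
    change f x = -(e.symm (f (f x) - f x))
    have : e (f x) = f x - f (f x) := rfl
    rw [← neg_sub, ← this, map_neg, e.symm_apply_apply, neg_neg]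

end RepLattice

/-! ### Indices of submodules of lattices over the 2-adic integers -/

lemma PadicInt.two_dvd_or_two_dvd_sub_one (r : R) : (2 : R) ∣ r ∨ (2 : R) ∣ r - 1 := by
  have key : ∀ s : R, (2 : R) ∣ s ↔ PadicInt.toZMod s = 0 := fun s => by
    rw [← RingHom.mem_ker, PadicInt.ker_toZMod, PadicInt.maximalIdeal_eq_span_p,
      Ideal.mem_span_singleton]
    rfl
  rw [key, key, map_sub, map_one]
  generalize PadicInt.toZMod r = s
  revert s
  decide

lemma PadicInt.not_two_dvd_one : ¬ (2 : R) ∣ 1 := fun h => by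
  have := PadicInt.irreducible_p (p := 2)
  exact this.not_isUnit (isUnit_of_dvd_one (by exact_mod_cast h))

namespace Submodule

variable {V W : Type} [AddCommGroup V] [Module R V] [AddCommGroup W] [Module R W]

/-- The index of a submodule. -/
def idx (A : Submodule R V) : ℕ := A.toAddSubgroup.index

/-- The index of `A ⊓ B` in `B`. -/
def relIdx (A B : Submodule R V) : ℕ := A.toAddSubgroup.relIndex B.toAddSubgroup

variable (V) in
/-- The submodule `2V`. -/
def dbl : Submodule R V := LinearMap.range ((2 : R) • (LinearMap.id : V →ₗ[R] V))

lemma mem_dbl {v : V} : v ∈ dbl V ↔ ∃ u, (2 : R) • u = v := Iff.rfl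

lemma two_smul_mem_dbl (v : V) : (2 : R) • v ∈ dbl V := ⟨v, rfl⟩

lemma map_dbl_le (f : V →ₗ[R] W) : (dbl V).map f ≤ dbl W := by
  rintro _ ⟨_, ⟨v, rfl⟩, rfl⟩
  exact ⟨f v, (map_smul f 2 v).symm⟩

lemma map_mem_dbl (f : V →ₗ[R] W) {v : V} (hv : v ∈ dbl V) : f v ∈ dbl W :=
  map_dbl_le f ⟨v, hv, rfl⟩

lemma map_dbl_of_surjective (f : V →ₗ[R] W) (hf : Function.Surjective f) :
    (dbl V).map f = dbl W := by
  refine le_antisymm (map_dbl_le f) ?_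
  rintro _ ⟨w, rfl⟩
  obtain ⟨v, rfl⟩ := hf w
  exact ⟨_, ⟨v, rfl⟩, map_smul f 2 v⟩

lemma relIdx_mul_idx {A B : Submodule R V} (h : A ≤ B) : A.relIdx B * B.idx = A.idx :=
  AddSubgroup.relIndex_mul_index h

lemma relIdx_mul_relIdx {A B C : Submodule R V} (h : A ≤ B) (h' : B ≤ C) :
    A.relIdx B * B.relIdx C = A.relIdx C :=
  AddSubgroup.relIndex_mul_relIndex _ _ _ h h'

lemma relIdx_sup (A B : Submodule R V) : A.relIdx (B ⊔ A) = A.relIdx B := by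
  rw [relIdx, sup_toAddSubgroup, AddSubgroup.relIndex_sup_right, relIdx]

lemma idx_comap (f : V →ₗ[R] W) (B : Submodule R W) :
    (B.comap f).idx = B.relIdx (LinearMap.range f) :=
  AddSubgroup.index_comap B.toAddSubgroup f.toAddMonoidHom

lemma idx_comap_of_surjective (f : V →ₗ[R] W) (hf : Function.Surjective f) (B : Submodule R W) :
    (B.comap f).idx = B.idx :=
  AddSubgroup.index_comap_of_surjective (f := f.toAddMonoidHom) B.toAddSubgroup hf

lemma idx_top : (⊤ : Submodule R V).idx = 1 := AddSubgroup.index_top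

lemma idx_eq_one {A : Submodule R V} : A.idx = 1 ↔ A = ⊤ := by
  rw [idx, AddSubgroup.index_eq_one]
  exact ⟨fun h => Submodule.toAddSubgroup_injective h, fun h => h ▸ rfl⟩

lemma eq_of_le_of_idx_le {A B : Submodule R V} (h : A ≤ B) (hA : A.idx ≠ 0)
    (hAB : A.idx ≤ B.idx) : A = B := by
  have h1 := relIdx_mul_idx h
  have h2 : A.relIdx B = 1 := by
    have h3 : A.relIdx B ≠ 0 := fun h0 => hA (by rw [← h1, h0, zero_mul])
    have h4 : B.idx ≠ 0 := fun h0 => hA (by rw [← h1, h0, mul_zero])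
    rw [← h1] at hAB
    have : A.relIdx B ≤ 1 := by
      by_contra! h5
      have := Nat.mul_le_mul_right B.idx h5
      omega
    omega
  exact le_antisymm h (AddSubgroup.relIndex_eq_one.1 h2)

lemma idx_dbl_ring : (dbl R).idx = 2 := by
  have h : (dbl R).toAddSubgroup = (PadicInt.toZMod (p := 2)).toAddMonoidHom.ker := by
    ext r
    rw [AddMonoidHom.mem_ker]
    change _ ↔ PadicInt.toZMod r = 0
    rw [← RingHom.mem_ker, PadicInt.ker_toZMod, PadicInt.maximalIdeal_eq_span_p,
      Ideal.mem_span_singleton', Submodule.mem_toAddSubgroup, mem_dbl]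
    simp only [smul_eq_mul, mul_comm]
    rfl
  have hs : Function.Surjective (PadicInt.toZMod (p := 2)).toAddMonoidHom :=
    ZMod.ringHom_surjective _
  rw [idx, h, AddSubgroup.index_ker, AddMonoidHom.range_eq_top.2 hs, AddSubgroup.card_top,
    Nat.card_zmod]

variable (V) in
lemma idx_dbl [Module.Free R V] [Module.Finite R V] : (dbl V).idx = 2 ^ Module.finrank R V := by
  let e : V ≃ₗ[R] (Fin (Module.finrank R V) → R) := (Module.finBasis R V).equivFun
  have h1 : dbl V = (dbl (Fin (Module.finrank R V) → R)).comap e.toLinearMap := by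
    refine le_antisymm (Submodule.map_le_iff_le_comap.1 (map_dbl_le _)) ?_
    rintro v ⟨u, hu⟩
    exact ⟨e.symm u, e.injective (by
      rw [LinearMap.smul_apply, LinearMap.id_apply, map_smul, e.apply_symm_apply]
      exact hu)⟩
  have h2 : (dbl (Fin (Module.finrank R V) → R)).toAddSubgroup =
      AddSubgroup.pi Set.univ fun _ => (dbl R).toAddSubgroup := by
    ext v
    rw [AddSubgroup.mem_pi, Submodule.mem_toAddSubgroup, mem_dbl]
    refine ⟨fun ⟨u, hu⟩ i _ => ⟨u i, congrFun hu i⟩, fun h => ?_⟩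
    choose u hu using fun i => h i trivial
    exact ⟨u, funext hu⟩
  rw [h1, idx_comap_of_surjective _ e.surjective, idx, h2, AddSubgroup.index_pi]
  have h3 : (dbl R).toAddSubgroup.index = 2 := idx_dbl_ring
  simp [h3]

lemma idx_prod (A : Submodule R V) (B : Submodule R W) :
    (A.prod B).idx = A.idx * B.idx :=
  AddSubgroup.index_prod A.toAddSubgroup B.toAddSubgroup

lemma relIdx_sup_span_singleton {A : Submodule R V} (hA : dbl V ≤ A) {v : V} (hv : v ∉ A) :
    A.relIdx (A ⊔ span R {v}) = 2 := by
  rw [relIdx, AddSubgroup.relIndex_eq_two_iff]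
  refine ⟨v, mem_sup_right (mem_span_singleton_self v), fun u hu => ?_⟩
  obtain ⟨w, hw, _, hr, rfl⟩ := mem_sup.1 hu
  obtain ⟨r, rfl⟩ := mem_span_singleton.1 hr
  have hdv : ∀ r : R, (2 : R) ∣ r → r • v ∈ A := by
    rintro _ ⟨s, rfl⟩
    rw [mul_smul]
    exact hA (two_smul_mem_dbl _)
  rcases PadicInt.two_dvd_or_two_dvd_sub_one r with h | h
  · refine Or.inr ⟨A.add_mem hw (hdv r h), fun h1 => hv ?_⟩
    have := A.sub_mem h1 (A.add_mem hw (hdv r h))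
    rwa [add_sub_cancel_left] at this
  · have h2 : (2 : R) ∣ r + 1 := by
      obtain ⟨s, hs⟩ := h
      exact ⟨s + 1, by linear_combination hs⟩
    refine Or.inl ⟨?_, fun h1 => hv ?_⟩
    · change w + r • v + v ∈ A
      convert A.add_mem hw (hdv _ h2) using 1
      module
    · convert A.sub_mem (A.sub_mem h1 hw) (hdv _ h) using 1
      module

/-- A submodule of finite index is completed to the whole module by generators `v` and `β v` with
`v` in a fixed submodule `T`, provided each of them multiplies the index by `q`. -/
lemma exists_generators (β : V →ₗ[R] V) (hβ : ∀ v, β (β (β v)) = v) {T : Submodule R V} {q : ℕ}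
    (hq : 1 < q) {J : Submodule R V} (hJ0 : J.idx ≠ 0) (hJβ : ∀ v ∈ J, β v ∈ J) (hJT : J ⊔ T = ⊤)
    (h : ∀ A, J ≤ A → ∀ v ∈ T, v ∉ A → (∀ v ∈ A, β v ∈ A) →
      A.relIdx (A ⊔ span R {v, β v, β (β v)}) = q) :
    ∃ (n : ℕ) (f : Fin n → V), (∀ i, f i ∈ T) ∧ J.idx = q ^ n ∧
      J ⊔ span R (Set.range f ∪ Set.range (β ∘ f) ∪ Set.range (β ∘ β ∘ f)) = ⊤ := by
  suffices H : ∀ m, ∀ A : Submodule R V, J ≤ A → (∀ v ∈ A, β v ∈ A) → A.idx = m → m ≠ 0 →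
      ∃ (n : ℕ) (f : Fin n → V), (∀ i, f i ∈ T) ∧ m = q ^ n ∧
      A ⊔ span R (Set.range f ∪ Set.range (β ∘ f) ∪ Set.range (β ∘ β ∘ f)) = ⊤ from
    H _ J le_rfl hJβ rfl hJ0
  intro m
  induction m using Nat.strong_induction_on with
  | _ m ih =>
  intro A hJA hAβ hAm hm
  by_cases hAT : T ≤ A
  · have : A = ⊤ := by rw [eq_top_iff, ← hJT]; exact sup_le hJA hAT
    subst this
    exact ⟨0, Fin.elim0, fun i => i.elim0, by rw [← hAm, idx_top, pow_zero], by simp⟩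
  · obtain ⟨v, hvT, hvA⟩ := SetLike.not_le_iff_exists.1 hAT
    have hrel := h A hJA v hvT hvA hAβ
    set B := A ⊔ span R {v, β v, β (β v)} with hB
    have hmul := relIdx_mul_idx (le_sup_left : A ≤ B)
    rw [hrel, hAm] at hmul
    have hB0 : B.idx ≠ 0 := fun h0 => hm (by rw [← hmul, h0, mul_zero])
    have hBβ : ∀ u ∈ B, β u ∈ B := by
      have : B.map β ≤ B := by
        rw [hB, Submodule.map_sup, Submodule.map_span]
        refine sup_le ?_ (span_le.2 ?_)
        · rintro _ ⟨u, hu, rfl⟩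
          exact mem_sup_left (hAβ u hu)
        · rintro _ ⟨u, hu, rfl⟩
          refine mem_sup_right (subset_span ?_)
          rcases hu with rfl | rfl | rfl
          · exact Or.inr (Or.inl rfl)
          · exact Or.inr (Or.inr rfl)
          · exact Or.inl (hβ v)
      exact fun u hu => this ⟨u, hu, rfl⟩
    obtain ⟨n, f, hfT, hn, hf⟩ := ih B.idx (by nlinarith [Nat.pos_of_ne_zero hB0]) B
      (hJA.trans le_sup_left) hBβ rfl hB0
    refine ⟨n + 1, Fin.cons v f, fun i => Fin.cases hvT hfT i, ?_, ?_⟩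
    · rw [← hmul, hn, pow_succ, mul_comm]
    · have h1 : ∀ γ : V → V, Set.range (γ ∘ (Fin.cons v f : Fin (n + 1) → V)) =
          {γ v} ∪ Set.range (γ ∘ f) := fun γ => by
        ext x
        simp [Fin.exists_fin_succ, eq_comm]
      rw [eq_top_iff, ← hf, hB]
      have h2 := h1 id
      simp only [Function.id_comp, id] at h2
      rw [← Function.comp_assoc, ← Function.comp_assoc, h1, h1, h2]
      refine sup_le (sup_le le_sup_left ?_) ?_ <;> refine le_sup_of_le_right (span_mono ?_)
      · rintro _ (rfl | rfl | rfl) <;> simp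
      · rintro x ((hx | hx) | hx)
        · exact Or.inl (Or.inl (Or.inr hx))
        · exact Or.inl (Or.inr (Or.inr hx))
        · exact Or.inr (Or.inr hx)

/-- The index of the trace `K ∩ L` in the kernel `K` of an epimorphism `f : Q → M`, where `L` is the
sum of the image of `N` and of `D`. -/
lemma relIdx_ker_mul {f : V →ₗ[R] W} (hf : Function.Surjective f) (N : V →ₗ[R] V)
    {D : Submodule R V} {E : Submodule R W} (hE : D.map f = E)
    (hN : ∀ v, f (N v) ∈ E) :
    (LinearMap.range N ⊔ D).relIdx (LinearMap.ker f) * (D.comap N).idx * E.idx = D.idx := by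
  set K := LinearMap.ker f
  set L := LinearMap.range N ⊔ D
  have hKD : K ⊔ D = E.comap f := by
    rw [← hE, Submodule.comap_map_eq, sup_comm]
  have hLK : L ≤ K ⊔ D := by
    refine sup_le ?_ le_sup_right
    rintro _ ⟨v, rfl⟩
    rw [hKD]
    exact hN v
  have h1 : (K ⊔ D).idx = E.idx := by rw [hKD, idx_comap_of_surjective _ hf]
  have h2 : L.relIdx (K ⊔ D) = L.relIdx K := by
    have : K ⊔ D = K ⊔ L :=
      le_antisymm (sup_le le_sup_left (le_sup_of_le_right le_sup_right)) (sup_le le_sup_left hLK)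
    rw [this, relIdx_sup]
  have h3 : D.relIdx L = (D.comap N).idx := by
    rw [idx_comap, relIdx_sup]
  rw [← h3, ← h1, ← h2, mul_comm (L.relIdx _), mul_assoc, relIdx_mul_idx hLK,
    relIdx_mul_idx le_sup_right]

/-- Nakayama's lemma. -/
lemma eq_top_of_sup_dbl [Module.Finite R V] {U : Submodule R V} (h : U ⊔ dbl V = ⊤) : U = ⊤ := by
  have h2 : dbl V = Ideal.span {(2 : R)} • (⊤ : Submodule R V) := by
    rw [Submodule.ideal_span_singleton_smul]
    ext v
    simp [mem_dbl, Submodule.mem_smul_pointwise_iff_exists]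
  rw [eq_top_iff]
  refine Submodule.le_of_le_smul_of_le_jacobson_bot (I := Ideal.span {(2 : R)})
    Module.Finite.fg_top ?_ ?_
  · refine le_trans ?_ (IsLocalRing.maximalIdeal_le_jacobson _)
    rw [PadicInt.maximalIdeal_eq_span_p]
    rfl
  · rw [← h2, h]

end Submodule

namespace AltFour

open Submodule

/-! ### The group `A₄` and its lattices -/

section Group

set_option maxRecDepth 100000

lemma a₁_mul_self : a₁ * a₁ = 1 := by decide
lemma a₂_mul_self : a₂ * a₂ = 1 := by decide
lemma a₂_mul_a₁ : a₂ * a₁ = a₁ * a₂ := by decide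
lemma b_mul_a₁ : b * a₁ = a₂ * b := by decide
lemma b_mul_a₂ : b * a₂ = a₁ * a₂ * b := by decide
lemma b_mul_a₁_mul_a₂ : b * (a₁ * a₂) = a₁ * b := by decide
lemma b_pow_three : b ^ 3 = 1 := by decide

lemma univ_eq : (Finset.univ : Finset G) =
    ({1, a₁, a₂, a₁ * a₂} ×ˢ Finset.range 3 : Finset (G × ℕ)).image fun p => p.1 * b ^ p.2 := by
  decide

lemma mul_b_pow_injOn : ∀ p ∈ ({1, a₁, a₂, a₁ * a₂} ×ˢ Finset.range 3 : Finset (G × ℕ)),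
    ∀ q ∈ ({1, a₁, a₂, a₁ * a₂} ×ˢ Finset.range 3 : Finset (G × ℕ)),
    p.1 * b ^ p.2 = q.1 * b ^ q.2 → p = q := by decide

lemma four_distinct : a₁ ≠ 1 ∧ a₂ ≠ 1 ∧ a₁ * a₂ ≠ 1 ∧ a₁ ≠ a₂ ∧ a₁ ≠ a₁ * a₂ ∧ a₂ ≠ a₁ * a₂ := by
  decide

end Group

lemma sum_eq_sum_b_pow {A : Type} [AddCommMonoid A] (f : G → A) :
    ∑ g, f g = ∑ i ∈ Finset.range 3,
      (f (b ^ i) + f (a₁ * b ^ i) + f (a₂ * b ^ i) + f (a₁ * a₂ * b ^ i)) := by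
  rw [univ_eq, Finset.sum_image (fun p hp q hq => mul_b_pow_injOn p hp q hq),
    Finset.sum_product_right]
  refine Finset.sum_congr rfl fun i _ => ?_
  obtain ⟨h1, h2, h3, h4, h5, h6⟩ := four_distinct
  rw [Finset.sum_insert (by simp [h1.symm, h2.symm, h3.symm]),
    Finset.sum_insert (by simp [h4, h2]), Finset.sum_insert (by simp [h1]),
    Finset.sum_singleton, one_mul, add_assoc, add_assoc]

/-- The element `a₁` of the Klein four-group. -/
def α₁ : H := ⟨a₁, Subgroup.subset_closure (by simp)⟩

/-- The element `a₂` of the Klein four-group. -/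
def α₂ : H := ⟨a₂, Subgroup.subset_closure (by simp)⟩

lemma mem_H_iff (g : G) : g ∈ H ↔ g = 1 ∨ g = a₁ ∨ g = a₂ ∨ g = a₁ * a₂ := by
  constructor
  · intro hg
    have h1 : ∀ x y : G, (x = 1 ∨ x = a₁ ∨ x = a₂ ∨ x = a₁ * a₂) →
        (y = 1 ∨ y = a₁ ∨ y = a₂ ∨ y = a₁ * a₂) →
        (x * y = 1 ∨ x * y = a₁ ∨ x * y = a₂ ∨ x * y = a₁ * a₂) := by
      set_option maxRecDepth 100000 in decide
    have h2 : ∀ x : G, (x = 1 ∨ x = a₁ ∨ x = a₂ ∨ x = a₁ * a₂) →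
        (x⁻¹ = 1 ∨ x⁻¹ = a₁ ∨ x⁻¹ = a₂ ∨ x⁻¹ = a₁ * a₂) := by
      set_option maxRecDepth 100000 in decide
    induction hg using Subgroup.closure_induction with
    | mem x hx => rcases hx with rfl | rfl <;> simp
    | one => simp
    | mul x y _ _ hx hy => exact h1 x y hx hy
    | inv x _ hx => exact h2 x hx
  · rintro (rfl | rfl | rfl | rfl)
    · exact one_mem _
    · exact α₁.2
    · exact α₂.2
    · exact mul_mem α₁.2 α₂.2

lemma eq_of_H (h : H) : h = 1 ∨ h = α₁ ∨ h = α₂ ∨ h = α₁ * α₂ := by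
  rcases (mem_H_iff h).1 h.2 with h | h | h | h
  · exact Or.inl (Subtype.ext h)
  · exact Or.inr (Or.inl (Subtype.ext h))
  · exact Or.inr (Or.inr (Or.inl (Subtype.ext h)))
  · exact Or.inr (Or.inr (Or.inr (Subtype.ext h)))

instance : Fintype H := Fintype.ofFinset {1, a₁, a₂, a₁ * a₂} fun g => by
  rw [SetLike.mem_coe, mem_H_iff]
  simp

lemma univ_H : (Finset.univ : Finset H) = {1, α₁, α₂, α₁ * α₂} := by
  ext h
  simpa using eq_of_H h

lemma card_H : Fintype.card H = 4 := by
  refine (Fintype.card_ofFinset (p := (H : Set G)) ({1, a₁, a₂, a₁ * a₂} : Finset G) _).trans ?_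
  set_option maxRecDepth 100000 in decide

lemma sum_H {A : Type} [AddCommMonoid A] (f : H → A) :
    ∑ h, f h = f 1 + f α₁ + f α₂ + f (α₁ * α₂) := by
  obtain ⟨h1, h2, h3, h4, h5, h6⟩ := four_distinct
  rw [univ_H, Finset.sum_insert, Finset.sum_insert, Finset.sum_insert, Finset.sum_singleton,
    add_assoc, add_assoc]
  all_goals simp [Subtype.ext_iff, α₁, α₂, h1.symm, h2, h2.symm, h3.symm, h4, h1]

/-- The restriction of a lattice to the Klein four-group. -/
abbrev res (M : RepLattice R G) : RepLattice R H where
  V := M.V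
  ρ := M.ρ.comp H.subtype

/-- An intertwining map, restricted to the Klein four-group. -/
def resHom {M N : RepLattice R G} (f : M.ρ.IntertwiningMap N.ρ) :
    (res M).ρ.IntertwiningMap (res N).ρ :=
  hom (M := res M) (N := res N) f.toLinearMap fun h x => f.isIntertwining _ _ h x

lemma _root_.RepLattice.Iso.res {M N : RepLattice R G} (h : M.Iso N) : (res M).Iso (res N) := by
  obtain ⟨e⟩ := h
  exact iso_of_inverse (M := AltFour.res M) (N := AltFour.res N) (resHom e.toIntertwiningMap)
    (resHom e.symm.toIntertwiningMap) e.symm_apply_apply e.apply_symm_apply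

lemma _root_.RepLattice.IsShortExact.res {M Q N : RepLattice R G} (h : IsShortExact M Q N) :
    IsShortExact (res M) (res Q) (res N) := by
  obtain ⟨i, p, h⟩ := h
  exact ⟨resHom i, resHom p, h⟩

/-! ### Radicals -/

section Radical

variable (L : RepLattice R H)

/-- The action of `a₁ - 1`. -/
def opX : L.ρ.IntertwiningMap L.ρ := hom (L.ρ α₁ - LinearMap.id) fun g x => by
  have : α₁ * g = g * α₁ := by
    rcases eq_of_H g with rfl | rfl | rfl | rfl <;>
      simp [α₁, α₂, a₂_mul_a₁, mul_assoc]
  change L.ρ α₁ (L.ρ g x) - L.ρ g x = L.ρ g (L.ρ α₁ x - x)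
  rw [map_sub, ← Module.End.mul_apply, ← map_mul, this, map_mul, Module.End.mul_apply]

/-- The action of `a₂ - 1`. -/
def opY : L.ρ.IntertwiningMap L.ρ := hom (L.ρ α₂ - LinearMap.id) fun g x => by
  have : α₂ * g = g * α₂ := by
    have h : α₂ * α₁ = α₁ * α₂ := Subtype.ext a₂_mul_a₁
    rcases eq_of_H g with rfl | rfl | rfl | rfl
    · simp
    · exact h
    · rfl
    · rw [← mul_assoc, h, mul_assoc]
  change L.ρ α₂ (L.ρ g x) - L.ρ g x = L.ρ g (L.ρ α₂ x - x)
  rw [map_sub, ← Module.End.mul_apply, ← map_mul, this, map_mul, Module.End.mul_apply]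

/-- The action of the norm element of the Klein four-group. -/
def norm : L.V →ₗ[R] L.V := LinearMap.id + L.ρ α₁ + L.ρ α₂ + L.ρ (α₁ * α₂)

/-- The radical of a lattice over the local ring `RH`. -/
def rad : Submodule R L.V :=
  LinearMap.range (opX L).toLinearMap ⊔ LinearMap.range (opY L).toLinearMap ⊔ dbl L.V

variable {L}

lemma opX_apply (x : L.V) : opX L x = L.ρ α₁ x - x := rfl

lemma opY_apply (x : L.V) : opY L x = L.ρ α₂ x - x := rfl

lemma norm_apply (x : L.V) : norm L x = x + L.ρ α₁ x + L.ρ α₂ x + L.ρ (α₁ * α₂) x := rfl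

lemma ρ_α₁_α₁ (x : L.V) : L.ρ α₁ (L.ρ α₁ x) = x := by
  rw [← Module.End.mul_apply, ← map_mul, show α₁ * α₁ = 1 from Subtype.ext a₁_mul_self, map_one,
    Module.End.one_apply]

lemma ρ_α₂_α₂ (x : L.V) : L.ρ α₂ (L.ρ α₂ x) = x := by
  rw [← Module.End.mul_apply, ← map_mul, show α₂ * α₂ = 1 from Subtype.ext a₂_mul_self, map_one,
    Module.End.one_apply]

lemma ρ_α₂_α₁ (x : L.V) : L.ρ α₂ (L.ρ α₁ x) = L.ρ α₁ (L.ρ α₂ x) := by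
  rw [← Module.End.mul_apply, ← map_mul, show α₂ * α₁ = α₁ * α₂ from Subtype.ext a₂_mul_a₁,
    map_mul, Module.End.mul_apply]

lemma norm_apply' (x : L.V) : norm L x = x + L.ρ α₁ x + L.ρ α₂ x + L.ρ α₁ (L.ρ α₂ x) := by
  rw [norm_apply, map_mul, Module.End.mul_apply]

lemma opX_opX (x : L.V) : opX L (opX L x) = (2 : R) • (-opX L x) := by
  simp only [opX_apply, map_sub, ρ_α₁_α₁]
  module

lemma opY_opY (x : L.V) : opY L (opY L x) = (2 : R) • (-opY L x) := by
  simp only [opY_apply, map_sub, ρ_α₂_α₂]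
  module

lemma opY_opX (x : L.V) : opY L (opX L x) = opX L (opY L x) := by
  simp only [opX_apply, opY_apply, map_sub, ρ_α₂_α₁]
  abel

lemma opX_opY (x : L.V) :
    opX L (opY L x) = norm L x - (2 : R) • (L.ρ α₁ x + L.ρ α₂ x) := by
  simp only [opX_apply, opY_apply, map_sub, norm_apply']
  module

lemma norm_opX (x : L.V) : norm L (opX L x) = 0 := by
  simp only [opX_apply, norm_apply', map_sub, ρ_α₂_α₁, ρ_α₁_α₁]
  abel

lemma norm_opY (x : L.V) : norm L (opY L x) = 0 := by
  simp only [opY_apply, norm_apply', map_sub, ρ_α₂_α₂]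
  abel

lemma opX_mem_rad (x : L.V) : opX L x ∈ rad L := mem_sup_left (mem_sup_left ⟨x, rfl⟩)

lemma opY_mem_rad (x : L.V) : opY L x ∈ rad L := mem_sup_left (mem_sup_right ⟨x, rfl⟩)

lemma dbl_le_rad : dbl L.V ≤ rad L := le_sup_right

lemma mem_rad {x : L.V} : x ∈ rad L ↔ ∃ u v w, x = opX L u + opY L v + (2 : R) • w := by
  constructor
  · intro hx
    obtain ⟨y, hy, _, ⟨w, rfl⟩, rfl⟩ := mem_sup.1 hx
    obtain ⟨_, ⟨u, rfl⟩, _, ⟨v, rfl⟩, rfl⟩ := mem_sup.1 hy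
    exact ⟨u, v, w, rfl⟩
  · rintro ⟨u, v, w, rfl⟩
    exact add_mem (add_mem (opX_mem_rad u) (opY_mem_rad v)) (dbl_le_rad (two_smul_mem_dbl w))

lemma norm_mem_dbl_of_mem_rad {x : L.V} (hx : x ∈ rad L) : norm L x ∈ dbl L.V := by
  obtain ⟨u, v, w, rfl⟩ := mem_rad.1 hx
  rw [map_add, map_add, norm_opX, norm_opY, map_smul, zero_add, zero_add]
  exact two_smul_mem_dbl _

variable {L' : RepLattice R H} (f : L.ρ.IntertwiningMap L'.ρ)

lemma map_opX (x : L.V) : f (opX L x) = opX L' (f x) := by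
  rw [opX_apply, map_sub, f.isIntertwining, opX_apply]

lemma map_opY (x : L.V) : f (opY L x) = opY L' (f x) := by
  rw [opY_apply, map_sub, f.isIntertwining, opY_apply]

lemma map_norm (x : L.V) : f (norm L x) = norm L' (f x) := by
  simp only [norm_apply, map_add, f.isIntertwining]

lemma map_mem_rad {x : L.V} (hx : x ∈ rad L) : f x ∈ rad L' := by
  obtain ⟨u, v, w, rfl⟩ := mem_rad.1 hx
  rw [map_add, map_add, map_opX, map_opY, map_smul]
  exact mem_rad.2 ⟨_, _, _, rfl⟩

end Radical

/-! ### The action of the idempotent `w₀` -/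

section Omega

variable (M : RepLattice R G)

/-- The action of the idempotent `w₀`, the projection onto the fixed points of `b`. -/
def opW : M.V →ₗ[R] M.V := third • (LinearMap.id + M.ρ b + M.ρ (b ^ 2))

/-- The submodule `w₁ M`, the kernel of the action of `w₀`. -/
def omega : Submodule R M.V := LinearMap.ker (opW M)

variable {M}

lemma opW_apply (x : M.V) : opW M x = third • (x + M.ρ b x + M.ρ (b ^ 2) x) := rfl

lemma mem_omega {x : M.V} : x ∈ omega M ↔ opW M x = 0 := Iff.rfl

lemma ρ_b_b (x : M.V) : M.ρ b (M.ρ b x) = M.ρ (b ^ 2) x := by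
  rw [← Module.End.mul_apply, ← map_mul, pow_two]

lemma ρ_b_pow_three (x : M.V) : M.ρ b (M.ρ (b ^ 2) x) = x := by
  rw [← Module.End.mul_apply, ← map_mul, ← pow_succ', b_pow_three, map_one, Module.End.one_apply]

lemma ρ_b_opW (x : M.V) : M.ρ b (opW M x) = opW M x := by
  rw [opW_apply, map_smul, map_add, map_add, ρ_b_b, ρ_b_pow_three]
  congr 1
  abel

lemma opW_eq_self {x : M.V} (hx : M.ρ b x = x) : opW M x = x := by
  rw [opW_apply, ← ρ_b_b, hx, hx, show x + x + x = (3 : R) • x by module, smul_smul,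
    mul_comm, three_mul_third, one_smul]

lemma opW_opW (x : M.V) : opW M (opW M x) = opW M x := opW_eq_self (ρ_b_opW x)

lemma opW_ρ_b (x : M.V) : opW M (M.ρ b x) = opW M x := by
  rw [opW_apply, opW_apply, ρ_b_b, ← ρ_b_b (M.ρ b x), ρ_b_b x, ρ_b_pow_three]
  congr 1
  abel

lemma sub_opW_mem_omega (x : M.V) : x - opW M x ∈ omega M := by
  rw [mem_omega, map_sub, opW_opW, sub_self]

lemma ρ_b_mem_omega {x : M.V} (hx : x ∈ omega M) : M.ρ b x ∈ omega M := by
  rw [mem_omega, opW_ρ_b, mem_omega.1 hx]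

lemma add_add_eq_zero_of_mem_omega {x : M.V} (hx : x ∈ omega M) :
    x + M.ρ b x + M.ρ b (M.ρ b x) = 0 := by
  have h := congrArg ((3 : R) • ·) (mem_omega.1 hx)
  simpa only [opW_apply, smul_smul, three_mul_third, one_smul, smul_zero, ρ_b_b] using h

lemma map_opW {N : RepLattice R G} (f : M.ρ.IntertwiningMap N.ρ) (x : M.V) :
    f (opW M x) = opW N (f x) := by
  simp only [opW_apply, map_smul, map_add, f.isIntertwining]

lemma opW_mem {J : Submodule R M.V} (hJ : ∀ x ∈ J, M.ρ b x ∈ J) {x : M.V} (hx : x ∈ J) :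
    opW M x ∈ J := by
  rw [opW_apply, ← ρ_b_b]
  exact J.smul_mem _ (add_mem (add_mem hx (hJ x hx)) (hJ _ (hJ x hx)))

lemma ρ_b_norm (x : M.V) : M.ρ b (norm (res M) x) = norm (res M) (M.ρ b x) := by
  have h : ∀ g : G, ∀ h : H, b * h = g * b → M.ρ b (M.ρ h x) = M.ρ g (M.ρ b x) :=
    fun g h hg => by rw [← Module.End.mul_apply, ← map_mul, hg, map_mul, Module.End.mul_apply]
  rw [norm_apply, norm_apply, map_add, map_add, map_add]
  change _ + M.ρ b (M.ρ (α₁ : G) x) + M.ρ b (M.ρ (α₂ : G) x) + M.ρ b (M.ρ (α₁ * α₂ : H) x) = _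
  rw [h _ α₁ b_mul_a₁, h _ α₂ b_mul_a₂, h _ (α₁ * α₂) b_mul_a₁_mul_a₂]
  change M.ρ b x + M.ρ a₂ _ + M.ρ (a₁ * a₂) _ + M.ρ a₁ _ =
    M.ρ b x + M.ρ a₁ _ + M.ρ a₂ _ + M.ρ (a₁ * a₂) _
  abel

lemma opW_norm (x : M.V) : opW M (norm (res M) x) = norm (res M) (opW M x) := by
  rw [opW_apply, opW_apply, map_smul, map_add, map_add, ← ρ_b_b, ← ρ_b_b, ← ρ_b_norm,
    ← ρ_b_norm, ← ρ_b_norm]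

lemma ρ_b_mem_rad {x : M.V} (hx : x ∈ rad (res M)) : M.ρ b x ∈ rad (res M) := by
  obtain ⟨u, v, w, rfl⟩ := mem_rad.1 hx
  rw [map_add, map_add, map_smul]
  refine add_mem (add_mem ?_ ?_) (dbl_le_rad (two_smul_mem_dbl _))
  · have : M.ρ b (opX (res M) u) = opY (res M) (M.ρ b u) := by
      change M.ρ b (M.ρ a₁ u - u) = M.ρ a₂ (M.ρ b u) - M.ρ b u
      rw [map_sub, ← Module.End.mul_apply, ← map_mul, b_mul_a₁, map_mul, Module.End.mul_apply]
    rw [this]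
    exact opY_mem_rad _
  · have : M.ρ b (opY (res M) v) =
        opX (res M) (M.ρ a₂ (M.ρ b v)) + opY (res M) (M.ρ b v) := by
      change M.ρ b (M.ρ a₂ v - v) =
        M.ρ a₁ (M.ρ a₂ (M.ρ b v)) - M.ρ a₂ (M.ρ b v) + (M.ρ a₂ (M.ρ b v) - M.ρ b v)
      rw [map_sub, ← Module.End.mul_apply, ← map_mul, b_mul_a₂, map_mul, map_mul,
        Module.End.mul_apply, Module.End.mul_apply]
      abel
    rw [this]
    exact add_mem (opX_mem_rad _) (opY_mem_rad _)

/-- Generators of `M` modulo `J`, chosen as eigenvectors of `w₀`: the ones with eigenvalue 0 come in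
`b`-orbits, since `R[b] w₁` is the ring of integers of the unramified quadratic extension. -/
lemma exists_eigengenerators {J : Submodule R M.V} (hJb : ∀ x ∈ J, M.ρ b x ∈ J)
    (hJ : dbl M.V ≤ J) {t a : ℕ} (ht : J.idx = 2 ^ t) (ha : (J ⊔ omega M).idx = 2 ^ a) :
    ∃ (c : ℕ) (e : Fin a → M.V) (f : Fin c → M.V), t = a + 2 * c ∧ (∀ i, opW M (e i) = e i) ∧
      (∀ j, opW M (f j) = 0) ∧
      ∀ U : Submodule R M.V, (∀ x ∈ U, M.ρ b x ∈ U) → J ≤ U → (∀ i, e i ∈ U) → (∀ j, f j ∈ U) →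
        U = ⊤ := by
  set F : Submodule R M.V := LinearMap.range (opW M)
  have hF : ∀ x ∈ F, M.ρ b x = x := by
    rintro _ ⟨x, rfl⟩
    exact ρ_b_opW x
  have hsum : ∀ A : Submodule R M.V, F ≤ A → omega M ≤ A → A = ⊤ := fun A h1 h2 => by
    rw [eq_top_iff]
    intro x _
    rw [← add_sub_cancel (opW M x) x]
    exact add_mem (h1 ⟨x, rfl⟩) (h2 (sub_opW_mem_omega x))
  have hb3 : ∀ x, M.ρ b (M.ρ b (M.ρ b x)) = x := fun x => by rw [ρ_b_b x, ρ_b_pow_three]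
  have hstab : ∀ T : Submodule R M.V, (∀ x ∈ T, M.ρ b x ∈ T) → ∀ x ∈ J ⊔ T, M.ρ b x ∈ J ⊔ T := by
    intro T hT x hx
    obtain ⟨y, hy, z, hz, rfl⟩ := mem_sup.1 hx
    rw [map_add]
    exact add_mem (mem_sup_left (hJb y hy)) (mem_sup_right (hT z hz))
  have hidx : (J ⊔ F).idx * (J ⊔ omega M).idx = J.idx := by
    have h1 : J ⊔ F = J.comap (LinearMap.id - opW M) := by
      refine le_antisymm (sup_le (fun x hx => ?_) ?_) fun x hx => ?_
      · exact sub_mem hx (opW_mem hJb hx)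
      · rintro _ ⟨x, rfl⟩
        change opW M x - opW M (opW M x) ∈ J
        rw [opW_opW, sub_self]
        exact zero_mem _
      · have hx : x - opW M x ∈ J := hx
        rw [← sub_add_cancel x (opW M x)]
        exact add_mem (mem_sup_left hx) (mem_sup_right ⟨x, rfl⟩)
    have h2 : LinearMap.range (LinearMap.id - opW M) = omega M := by
      refine le_antisymm ?_ fun x hx => ⟨x, ?_⟩
      · rintro _ ⟨x, rfl⟩
        exact sub_opW_mem_omega x
      · change x - opW M x = x
        rw [mem_omega.1 hx, sub_zero]
    rw [h1, idx_comap, h2, ← relIdx_sup, sup_comm, relIdx_mul_idx le_sup_left]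
  have hJ0 : J.idx ≠ 0 := by rw [ht]; positivity
  obtain ⟨n, e, heF, hn, he⟩ := exists_generators (M.ρ b) hb3 (T := F) (q := 2) (by norm_num)
    (J := J ⊔ omega M) (by rw [ha]; positivity) (hstab _ fun x hx => ρ_b_mem_omega hx)
    (hsum _ le_sup_right (le_sup_of_le_left le_sup_right)) (by
      intro A hA v hv hvA _
      rw [hF v hv, hF v hv, Set.pair_eq_singleton, Set.pair_eq_singleton]
      exact relIdx_sup_span_singleton (hJ.trans (le_sup_left.trans hA)) hvA)
  obtain ⟨c, f, hfT, hc, hf⟩ := exists_generators (M.ρ b) hb3 (T := omega M) (q := 4) (by norm_num)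
    (J := J ⊔ F) (fun h0 => hJ0 (by rw [← hidx, h0, zero_mul]))
    (hstab _ fun x hx => by rw [hF x hx]; exact hx)
    (hsum _ (le_sup_of_le_left le_sup_right) le_sup_right) (by
      intro A hA v hv hvA hAb
      have h2A : dbl M.V ≤ A := hJ.trans (le_sup_left.trans hA)
      have h0 := add_add_eq_zero_of_mem_omega hv
      have hspan : span R {v, M.ρ b v, M.ρ b (M.ρ b v)} = span R {v} ⊔ span R {M.ρ b v} := by
        refine le_antisymm (span_le.2 ?_) (sup_le (span_mono (by simp)) (span_mono (by simp)))
        have h1 := mem_sup_left (mem_span_singleton_self (R := R) v) (T := span R {M.ρ b v})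
        have h2 := mem_sup_right (mem_span_singleton_self (R := R) (M.ρ b v)) (S := span R {v})
        rintro _ (rfl | rfl | rfl)
        · exact h1
        · exact h2
        · rw [eq_neg_of_add_eq_zero_right h0]
          exact neg_mem (add_mem h1 h2)
      have hv' : M.ρ b v ∉ A ⊔ span R {v} := by
        intro hmem
        obtain ⟨w, hw, _, hr, hwr⟩ := mem_sup.1 hmem
        obtain ⟨r, rfl⟩ := mem_span_singleton.1 hr
        have hdv : ∀ r : R, (2 : R) ∣ r → r • v ∈ A := by
          rintro _ ⟨s, rfl⟩
          rw [mul_smul]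
          exact h2A (two_smul_mem_dbl _)
        rcases PadicInt.two_dvd_or_two_dvd_sub_one r with h | h
        · apply hvA
          rw [← hb3 v, ← hwr]
          exact hAb _ (hAb _ (add_mem hw (hdv r h)))
        · -- here `b v ≡ v` modulo `A`, and so `0 = v + b v + b² v ≡ 3 v`
          have h1 : M.ρ b v - v ∈ A := by
            rw [← hwr]
            convert add_mem hw (hdv _ h) using 1
            module
          have h2 := hAb _ h1
          rw [map_sub] at h2
          have h3 := h2A (two_smul_mem_dbl (M.ρ b v))
          refine hvA ?_
          convert sub_mem (neg_mem h2) h3 using 1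
          rw [eq_neg_of_add_eq_zero_right h0]
          module
      rw [hspan, ← sup_assoc, ← relIdx_mul_relIdx le_sup_left le_sup_left,
        relIdx_sup_span_singleton h2A hvA,
        relIdx_sup_span_singleton (h2A.trans le_sup_left) hv'])
  have hna : n = a := Nat.pow_right_injective le_rfl (hn.symm.trans ha)
  subst hna
  refine ⟨c, e, f, Nat.pow_right_injective le_rfl ?_, fun i => opW_eq_self (hF _ (heF i)), hfT,
    fun U hUb hJU heU hfU => ?_⟩
  · change 2 ^ t = 2 ^ (n + 2 * c)
    rw [← ht, ← hidx, hc, ha, pow_add, pow_mul, mul_comm]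
    norm_num
  · have key : ∀ (m : ℕ) (g : Fin m → M.V), (∀ i, g i ∈ U) →
        span R (Set.range g ∪ Set.range (M.ρ b ∘ g) ∪ Set.range (M.ρ b ∘ M.ρ b ∘ g)) ≤ U := by
      intro m g hg
      rw [span_le]
      rintro _ ((⟨i, rfl⟩ | ⟨i, rfl⟩) | ⟨i, rfl⟩)
      · exact hg i
      · exact hUb _ (hg i)
      · exact hUb _ (hUb _ (hg i))
    have he' : U ⊔ omega M = ⊤ := by
      rw [eq_top_iff, ← he]
      exact sup_le (sup_le_sup_right hJU _) (le_sup_of_le_left (key _ e heU))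
    have hf' : U ⊔ F = ⊤ := by
      rw [eq_top_iff, ← hf]
      exact sup_le (sup_le_sup_right hJU _) (le_sup_of_le_left (key _ f hfU))
    refine hsum U ?_ ?_
    · rintro _ ⟨x, rfl⟩
      obtain ⟨u, hu, v, hv, rfl⟩ := mem_sup.1 (he' ▸ mem_top : x ∈ U ⊔ omega M)
      rw [map_add, mem_omega.1 hv, add_zero]
      exact opW_mem hUb hu
    · intro x hx
      obtain ⟨u, hu, _, ⟨v, rfl⟩, rfl⟩ := mem_sup.1 (hf' ▸ mem_top : x ∈ U ⊔ F)
      have h1 : opW M v = -opW M u := by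
        have := mem_omega.1 hx
        rw [map_add, opW_opW] at this
        exact eq_neg_of_add_eq_zero_right this
      rw [h1]
      exact add_mem hu (neg_mem (opW_mem hUb hu))

end Omega

end AltFour

namespace RepLattice

open Submodule

/-! ### Permutation lattices -/

section Perm

variable {k : Type} {G' : Type} [CommRing k] [Group G']

lemma monoidAlgebra_ext {X W : Type} [AddCommGroup W] [Module k W] {f g : k[X] →ₗ[k] W}
    (h : ∀ x, f (MonoidAlgebra.single x 1) = g (MonoidAlgebra.single x 1)) : f = g :=
  MonoidAlgebra.lhom_ext' fun x => LinearMap.ext_ring (h x)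

variable (k) in
/-- The linear map on `k[X]` with prescribed values on the basis `X`. -/
def linLift {X W : Type} [AddCommGroup W] [Module k W] (v : X → W) : k[X] →ₗ[k] W :=
  Finsupp.linearCombination k v ∘ₗ (MonoidAlgebra.coeffLinearEquiv k).toLinearMap

@[simp] lemma linLift_single {X W : Type} [AddCommGroup W] [Module k W] (v : X → W) (x : X)
    (r : k) : linLift k v (MonoidAlgebra.single x r) = r • v x := by
  simp [linLift]

variable (k G') in
/-- The permutation lattice on a finite `G'`-set. -/
abbrev permMod (X : Type) [Finite X] [MulAction G' X] : RepLattice k G' where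
  V := k[X]
  finite := Module.Finite.of_basis (MonoidAlgebra.basis X k)
  ρ := Representation.ofMulAction k G' X

variable {X : Type} [Finite X] [MulAction G' X]

/-- The basis vector of a permutation lattice. -/
abbrev bas (x : X) : (permMod k G' X).V := MonoidAlgebra.single x 1

lemma permMod_ρ_bas (g : G') (x : X) :
    (permMod k G' X).ρ g (bas x) = bas (g • x) :=
  Representation.ofMulAction_single g x 1

/-- The map from a permutation lattice given by an equivariant family of vectors. -/
def permLift {M : RepLattice k G'} (v : X → M.V) (hv : ∀ g x, M.ρ g (v x) = v (g • x)) :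
    (permMod k G' X).ρ.IntertwiningMap M.ρ :=
  hom (M := permMod k G' X) (linLift k v) fun g => LinearMap.congr_fun
    (f := linLift k v ∘ₗ (permMod k G' X).ρ g) (g := M.ρ g ∘ₗ linLift k v) <|
    monoidAlgebra_ext fun x => by simp [hv]

@[simp] lemma permLift_bas {M : RepLattice k G'} (v : X → M.V) (hv) (x : X) :
    permLift (k := k) (G' := G') v hv (bas x) = v x := by
  change linLift k v (MonoidAlgebra.single x 1) = _
  simp

lemma finrank_permMod [Nontrivial k] : Module.finrank k (permMod k G' X).V = Nat.card X := by
  have := Fintype.ofFinite X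
  rw [Module.finrank_eq_card_basis (MonoidAlgebra.basis X k), Nat.card_eq_fintype_card]

lemma finrank_freeMod [Nontrivial k] [Finite G'] (d : ℕ) :
    Module.finrank k (freeMod k G' d).V = d * Nat.card G' := by
  have := Fintype.ofFinite G'
  change Module.finrank k (Fin d →₀ k[G']) = _
  rw [Module.finrank_finsupp, Module.finrank_eq_card_basis (MonoidAlgebra.basis G' k),
    Nat.card_eq_fintype_card, Fintype.card_fin]

end Perm

section PermPadic

variable {G' : Type} [Group G'] {X : Type} [Finite X] [MulAction G' X]

/-- Permutation lattices are self-dual. -/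
lemma permMod_dual : (permMod R G' X).dual.Iso (permMod R G' X) := by
  classical
  have := Fintype.ofFinite X
  let v : X → (permMod R G' X).dual.V := fun x =>
    (linLift R fun y => if y = x then (1 : R) else 0)
  refine (iso_of_surjective (permLift (M := (permMod R G' X).dual) v fun g x =>
    monoidAlgebra_ext fun y => ?_) (fun φ => ?_) ?_).symm
  · change v x ((permMod R G' X).ρ g⁻¹ (bas y)) = v (g • x) (bas y)
    rw [permMod_ρ_bas]
    simp [v, inv_smul_eq_iff]
  · refine ⟨∑ x, φ (bas x) • bas x, monoidAlgebra_ext fun y => ?_⟩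
    rw [map_sum, Finset.sum_congr rfl fun x _ => by rw [map_smul, permLift_bas]]
    change (∑ x, φ (bas x) • v x : Module.Dual R R[X]) (MonoidAlgebra.single y 1) = φ (bas y)
    rw [LinearMap.sum_apply]
    simp [v]
  · exact (Module.finrank_linearMap_self R R R[X]).symm

lemma freeMod_add [Finite G'] (m n : ℕ) :
    (freeMod R G' (m + n)).Iso ((freeMod R G' m).sum (freeMod R G' n)) := by
  let L := (Finsupp.lmapDomain R[G'] R (Fin.castAdd n)).coprod
    (Finsupp.lmapDomain R[G'] R (Fin.natAdd m))
  refine (iso_of_surjective (M := (freeMod R G' m).sum (freeMod R G' n)) (N := freeMod R G' (m + n))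
    (hom (M := (freeMod R G' m).sum (freeMod R G' n)) (N := freeMod R G' (m + n)) L fun g =>
      LinearMap.congr_fun (f := L ∘ₗ ((freeMod R G' m).sum (freeMod R G' n)).ρ g)
        (g := (freeMod R G' (m + n)).ρ g ∘ₗ L) ?_) (fun x => ?_) ?_).symm
  · refine LinearMap.prod_ext ?_ ?_ <;> ext i a : 4 <;> simp [L]
  · induction x using Finsupp.induction_linear with
    | zero => exact ⟨0, map_zero _⟩
    | add f g hf hg =>
      obtain ⟨x, rfl⟩ := hf
      obtain ⟨y, rfl⟩ := hg
      exact ⟨x + y, map_add _ _ _⟩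
    | single i a =>
      refine Fin.addCases (fun i => ⟨(Finsupp.single i a, 0), ?_⟩)
        (fun i => ⟨(0, Finsupp.single i a), ?_⟩) i
      · change L _ = _
        simp [L]
      · change L _ = _
        simp [L]
  · change Module.finrank R ((freeMod R G' m).V × (freeMod R G' n).V) = _
    rw [Module.finrank_prod, finrank_freeMod, finrank_freeMod, finrank_freeMod, add_mul]

end PermPadic

/-! ### Principal projective lattices -/

section Principal

variable {k : Type} {G' : Type} [CommRing k] [Group G'] [Finite G']

lemma freeMod_one_iso (k : Type) [CommRing k] : (freeMod k G' 1).Iso (permMod k G' G') :=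
  iso_of_inverse (M := freeMod k G' 1) (N := permMod k G' G')
    (hom (M := freeMod k G' 1) (N := permMod k G' G') (Finsupp.lapply 0) fun g =>
      LinearMap.congr_fun (f := Finsupp.lapply 0 ∘ₗ Representation.free k G' (Fin 1) g)
        (g := Representation.leftRegular k G' g ∘ₗ Finsupp.lapply 0) <|
      Finsupp.lhom_ext fun i a => by rw [Subsingleton.elim i 0]; simp)
    (hom (M := permMod k G' G') (N := freeMod k G' 1) (Finsupp.lsingle 0)
      fun g x => (Representation.finsupp_single _ g 0 x).symm)
    (fun x => Finsupp.ext fun i => by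
      rw [Subsingleton.elim i 0]
      exact Finsupp.single_eq_same)
    (fun x => Finsupp.single_eq_same)

omit [Finite G'] in
lemma asAlgebraHom_leftRegular (M : RepLattice k G') (g : G') (x : k[G']) (m : M.V) :
    M.ρ.asAlgebraHom (Representation.leftRegular k G' g x) m = M.ρ g (M.ρ.asAlgebraHom x m) := by
  have h := Representation.asAlgebraHom_ofMulAction_smul_eq_mul (MonoidAlgebra.single g 1) x
  rw [Representation.asAlgebraHom_single, one_smul] at h
  rw [h, map_mul, Representation.asAlgebraHom_single, one_smul, Module.End.mul_apply]

variable [IsDomain k] [IsPrincipalIdealRing k]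

/-- The map `k[G] w → M` that sends `x` to `x m`. -/
def principalHom (w : k[G']) {M : RepLattice k G'} (m : M.V) :
    (principal w).ρ.IntertwiningMap M.ρ :=
  hom ((LinearMap.applyₗ m ∘ₗ M.ρ.asAlgebraHom.toLinearMap) ∘ₗ Submodule.subtype _)
    fun g x => asAlgebraHom_leftRegular M g x.1 m

/-- The generator `w` of `k[G] w`. -/
def gen (w : k[G']) : (principal w).V := ⟨w, 1, one_mul w⟩

lemma mem_principal_iff {w : k[G']} (hw : w * w = w) (x : (principal w).V) : x.1 * w = x.1 := by
  obtain ⟨_, y, rfl⟩ := x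
  change y * w * w = y * w
  rw [mul_assoc, hw]

/-- Right multiplication by `w`. -/
def toPrincipal (w : k[G']) : (permMod k G' G').ρ.IntertwiningMap (principal w).ρ :=
  hom (M := permMod k G' G') (LinearMap.rangeRestrict (LinearMap.mulRight k w)) fun g x =>
    Subtype.ext <| by
      have h := fun y => Representation.asAlgebraHom_ofMulAction_smul_eq_mul
        (MonoidAlgebra.single g (1 : k)) y
      simp only [Representation.asAlgebraHom_single, one_smul] at h
      change Representation.leftRegular k G' g x * w = Representation.leftRegular k G' g (x * w)
      rw [h, h, mul_assoc]

/-- The inclusion of `k[G] w`. -/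
def ofPrincipal (w : k[G']) : (principal w).ρ.IntertwiningMap (permMod k G' G').ρ :=
  hom (N := permMod k G' G') (Submodule.subtype _) fun _ _ => rfl

lemma isProj_principal {w : k[G']} (hw : w * w = w) : IsProj (principal w) :=
  ((isProj_freeMod 1).of_iso (freeMod_one_iso k).symm).of_retract (ofPrincipal w) (toPrincipal w)
    fun x => Subtype.ext (mem_principal_iff hw x)

/-- The decomposition of the regular module given by an idempotent. -/
lemma permMod_iso_principal_sum {w : k[G']} (hw : w * w = w) :
    (permMod k G' G').Iso ((principal w).sum (principal (1 - w))) := by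
  have hw' : (1 - w) * (1 - w) = 1 - w := by rw [mul_sub, sub_mul, sub_mul, hw]; simp
  refine iso_of_inverse (M := permMod k G' G') (N := (principal w).sum (principal (1 - w)))
    ((toPrincipal w).prod (toPrincipal (1 - w)))
    ((ofPrincipal w).comp (.fst k _ _) + (ofPrincipal (1 - w)).comp (.snd k _ _))
    (fun x => ?_) fun x => Prod.ext (Subtype.ext ?_) (Subtype.ext ?_)
  · change x * w + x * (1 - w) = x
    rw [mul_sub, mul_one, add_sub_cancel]
  · have h1 := mem_principal_iff hw x.1
    have h2 := mem_principal_iff hw' x.2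
    change (x.1.1 + x.2.1) * w = x.1.1
    rw [add_mul, h1, ← h2, mul_assoc, sub_mul, one_mul, hw, sub_self, mul_zero, add_zero]
  · have h1 := mem_principal_iff hw x.1
    have h2 := mem_principal_iff hw' x.2
    change (x.1.1 + x.2.1) * (1 - w) = x.2.1
    rw [add_mul, h2, ← h1, mul_assoc, mul_sub, hw, mul_one, sub_self, mul_zero, zero_add]

end Principal

end RepLattice

namespace AltFour

open Submodule

/-! ### The projective covers over `A₄` -/

lemma opW_eq (M : RepLattice R G) (m : M.V) : opW M m = M.ρ.asAlgebraHom w₀ m := by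
  simp only [w₀, map_smul, map_add, Representation.asAlgebraHom_single, one_smul, map_one]
  rfl

lemma w₀_mul_w₀ : w₀ * w₀ = w₀ := by
  have h : ∀ x : R[G], w₀ * x = opW (permMod R G G) x := fun x => by
    rw [opW_eq]
    exact (Representation.asAlgebraHom_ofMulAction_smul_eq_mul w₀ x).symm
  have h1 := h 1
  rw [mul_one] at h1
  conv_rhs => rw [h1, ← opW_opW, ← h1, ← h]

lemma w₁_mul_w₁ : w₁ * w₁ = w₁ := by
  rw [w₁, mul_sub, sub_mul, sub_mul, w₀_mul_w₀]
  simp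

lemma isProj_P₀ : IsProj P₀ := isProj_principal w₀_mul_w₀

lemma isProj_P₁ : IsProj P₁ := isProj_principal w₁_mul_w₁

lemma Γ_iso : Γ.Iso (P₀.sum P₁) := permMod_iso_principal_sum w₀_mul_w₀

/-- The elements of the Klein four-group, indexed by the images of the point fixed by `b`. -/
def τ : Fin 4 → G := ![a₂, a₁ * a₂, a₁, 1]

lemma τ_smul : ∀ i : Fin 4, τ i • (3 : Fin 4) = i := by decide

lemma mul_τ : ∀ (g : G) (i : Fin 4), ∃ j ∈ Finset.range 3, g * τ i = τ (g • i) * b ^ j := by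
  set_option maxRecDepth 100000 in decide

/-- The lattice `P₀` is the permutation lattice on four points. -/
lemma P₀_iso : P₀.Iso (permMod R G (Fin 4)) := by
  set P : RepLattice R G := principal w₀
  have hb : ∀ j : ℕ, P.ρ (b ^ j) (gen w₀) = gen w₀ := fun j => by
    have h1 : P.ρ b (gen w₀) = gen w₀ := Subtype.ext <| by
      have h := ρ_b_opW (M := permMod R G G) (1 : R[G])
      have h2 : opW (permMod R G G) (1 : R[G]) = w₀ := by
        rw [opW_eq]
        exact (Representation.asAlgebraHom_ofMulAction_smul_eq_mul w₀ 1).trans (mul_one w₀)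
      rwa [h2] at h
    induction j with
    | zero => rw [pow_zero, map_one, Module.End.one_apply]
    | succ j ih => rw [pow_succ, map_mul, Module.End.mul_apply, h1, ih]
  have hv : ∀ (g : G) (i : Fin 4), P.ρ g (P.ρ (τ i) (gen w₀)) = P.ρ (τ (g • i)) (gen w₀) :=
    fun g i => by
      obtain ⟨j, -, hj⟩ := mul_τ g i
      rw [← Module.End.mul_apply, ← map_mul, hj, map_mul, Module.End.mul_apply, hb]
  let F : (permMod R G (Fin 4)).ρ.IntertwiningMap P.ρ := permLift (fun i => P.ρ (τ i) (gen w₀)) hv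
  let E : P.ρ.IntertwiningMap (permMod R G (Fin 4)).ρ := principalHom w₀ (bas (3 : Fin 4))
  have hEF : ∀ x, E (F x) = x := LinearMap.congr_fun (f := E.toLinearMap ∘ₗ F.toLinearMap)
    (g := LinearMap.id) <| monoidAlgebra_ext fun i => by
      change E (F (bas i)) = bas i
      have : opW (permMod R G (Fin 4)) (bas (3 : Fin 4)) = bas 3 := opW_eq_self <| by
        rw [permMod_ρ_bas]
        rfl
      have h : E (gen w₀) = bas 3 := (opW_eq _ _).symm.trans this
      rw [permLift_bas, E.isIntertwining, h, permMod_ρ_bas, τ_smul]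
  have hF : Function.Surjective F := by
    have hle : ∀ x : R[G], ∃ y, F y = toPrincipal w₀ x := fun x => by
      induction x using MonoidAlgebra.induction_linear with
      | zero => exact ⟨0, by rw [map_zero, map_zero]⟩
      | add x y hx hy =>
        obtain ⟨u, hu⟩ := hx
        obtain ⟨v, hv⟩ := hy
        exact ⟨u + v, by rw [map_add, map_add, hu, hv]⟩
      | single g r =>
        refine ⟨r • (permMod R G (Fin 4)).ρ g (bas 3), ?_⟩
        have h1 : (MonoidAlgebra.single g r : R[G]) = r • (permMod R G G).ρ g (bas 1) := by
          rw [permMod_ρ_bas]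
          simp [bas]
        rw [h1, map_smul, map_smul, F.isIntertwining, (toPrincipal w₀).isIntertwining,
          permLift_bas]
        congr 2
        change P.ρ 1 (gen w₀) = _
        rw [map_one]
        exact Subtype.ext (one_mul w₀).symm
    intro x
    obtain ⟨y, hy⟩ := hle x.1
    exact ⟨y, hy.trans (Subtype.ext (mem_principal_iff w₀_mul_w₀ x))⟩
  exact (iso_of_bijective F ⟨fun x y h => by rw [← hEF x, h, hEF], hF⟩).symm

end AltFour

namespace AltFour

open Submodule

/-! ### Indices of the radicals -/

section Index

variable {M N : RepLattice R G}

lemma map_mem_dbl_sup_omega (f : M.ρ.IntertwiningMap N.ρ) {x : M.V}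
    (hx : x ∈ dbl M.V ⊔ omega M) : f x ∈ dbl N.V ⊔ omega N := by
  obtain ⟨y, hy, z, hz, rfl⟩ := mem_sup.1 hx
  rw [map_add]
  refine add_mem (mem_sup_left (map_mem_dbl f.toLinearMap hy)) (mem_sup_right ?_)
  rw [mem_omega, ← map_opW, mem_omega.1 hz, map_zero]

lemma _root_.RepLattice.Iso.idx_omega (h : M.Iso N) :
    (dbl M.V ⊔ omega M).idx = (dbl N.V ⊔ omega N).idx := by
  obtain ⟨e⟩ := h
  rw [← idx_comap_of_surjective e.toLinearMap e.surjective]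
  congr 1
  refine le_antisymm (fun x hx => map_mem_dbl_sup_omega e.toIntertwiningMap hx) fun x hx => ?_
  rw [← e.symm_apply_apply x]
  exact map_mem_dbl_sup_omega e.symm.toIntertwiningMap hx

lemma idx_omega_sum (M N : RepLattice R G) : (dbl (M.sum N).V ⊔ omega (M.sum N)).idx =
    (dbl M.V ⊔ omega M).idx * (dbl N.V ⊔ omega N).idx := by
  rw [← idx_prod]
  congr 1
  refine le_antisymm (fun x hx => ⟨map_mem_dbl_sup_omega (.fst R M.ρ N.ρ) hx,
    map_mem_dbl_sup_omega (.snd R M.ρ N.ρ) hx⟩) ?_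
  rintro ⟨x, y⟩ ⟨hx, hy⟩
  have := add_mem (map_mem_dbl_sup_omega (N := M.sum N) (.inl R M.ρ N.ρ) hx)
    (map_mem_dbl_sup_omega (N := M.sum N) (.inr R M.ρ N.ρ) hy)
  convert this using 1
  exact Prod.ext (add_zero x).symm (zero_add y).symm

/-- On a permutation lattice, the action of `w₀` is the projection to the space of orbits of `b`;
here `π` is the map to the orbits and `σ` a section. -/
lemma idx_omega_permMod {X Y : Type} [Finite X] [MulAction G X] [Finite Y] (π : X → Y) (σ : Y → X)
    (hπ : ∀ x, π (b • x) = π x) (hπσ : ∀ y, π (σ y) = y)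
    (hσ : ∀ x, ∃ j ∈ Finset.range 3, b ^ j • σ (π x) = x) :
    (dbl (permMod R G X).V ⊔ omega (permMod R G X)).idx = 2 ^ Nat.card Y := by
  set P := permMod R G X
  let p : R[X] →ₗ[R] R[Y] := linLift R fun x => MonoidAlgebra.single (π x) 1
  let s : R[Y] →ₗ[R] R[X] := linLift R fun y => MonoidAlgebra.single (σ y) 1
  have hps : ∀ y, p (s y) = y := LinearMap.congr_fun (f := p ∘ₗ s) (g := LinearMap.id) <|
    monoidAlgebra_ext fun y => by simp [p, s, hπσ]
  have hpb : ∀ x, p (P.ρ b x) = p x := LinearMap.congr_fun (f := p ∘ₗ P.ρ b) (g := p) <|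
    monoidAlgebra_ext fun x => by simp [p, P, hπ]
  have hpW : ∀ x, p (opW P x) = p x := fun x => by
    rw [opW_apply, ← ρ_b_b, map_smul, map_add, map_add, hpb, hpb, hpb,
      show p x + p x + p x = (3 : R) • p x by module, smul_smul, mul_comm, three_mul_third,
      one_smul]
  have hWj : ∀ (j : ℕ) x, opW P (P.ρ (b ^ j) x) = opW P x := fun j => by
    induction j with
    | zero => intro x; rw [pow_zero, map_one, Module.End.one_apply]
    | succ j ih => intro x; rw [pow_succ', map_mul, Module.End.mul_apply, opW_ρ_b, ih]
  have hWs : ∀ x, opW P (s (p x)) = opW P x :=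
    LinearMap.congr_fun (f := opW P ∘ₗ s ∘ₗ p) (g := opW P) <| monoidAlgebra_ext fun x => by
      obtain ⟨j, -, hj⟩ := hσ x
      have h1 : (MonoidAlgebra.single x 1 : R[X]) = P.ρ (b ^ j) (bas (σ (π x))) := by
        rw [permMod_ρ_bas, hj]
      change opW P (s (p (MonoidAlgebra.single x 1))) = opW P (MonoidAlgebra.single x 1)
      rw [show p (MonoidAlgebra.single x 1) = MonoidAlgebra.single (π x) 1 by simp [p],
        show s (MonoidAlgebra.single (π x) 1) = MonoidAlgebra.single (σ (π x)) 1 by simp [s], h1,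
        hWj]
  have h : dbl P.V ⊔ omega P = (dbl R[Y]).comap p := by
    refine le_antisymm (sup_le (fun x hx => map_mem_dbl p hx) fun x hx => ?_) fun x hx => ?_
    · change p x ∈ dbl R[Y]
      rw [← hpW, mem_omega.1 hx, map_zero]
      exact zero_mem _
    · obtain ⟨y, hy⟩ := hx
      rw [← add_sub_cancel ((2 : R) • s y) x]
      refine add_mem (mem_sup_left (two_smul_mem_dbl _)) (mem_sup_right ?_)
      rw [mem_omega, ← hWs, map_sub, map_smul, hps]
      have hy : (2 : R) • y = p x := hy
      rw [hy, sub_self, map_zero, map_zero]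
  have : Module.Finite R R[Y] := Module.Finite.of_basis (MonoidAlgebra.basis Y R)
  have := Fintype.ofFinite Y
  rw [h, idx_comap_of_surjective p (fun y => ⟨s y, hps y⟩), idx_dbl,
    Module.finrank_eq_card_basis (MonoidAlgebra.basis Y R), Nat.card_eq_fintype_card]

end Index

section FreeRadical

/-- On a free lattice over `R H`, the radical is the preimage of `2 R ^ t` under the augmentation, and
it contains every element whose norm is divisible by two. -/
lemma exists_augmentation (t : ℕ) : ∃ ε : (freeMod R H t).V →ₗ[R] (Fin t →₀ R),
    Function.Surjective ε ∧ rad (freeMod R H t) = (dbl (Fin t →₀ R)).comap ε ∧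
    ∀ q, norm (freeMod R H t) q ∈ dbl (freeMod R H t).V → ε q ∈ dbl (Fin t →₀ R) := by
  set F := freeMod R H t
  let ε₀ : R[H] →ₗ[R] R := linLift R fun _ => 1
  let κ₀ : R[H] →ₗ[R] R := linLift R fun h => if h = 1 then 1 else 0
  let ε : F.V →ₗ[R] (Fin t →₀ R) := Finsupp.mapRange.linearMap ε₀
  let η : (Fin t →₀ R) →ₗ[R] F.V := Finsupp.mapRange.linearMap (MonoidAlgebra.lsingle 1)
  let κ : F.V →ₗ[R] (Fin t →₀ R) := Finsupp.mapRange.linearMap κ₀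
  have hext : ∀ {W : Type} [AddCommGroup W] [Module R W] {f g : F.V →ₗ[R] W},
      (∀ i h, f (Finsupp.single i (MonoidAlgebra.single h 1)) =
        g (Finsupp.single i (MonoidAlgebra.single h 1))) → ∀ x, f x = g x := fun {W} _ _ f g hfg =>
    LinearMap.congr_fun <| Finsupp.lhom_ext' fun i => monoidAlgebra_ext fun h => hfg i h
  have hε : ∀ i h, ε (Finsupp.single i (MonoidAlgebra.single h 1)) = Finsupp.single i 1 :=
    fun i h => (Finsupp.mapRange_single (hf := map_zero ε₀)).trans (by simp [ε₀])
  have hη : ∀ i, η (Finsupp.single i 1) = Finsupp.single i (MonoidAlgebra.single 1 1) :=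
    fun i => Finsupp.mapRange_single (hf := map_zero _)
  have hκ₁ : ∀ i h, κ (Finsupp.single i (MonoidAlgebra.single h 1)) =
      if h = 1 then Finsupp.single i 1 else 0 :=
    fun i h => (Finsupp.mapRange_single (hf := map_zero κ₀)).trans (by
      by_cases h1 : h = 1 <;> simp [κ₀, h1])
  have hεη : ∀ v, ε (η v) = v := LinearMap.congr_fun (f := ε ∘ₗ η) (g := LinearMap.id) <| by
    refine Finsupp.lhom_ext' fun i => LinearMap.ext_ring ?_
    change ε (η (Finsupp.single i 1)) = Finsupp.single i 1
    rw [hη, hε]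
  have hερ : ∀ g x, ε (F.ρ g x) = ε x := fun g => hext (f := ε ∘ₗ F.ρ g) (g := ε) fun i h => by
    change ε (F.ρ g _) = _
    simp only [F, Representation.free_single_single]
    rw [hε, hε]
  have hεX : ∀ x, ε (opX F x) = 0 := fun x => by rw [opX_apply, map_sub, hερ, sub_self]
  have hεY : ∀ x, ε (opY F x) = 0 := fun x => by rw [opY_apply, map_sub, hερ, sub_self]
  have hκ : ∀ q, κ (norm F q) = ε q := hext (f := κ ∘ₗ norm F) (g := ε) fun i h => by
    have hsum : ∀ x, norm F x = ∑ g, F.ρ g x := fun x => by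
      rw [sum_H, map_one, Module.End.one_apply, norm_apply]
    have hρ : ∀ g, κ (F.ρ g (Finsupp.single i (MonoidAlgebra.single h 1))) =
        if g = h⁻¹ then Finsupp.single i 1 else 0 := fun g => by
      simp only [F, Representation.free_single_single]
      rw [hκ₁]
      simp only [mul_eq_one_iff_eq_inv]
    change κ (norm F _) = _
    rw [hsum, map_sum, Finset.sum_congr rfl fun g _ => hρ g, Finset.sum_ite_eq', hε]
    simp
  have hrad : ∀ x, x - η (ε x) ∈ rad F := by
    intro x
    suffices h : ∀ x, (rad F).mkQ x = ((rad F).mkQ ∘ₗ η ∘ₗ ε) x by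
      rw [← ker_mkQ (rad F), LinearMap.mem_ker, map_sub, h x]
      exact sub_self _
    refine hext fun i h => ?_
    set u : F.V := Finsupp.single i (MonoidAlgebra.single 1 1) with hu
    have h1 : (Finsupp.single i (MonoidAlgebra.single h 1) : F.V) = F.ρ h u := by simp [F, hu]
    have h2 : ε (F.ρ h u) = Finsupp.single i 1 := by rw [hερ, hε]
    change (rad F).mkQ _ = (rad F).mkQ (η (ε _))
    rw [h1, h2, hη, ← sub_eq_zero, ← map_sub, mkQ_apply, Quotient.mk_eq_zero]
    rcases eq_of_H h with rfl | rfl | rfl | rfl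
    · rw [map_one, Module.End.one_apply, sub_self]
      exact zero_mem _
    · exact opX_mem_rad u
    · exact opY_mem_rad u
    · have := add_mem (opX_mem_rad (L := F) (F.ρ α₂ u)) (opY_mem_rad u)
      rwa [opX_apply, opY_apply, sub_add_sub_cancel, ← Module.End.mul_apply, ← map_mul] at this
  refine ⟨ε, fun v => ⟨η v, hεη v⟩, le_antisymm (fun x hx => ?_) fun x hx => ?_, fun q hq => ?_⟩
  · obtain ⟨u, v, w, rfl⟩ := mem_rad.1 hx
    rw [mem_comap]
    change ε (opX F u + opY F v + (2 : R) • w) ∈ _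
    rw [map_add, map_add, hεX, hεY, zero_add, zero_add, map_smul]
    exact two_smul_mem_dbl _
  · rw [← sub_add_cancel x (η (ε x))]
    exact add_mem (hrad x) (dbl_le_rad (map_mem_dbl η hx))
  · rw [← hκ]
    exact map_mem_dbl κ hq

variable {L L' : RepLattice R H}

lemma _root_.RepLattice.Iso.idx_rad (h : L.Iso L') : (rad L).idx = (rad L').idx := by
  obtain ⟨e⟩ := h
  rw [← idx_comap_of_surjective e.toLinearMap e.surjective]
  congr 1
  refine le_antisymm (fun x hx => map_mem_rad e.toIntertwiningMap hx) fun x hx => ?_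
  rw [← e.symm_apply_apply x]
  exact map_mem_rad e.symm.toIntertwiningMap hx

lemma idx_rad_of_free {t : ℕ} (h : L.Iso (freeMod R H t)) : (rad L).idx = 2 ^ t := by
  obtain ⟨ε, hε, hrad, -⟩ := exists_augmentation t
  rw [h.idx_rad, hrad, idx_comap_of_surjective ε hε, idx_dbl]
  simp

lemma mem_rad_of_free {t : ℕ} (h : L.Iso (freeMod R H t)) {q : L.V} (hq : norm L q ∈ dbl L.V) :
    q ∈ rad L := by
  obtain ⟨ε, hε, hrad, hN⟩ := exists_augmentation t
  obtain ⟨e⟩ := h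
  have h1 : e q ∈ rad (freeMod R H t) := by
    rw [hrad]
    refine hN _ ?_
    have := map_mem_dbl e.toLinearMap hq
    have h2 : e (norm L q) = norm (freeMod R H t) (e q) := map_norm e.toIntertwiningMap q
    rw [← h2]
    exact this
  rw [← e.symm_apply_apply q]
  exact map_mem_rad e.symm.toIntertwiningMap h1

end FreeRadical

section Cover

/-- The lattices `P₀ᵃ ⊕ P₁ᶜ`, through the properties that are used: they are projective, free over
the Klein four-group, and elements `e i` in the image of `w₀` and `f j` in the image of `w₁` of any
lattice are in the image of a common map. -/
structure IsCover (a c : ℕ) (Q : RepLattice R G) : Prop where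
  isProj : IsProj Q
  res_iso : (res Q).Iso (freeMod R H (a + 2 * c))
  idx_omega : (dbl Q.V ⊔ omega Q).idx = 2 ^ (2 * (a + c))
  exists_hom : ∀ (M : RepLattice R G) (e : Fin a → M.V) (f : Fin c → M.V),
    (∀ i, opW M (e i) = e i) → (∀ j, opW M (f j) = 0) →
    ∃ φ : Q.ρ.IntertwiningMap M.ρ, (∀ i, ∃ x, φ x = e i) ∧ ∀ j, ∃ x, φ x = f j

lemma IsCover.finrank_eq {a c : ℕ} {Q : RepLattice R G} (h : IsCover a c Q) :
    Module.finrank R Q.V = 4 * (a + 2 * c) := by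
  rw [show Module.finrank R Q.V = Module.finrank R (res Q).V from rfl, h.res_iso.finrank_eq,
    finrank_freeMod, Nat.card_eq_fintype_card, card_H, mul_comm]

lemma IsCover.of_iso {a c : ℕ} {Q Q' : RepLattice R G} (h : IsCover a c Q) (e : Q'.Iso Q) :
    IsCover a c Q' where
  isProj := h.isProj.of_iso e
  res_iso := e.res.trans h.res_iso
  idx_omega := e.idx_omega.trans h.idx_omega
  exists_hom M u v hu hv := by
    obtain ⟨φ, h1, h2⟩ := h.exists_hom M u v hu hv
    obtain ⟨e⟩ := e
    have : ∀ y, (∃ x, φ x = y) → ∃ x, (φ.comp e.toIntertwiningMap) x = y := by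
      rintro _ ⟨x, rfl⟩
      exact ⟨e.symm x, congrArg φ (e.apply_symm_apply x)⟩
    exact ⟨_, fun i => this _ (h1 i), fun j => this _ (h2 j)⟩

lemma IsCover.sum {a c a' c' : ℕ} {Q Q' : RepLattice R G} (h : IsCover a c Q)
    (h' : IsCover a' c' Q') : IsCover (a + a') (c + c') (Q.sum Q') where
  isProj := h.isProj.sum h'.isProj
  res_iso := by
    rw [show a + a' + 2 * (c + c') = (a + 2 * c) + (a' + 2 * c') by ring]
    exact (h.res_iso.sum h'.res_iso : Iso (res (Q.sum Q')) _).trans (freeMod_add _ _).symm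
  idx_omega := by
    rw [idx_omega_sum, h.idx_omega, h'.idx_omega, ← pow_add]
    ring
  exists_hom M u v hu hv := by
    obtain ⟨φ, h1, h2⟩ := h.exists_hom M (u ∘ Fin.castAdd _) (v ∘ Fin.castAdd _)
      (fun i => hu _) fun j => hv _
    obtain ⟨φ', h1', h2'⟩ := h'.exists_hom M (u ∘ Fin.natAdd _) (v ∘ Fin.natAdd _)
      (fun i => hu _) fun j => hv _
    let ψ : (Q.sum Q').ρ.IntertwiningMap M.ρ :=
      φ.comp (.fst R Q.ρ Q'.ρ) + φ'.comp (.snd R Q.ρ Q'.ρ)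
    have hl : ∀ y, (∃ x, φ x = y) → ∃ x, ψ x = y := by
      rintro _ ⟨x, rfl⟩
      refine ⟨(x, 0), ?_⟩
      change φ x + φ' 0 = φ x
      rw [map_zero, add_zero]
    have hr : ∀ y, (∃ x, φ' x = y) → ∃ x, ψ x = y := by
      rintro _ ⟨x, rfl⟩
      refine ⟨(0, x), ?_⟩
      change φ 0 + φ' x = φ' x
      rw [map_zero, zero_add]
    exact ⟨ψ, fun i => Fin.addCases (fun i => hl _ (h1 i)) (fun i => hr _ (h1' i)) i,
      fun j => Fin.addCases (fun j => hl _ (h2 j)) (fun j => hr _ (h2' j)) j⟩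

/-- A permutation lattice is free over the Klein four-group if the latter acts freely. -/
lemma res_permMod {X : Type} [Finite X] [MulAction G X] {t : ℕ} (s : Fin t → X)
    (hs : ∀ x, ∃ i, ∃ g ∈ ({1, a₁, a₂, a₁ * a₂} : Finset G), g • s i = x)
    (hX : Nat.card X = t * 4) : (res (permMod R G X)).Iso (freeMod R H t) := by
  refine (iso_of_surjective (Representation.freeLift (res (permMod R G X)).ρ
    fun i => bas (s i)) (fun y => ?_) ?_).symm
  · induction y using MonoidAlgebra.induction_linear with
    | zero => exact ⟨0, map_zero _⟩
    | add x y hx hy =>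
      obtain ⟨u, hu⟩ := hx
      obtain ⟨v, hv⟩ := hy
      exact ⟨u + v, by rw [map_add, hu, hv]⟩
    | single x r =>
      obtain ⟨i, g, hg, rfl⟩ := hs x
      have hg : g ∈ H := (mem_H_iff g).2 (by simpa using hg)
      refine ⟨Finsupp.single i (MonoidAlgebra.single ⟨g, hg⟩ r), ?_⟩
      refine (Representation.freeLift_single_single _ i _ r _).trans ?_
      change r • (permMod R G X).ρ g (bas (s i)) = _
      rw [permMod_ρ_bas]
      simp [bas]
  · change _ = Module.finrank R (permMod R G X).V
    rw [finrank_freeMod, finrank_permMod, hX, Nat.card_eq_fintype_card, card_H]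

lemma isCover_P₀ : IsCover 1 0 P₀ where
  isProj := isProj_P₀
  res_iso := P₀_iso.res.trans (res_permMod (fun _ : Fin 1 => 3) (by decide) (by simp))
  idx_omega := by
    rw [P₀_iso.idx_omega, idx_omega_permMod (X := Fin 4) (![0, 0, 0, 1] : Fin 4 → Fin 2) ![0, 3]
      (by decide) (by decide) (by decide)]
    simp
  exists_hom M u v hu _ := by
    refine ⟨principalHom w₀ (u 0), fun i => ⟨gen w₀, ?_⟩, fun j => j.elim0⟩
    rw [Subsingleton.elim i 0]
    exact (opW_eq M (u 0)).symm.trans (hu 0)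

lemma idx_omega_Γ : (dbl Γ.V ⊔ omega Γ).idx = 2 ^ 4 := by
  have := idx_omega_permMod (X := G) (fun g => g⁻¹ • (3 : Fin 4)) (fun i => (τ i)⁻¹)
    (by set_option maxRecDepth 100000 in decide) (by decide)
    (by set_option maxRecDepth 100000 in decide)
  rw [Nat.card_eq_fintype_card, Fintype.card_fin] at this
  exact this

lemma res_Γ : (res Γ).Iso (freeMod R H 3) :=
  res_permMod (X := G) (fun i : Fin 3 => b ^ (i : ℕ))
    (by set_option maxRecDepth 100000 in decide) (by
      rw [Nat.card_eq_fintype_card]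
      set_option maxRecDepth 100000 in decide)

lemma isCover_P₁ : IsCover 0 1 P₁ where
  isProj := isProj_P₁
  res_iso := by
    have h1 : (freeMod R H 3).Iso ((freeMod R H 1).sum (res P₁)) :=
      res_Γ.symm.trans ((Γ_iso.res : (res Γ).Iso ((res P₀).sum (res P₁))).trans
        (isCover_P₀.res_iso.sum (iso_refl (res P₁))))
    have h2 := (freeMod_add (G' := H) 1 2).symm.trans h1
    rw [← isoClass_eq_iff, isoClass_sum, isoClass_sum] at h2
    exact (isoClass_eq_iff.1 (add_left_cancel h2)).symm
  idx_omega := by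
    have h := Γ_iso.idx_omega
    rw [idx_omega_sum, idx_omega_Γ, isCover_P₀.idx_omega] at h
    norm_num at h ⊢
    omega
  exists_hom M u v _ hv := by
    refine ⟨principalHom w₁ (v 0), fun j => j.elim0, fun i => ⟨gen w₁, ?_⟩⟩
    rw [Subsingleton.elim i 0]
    change M.ρ.asAlgebraHom (1 - w₀) (v 0) = _
    rw [map_sub, map_one, LinearMap.sub_apply, ← opW_eq, hv 0, Module.End.one_apply, sub_zero]

lemma freeMod_one_iso_sum : (freeMod R G 1).Iso (P₀.sum P₁) := (freeMod_one_iso R).trans Γ_iso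

lemma isCover_freeMod (k : ℕ) : IsCover k k (freeMod R G k) := by
  induction k with
  | zero =>
    have h1 : Subsingleton (freeMod R G 0).V :=
      inferInstanceAs (Subsingleton (Fin 0 →₀ R[G]))
    have h2 : Subsingleton (freeMod R H (0 + 2 * 0)).V :=
      inferInstanceAs (Subsingleton (Fin 0 →₀ R[H]))
    refine ⟨isProj_freeMod 0, iso_of_bijective 0
      ⟨fun _ _ _ => Subsingleton.elim (α := (freeMod R G 0).V) _ _, fun y => ⟨0, Subsingleton.elim _ _⟩⟩, ?_,
      fun M e f _ _ => ⟨0, fun j => j.elim0, fun j => j.elim0⟩⟩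
    exact idx_eq_one.2 (Subsingleton.elim _ _)
  | succ k ih =>
    exact (ih.sum ((isCover_P₀.sum isCover_P₁).of_iso freeMod_one_iso_sum)).of_iso (freeMod_add k 1)

end Cover

end AltFour

namespace AltFour

open Submodule

/-! ### Lifting the Heller modules to `A₄` -/

/-- The invariants that are carried along the recursion for the lifts of the Heller modules: the
first two say that the norm of `H` and the element `a₂ - 1` act on `M / 2 M` as zero and into the
image of `a₁ - 1`; the indices are the orders of `M`, of its head, and of their fixed points under
`b`, all modulo 2. -/
structure IsHellerLift (n : ℕ) (M : RepLattice R G) : Prop where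
  norm_mem : ∀ m, norm (res M) m ∈ dbl M.V
  opY_mem : ∀ m, ∃ u v, opY (res M) m = opX (res M) u + (2 : R) • v
  finrank_eq : Module.finrank R M.V = 2 * n + 1
  idx_omega : (dbl M.V ⊔ omega M).idx = 2 ^ (2 * (n / 3) + 1)
  idx_rad : (rad (res M)).idx = 2 ^ (n + 1)
  idx_rad_omega : (rad (res M) ⊔ omega M).idx = 2 ^ (n + 1 - 2 * ((n + 2) / 3))
  res_iso : (res M).Iso (hellerNat R H n)

lemma dbl_cancel {V : Type} [AddCommGroup V] [Module R V] [Module.Free R V] {x y : V}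
    (h : (2 : R) • x = (2 : R) • y) : x = y :=
  smul_right_injective V (two_ne_zero (α := R)) h

lemma isHellerLift_zero : IsHellerLift 0 (triv R G) := by
  have hX : ∀ x, opX (res (triv R G)) x = 0 := fun x => sub_self x
  have hY : ∀ x, opY (res (triv R G)) x = 0 := fun x => sub_self x
  have hdbl : (dbl R).idx = 2 := idx_dbl_ring
  have hrad : rad (res (triv R G)) = dbl R := by
    refine le_antisymm (fun x hx => ?_) dbl_le_rad
    obtain ⟨u, v, w, rfl⟩ := mem_rad.1 hx
    rw [hX, hY, zero_add, zero_add]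
    exact two_smul_mem_dbl w
  have homega : omega (triv R G) = ⊥ := by
    refine eq_bot_iff.2 fun x hx => ?_
    exact (opW_eq_self (M := triv R G) (x := x) rfl).symm.trans hx
  refine ⟨fun m => ?_, fun m => ⟨0, 0, ?_⟩, ?_, ?_, ?_, ?_, ⟨.refl _⟩⟩
  · exact ⟨(2 : R) • m, by
      change (2 : R) • (2 : R) • m = m + m + m + m
      module⟩
  · rw [hY, map_zero, smul_zero, add_zero]
  · exact Module.finrank_self R
  · rw [homega, sup_bot_eq]
    exact hdbl
  · rw [hrad]
    exact hdbl
  · rw [homega, hrad, sup_bot_eq]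
    exact hdbl

section Step

variable {K Q M : RepLattice R G} {n a c : ℕ}

/-- A map onto `M` modulo its radical is surjective. -/
lemma IsHellerLift.surjective (hM : IsHellerLift n M) {φ : Q.ρ.IntertwiningMap M.ρ}
    (h : LinearMap.range φ.toLinearMap ⊔ rad (res M) = ⊤) : Function.Surjective φ := by
  refine LinearMap.range_eq_top.1 (eq_top_of_sup_dbl ?_)
  rw [eq_top_iff]
  rintro m -
  have hrad : ∀ x ∈ rad (res M), ∃ u v, x = opX (res M) u + (2 : R) • v := fun x hx => by
    obtain ⟨u, v, w, rfl⟩ := mem_rad.1 hx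
    obtain ⟨u', v', h⟩ := hM.opY_mem v
    exact ⟨u + u', v' + w, by rw [h, map_add, smul_add]; abel⟩
  have hsplit : ∀ m : M.V, ∃ q u v, m = φ q + opX (res M) u + (2 : R) • v := fun m => by
    obtain ⟨_, ⟨q, rfl⟩, r, hr, rfl⟩ := mem_sup.1 (h ▸ mem_top : m ∈ _ ⊔ _)
    obtain ⟨u, v, rfl⟩ := hrad r hr
    exact ⟨q, u, v, (add_assoc _ _ _).symm⟩
  obtain ⟨q, u, v, rfl⟩ := hsplit m
  obtain ⟨q', u', v', rfl⟩ := hsplit u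
  -- `(a₁ - 1)² = -2 (a₁ - 1)`
  have : φ q + opX (res M) (φ q' + opX (res M) u' + (2 : R) • v') + (2 : R) • v =
      φ (q + opX (res Q) q') + (2 : R) • (v - opX (res M) u' + opX (res M) v') := by
    have h1 : φ (opX (res Q) q') = opX (res M) (φ q') := map_opX (resHom φ) q'
    rw [map_add, map_add, map_add, opX_opX, map_smul, h1]
    module
  rw [this]
  exact add_mem (mem_sup_left ⟨_, rfl⟩) (mem_sup_right (two_smul_mem_dbl _))

/-- The projective cover of a lift of a Heller module. -/
lemma IsHellerLift.exists_surjective (hM : IsHellerLift n M) (hQ : IsCover a c Q)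
    (ha : a = n + 1 - 2 * ((n + 2) / 3)) (hac : a + 2 * c = n + 1) :
    ∃ φ : Q.ρ.IntertwiningMap M.ρ, Function.Surjective φ := by
  obtain ⟨c', e, f, hc', he, hf, hU⟩ := exists_eigengenerators (J := rad (res M))
    (fun x hx => ρ_b_mem_rad hx)
    (dbl_le_rad (L := res M)) hM.idx_rad hM.idx_rad_omega
  obtain rfl : c' = c := by omega
  subst ha
  obtain ⟨φ, h1, h2⟩ := hQ.exists_hom M e f he hf
  refine ⟨φ, hM.surjective (hU _ (fun x hx => ?_) le_sup_right
    (fun i => mem_sup_left (h1 i)) fun j => mem_sup_left (h2 j))⟩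
  obtain ⟨_, ⟨q, rfl⟩, r, hr, rfl⟩ := mem_sup.1 hx
  rw [map_add]
  exact add_mem (mem_sup_left ⟨Q.ρ b q, φ.isIntertwining _ _ b q⟩)
    (mem_sup_right (ρ_b_mem_rad hr))

/-- The Heller module of a lattice over the Klein four-group is the kernel of any map from a free
lattice, as long as this kernel has no free summand. -/
lemma theta_iso {A L : RepLattice R H} {t : ℕ} (hA : ∀ x, norm A x ∈ dbl A.V)
    (h : IsShortExact A (freeMod R H t) L) : A.Iso L.theta := by
  have hθ : IsShortExact L.theta (freeMod R H L.coverRank) L :=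
    ⟨hom (Submodule.subtype _) fun _ _ => rfl, L.cover, Subtype.val_injective,
      fun x => ⟨fun hx => ⟨⟨x, hx⟩, rfl⟩, fun ⟨y, hy⟩ => hy ▸ y.2⟩, L.cover_surjective⟩
  have hle : L.coverRank ≤ t := by
    obtain ⟨i, p, -, -, hp⟩ := h
    exact Nat.sInf_le ⟨p, hp⟩
  obtain ⟨s, rfl⟩ := Nat.exists_eq_add_of_le hle
  have h1 := schanuel (isProj_freeMod _) (isProj_freeMod _) h hθ
  rw [← isoClass_eq_iff, isoClass_sum, isoClass_sum, isoClass_eq_iff.2 (freeMod_add _ _),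
    isoClass_sum, add_comm (freeMod R H L.coverRank).isoClass, ← add_assoc] at h1
  have h2 := add_right_cancel h1
  rw [← isoClass_sum, isoClass_eq_iff] at h2
  obtain ⟨e⟩ := h2
  have hs : s = 0 := by
    have : rad (freeMod R H s) = ⊤ := by
      rw [eq_top_iff]
      rintro x -
      refine mem_rad_of_free (iso_refl _) ?_
      let π : A.ρ.IntertwiningMap (freeMod R H s).ρ :=
        (Representation.IntertwiningMap.snd R L.theta.ρ (freeMod R H s).ρ).comp
          e.toIntertwiningMap
      obtain ⟨y, rfl⟩ : ∃ y, π y = x := by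
        refine ⟨e.symm (0, x), ?_⟩
        change (e (e.symm (0, x))).2 = x
        rw [e.apply_symm_apply]
      rw [← map_norm]
      exact map_mem_dbl π.toLinearMap (hA y)
    have h3 := idx_rad_of_free (iso_refl (freeMod R H s))
    rw [this, idx_top] at h3
    exact (Nat.pow_eq_one.1 h3.symm).resolve_left (by norm_num)
  subst hs
  have : Subsingleton (freeMod R H 0).V := inferInstanceAs (Subsingleton (Fin 0 →₀ R[H]))
  exact Iso.trans ⟨e⟩ (iso_sum_of_subsingleton _ _)

lemma IsHellerLift.step (hM : IsHellerLift n M) (hQ : IsCover a c Q)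
    (ha : a = n + 1 - 2 * ((n + 2) / 3)) (hac : a + 2 * c = n + 1) (h : IsShortExact K Q M) :
    IsHellerLift (n + 1) K := by
  obtain ⟨i, p, hi, hip, hp⟩ := id h
  have hpi : ∀ x, p (i x) = 0 := fun x => (hip _).2 ⟨x, rfl⟩
  have hK : ∀ q, p q = 0 → ∃ x, i x = q := fun q hq => (hip q).1 hq
  have hrange : LinearMap.range i.toLinearMap = LinearMap.ker p.toLinearMap := by
    ext q
    exact (hip q).symm
  have hidx : ∀ D : Submodule R Q.V,
      (D.comap i.toLinearMap).idx = D.relIdx (LinearMap.ker p.toLinearMap) := fun D => by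
    rw [idx_comap, hrange]
  have hiX : ∀ x, i (opX (res K) x) = opX (res Q) (i x) := map_opX (resHom i)
  have hiY : ∀ x, i (opY (res K) x) = opY (res Q) (i x) := map_opY (resHom i)
  have hiN : ∀ x, i (norm (res K) x) = norm (res Q) (i x) := map_norm (resHom i)
  have hpX : ∀ x, p (opX (res Q) x) = opX (res M) (p x) := map_opX (resHom p)
  have hpY : ∀ x, p (opY (res Q) x) = opY (res M) (p x) := map_opY (resHom p)
  have hpN : ∀ x, p (norm (res Q) x) = norm (res M) (p x) := map_norm (resHom p)
  -- `K` is pure in `Q`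
  have hpure : ∀ x : K.V, i x ∈ dbl Q.V → x ∈ dbl K.V := by
    rintro x ⟨q, hq⟩
    have hq : (2 : R) • q = i x := hq
    obtain ⟨y, rfl⟩ := hK q <| dbl_cancel <| by rw [← map_smul, hq, hpi, smul_zero]
    exact ⟨y, hi (by rw [← hq]; exact map_smul i _ _)⟩
  -- `K` is contained in the radical, by comparison of the heads of `Q` and `M`
  have hrad : rad (res Q) = (rad (res M)).comap p.toLinearMap := by
    refine eq_of_le_of_idx_le (fun x hx => map_mem_rad (resHom p) hx) ?_ ?_
    · rw [idx_rad_of_free hQ.res_iso]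
      positivity
    · rw [idx_rad_of_free hQ.res_iso, idx_comap_of_surjective _ hp, hM.idx_rad, hac]
  have hKrad : ∀ x, i x ∈ rad (res Q) := fun x => by
    rw [hrad, mem_comap]
    change p (i x) ∈ _
    rw [hpi]
    exact zero_mem _
  have hNrad : ∀ q, norm (res Q) q ∈ dbl Q.V ↔ q ∈ rad (res Q) := fun q =>
    ⟨fun h => mem_rad_of_free hQ.res_iso h, fun h => norm_mem_dbl_of_mem_rad h⟩
  -- every `(a₁ - 1) (a₂ - 1) q` is in `(a₁ - 1) K`, modulo 2
  have hXY : ∀ q, ∃ x v, opX (res Q) (opY (res Q) q) = i (opX (res K) x) + (2 : R) • v := by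
    intro q
    obtain ⟨u, v, huv⟩ := hM.opY_mem (p q)
    obtain ⟨u, rfl⟩ := hp u
    obtain ⟨v, rfl⟩ := hp v
    obtain ⟨x, hx⟩ := hK (opY (res Q) q - opX (res Q) u - (2 : R) • v) <| by
      rw [map_sub, map_sub, hpY, hpX, huv, map_smul]
      abel
    refine ⟨x, -opX (res Q) u + opX (res Q) v, ?_⟩
    rw [hiX, hx, map_sub, map_sub, opX_opX, map_smul]
    module
  have hnorm : ∀ x, norm (res K) x ∈ dbl K.V := fun x => hpure _ <| by
    rw [hiN, hNrad]
    exact hKrad x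
  have hXYN : ∀ q, opX (res Q) (opY (res Q) q) ∈ LinearMap.range (norm (res Q)) ⊔ dbl Q.V :=
    fun q => by
      rw [opX_opY]
      exact sub_mem (mem_sup_left ⟨q, rfl⟩) (mem_sup_right (two_smul_mem_dbl _))
  have hradK : (LinearMap.range (norm (res Q)) ⊔ dbl Q.V).comap i.toLinearMap = rad (res K) := by
    refine le_antisymm (fun x hx => ?_) fun x hx => ?_
    · obtain ⟨_, ⟨q, rfl⟩, _, ⟨w, rfl⟩, hx⟩ := mem_sup.1 hx
      have hx : norm (res Q) q + (2 : R) • w = i x := hx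
      obtain ⟨y, v, hy⟩ := hXY q
      rw [opX_opY, sub_eq_iff_eq_add] at hy
      rw [← add_sub_cancel (opX (res K) y) x]
      refine add_mem (opX_mem_rad y) (dbl_le_rad (L := res K) (hpure _ ?_))
      rw [map_sub, ← hx, hy]
      refine ⟨v + ((res Q).ρ α₁ q + (res Q).ρ α₂ q) + w, ?_⟩
      change (2 : R) • (v + ((res Q).ρ α₁ q + (res Q).ρ α₂ q) + w) = _
      module
    · obtain ⟨u, v, w, rfl⟩ := mem_rad.1 hx
      rw [mem_comap]
      change i (opX (res K) u + opY (res K) v + (2 : R) • w) ∈ _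
      rw [map_add, map_add, map_smul, hiX, hiY]
      obtain ⟨p₁, q₁, w₁, h₁⟩ := mem_rad.1 (hKrad u)
      obtain ⟨p₂, q₂, w₂, h₂⟩ := mem_rad.1 (hKrad v)
      rw [h₁, h₂, map_add, map_add, map_add, map_add, opX_opX, opY_opY, opY_opX, map_smul, map_smul]
      refine add_mem (add_mem (add_mem (add_mem ?_ (hXYN _)) ?_) (add_mem (add_mem (hXYN _) ?_) ?_))
        ?_ <;> exact mem_sup_right (two_smul_mem_dbl _)
  have hdblK : (dbl Q.V).comap i.toLinearMap = dbl K.V :=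
    le_antisymm hpure fun x hx => map_mem_dbl i.toLinearMap hx
  have homegaK' : ∀ x, x ∈ omega K ↔ i x ∈ omega Q := fun x => by
    rw [mem_omega, mem_omega, ← map_opW, map_eq_zero_iff i hi]
  -- the fixed points of `b` split off
  have hsplit : ∀ D : Submodule R Q.V, (∀ x ∈ D, opW Q x ∈ D) →
      (D ⊔ omega Q).comap i.toLinearMap = D.comap i.toLinearMap ⊔ omega K := fun D hD => by
    refine le_antisymm (fun x hx => ?_) (sup_le (comap_mono le_sup_left) fun x hx =>
      mem_sup_right (T := omega Q) ((homegaK' x).1 hx))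
    obtain ⟨y, hy, z, hz, hx⟩ := mem_sup.1 hx
    have hx : y + z = i x := hx
    rw [← add_sub_cancel (opW K x) x]
    refine add_mem (mem_sup_left ?_) (mem_sup_right (sub_opW_mem_omega x))
    change i (opW K x) ∈ D
    rw [map_opW, ← hx, map_add, mem_omega.1 hz, add_zero]
    exact hD y hy
  have hWdbl : ∀ x ∈ dbl Q.V, opW Q x ∈ dbl Q.V := fun x hx => map_mem_dbl (opW Q) hx
  have homegaK : (dbl Q.V ⊔ omega Q).comap i.toLinearMap = dbl K.V ⊔ omega K := by
    rw [hsplit _ hWdbl, hdblK]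
  have hradomegaK : (LinearMap.range (norm (res Q)) ⊔ (dbl Q.V ⊔ omega Q)).comap i.toLinearMap =
      rad (res K) ⊔ omega K := by
    rw [← sup_assoc, hsplit, hradK]
    intro x hx
    obtain ⟨_, ⟨q, rfl⟩, z, hz, rfl⟩ := mem_sup.1 hx
    rw [map_add, opW_norm]
    exact add_mem (mem_sup_left ⟨_, rfl⟩) (mem_sup_right (hWdbl z hz))
  have hdblM : (dbl Q.V).map p.toLinearMap = dbl M.V := map_dbl_of_surjective _ hp
  have homega : ∀ m ∈ omega M, ∃ q ∈ omega Q, p q = m := fun m hm => by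
    obtain ⟨q, rfl⟩ := hp m
    exact ⟨q - opW Q q, sub_opW_mem_omega q, by
      rw [map_sub, map_opW, mem_omega.1 hm, sub_zero]⟩
  have homega' : ∀ q ∈ omega Q, p q ∈ omega M := fun q hq => by
    rw [mem_omega, ← map_opW, mem_omega.1 hq, map_zero]
  have homegaM : (dbl Q.V ⊔ omega Q).map p.toLinearMap = dbl M.V ⊔ omega M := by
    rw [Submodule.map_sup, hdblM]
    congr 1
    refine le_antisymm ?_ fun m hm => homega m hm
    rintro _ ⟨q, hq, rfl⟩
    exact homega' q hq
  have hradomegaQ : ((dbl Q.V ⊔ omega Q).comap (norm (res Q))) =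
      (rad (res M) ⊔ omega M).comap p.toLinearMap := by
    refine le_antisymm (fun q hq => ?_) fun q hq => ?_
    · have h1 : opW Q q ∈ rad (res Q) := by
        rw [← hNrad, ← opW_norm]
        obtain ⟨y, hy, z, hz, h⟩ := mem_sup.1 hq
        rw [← h, map_add, mem_omega.1 hz, add_zero]
        exact hWdbl y hy
      rw [hrad] at h1
      rw [← add_sub_cancel (opW Q q) q, mem_comap, map_add]
      exact add_mem (mem_sup_left h1) (mem_sup_right (homega' _ (sub_opW_mem_omega q)))
    · obtain ⟨r, hr, m, hm, h⟩ := mem_sup.1 hq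
      obtain ⟨z, hz, rfl⟩ := homega m hm
      have h : r + p z = p q := h
      have h1 : q - z ∈ rad (res Q) := by
        rw [hrad, mem_comap]
        change p (q - z) ∈ _
        rwa [map_sub, ← h, add_sub_cancel_right]
      rw [← sub_add_cancel q z, mem_comap, map_add]
      refine add_mem (mem_sup_left ((hNrad _).2 h1)) (mem_sup_right ?_)
      rw [mem_omega, opW_norm, mem_omega.1 hz, map_zero]
  have e1 : 4 * (a + 2 * c) = Module.finrank R K.V + (2 * n + 1) := by
    have h1 := relIdx_ker_mul hp (0 : Q.V →ₗ[R] Q.V) hdblM fun v => by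
      change p 0 ∈ _
      rw [map_zero]
      exact zero_mem _
    rw [LinearMap.range_zero, bot_sup_eq, ← hidx, hdblK, comap_zero, idx_top, mul_one, idx_dbl,
      idx_dbl, idx_dbl, hM.finrank_eq, hQ.finrank_eq, ← pow_add] at h1
    exact (Nat.pow_right_injective le_rfl h1).symm
  refine ⟨hnorm, fun x => ?_, ?_, ?_, ?_, ?_, ?_⟩
  · obtain ⟨u, v, w, h1⟩ := mem_rad.1 (hKrad x)
    obtain ⟨y, v', h2⟩ := hXY u
    obtain ⟨z, hz⟩ := hpure (opY (res K) x - opX (res K) y) <| by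
      rw [map_sub, hiY, h1, map_add, map_add, opY_opX, h2, opY_opY, map_smul]
      refine ⟨v' - opY (res Q) v + opY (res Q) w, ?_⟩
      change (2 : R) • (v' - opY (res Q) v + opY (res Q) w) = _
      module
    refine ⟨y, z, ?_⟩
    have hz : (2 : R) • z = _ := hz
    rw [hz]
    abel
  · omega
  · have h1 := relIdx_ker_mul hp (0 : Q.V →ₗ[R] Q.V) homegaM fun v => by
      change p 0 ∈ _
      rw [map_zero]
      exact zero_mem _
    rw [LinearMap.range_zero, bot_sup_eq, ← hidx, homegaK, comap_zero, idx_top, mul_one,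
      hM.idx_omega, hQ.idx_omega] at h1
    refine Nat.eq_of_mul_eq_mul_right (m := 2 ^ (2 * (n / 3) + 1)) (by positivity) ?_
    rw [h1, ← pow_add]
    congr 1
    omega
  · have h1 := relIdx_ker_mul hp (norm (res Q)) hdblM fun v => by
      change p (norm (res Q) v) ∈ _
      rw [hpN]
      exact hM.norm_mem _
    have h2 : (dbl Q.V).comap (norm (res Q)) = rad (res Q) := Submodule.ext hNrad
    rw [← hidx, hradK, h2, idx_rad_of_free hQ.res_iso, idx_dbl, idx_dbl, hM.finrank_eq,
      hQ.finrank_eq] at h1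
    refine Nat.eq_of_mul_eq_mul_right (m := 2 ^ (a + 2 * c) * 2 ^ (2 * n + 1)) (by positivity) ?_
    rw [← mul_assoc, h1, ← pow_add, ← pow_add]
    congr 1
    omega
  · have h1 := relIdx_ker_mul hp (norm (res Q)) homegaM fun v => by
      change p (norm (res Q) v) ∈ _
      rw [hpN]
      exact mem_sup_left (hM.norm_mem _)
    rw [← hidx, hradomegaK, hradomegaQ, idx_comap_of_surjective _ hp, hM.idx_rad_omega,
      hM.idx_omega, hQ.idx_omega] at h1
    refine Nat.eq_of_mul_eq_mul_right
      (m := 2 ^ (n + 1 - 2 * ((n + 2) / 3)) * 2 ^ (2 * (n / 3) + 1)) (by positivity) ?_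
    rw [← mul_assoc, h1, ← pow_add, ← pow_add]
    congr 1
    omega
  · exact theta_iso (t := n + 1) hnorm <| hac ▸
      (h.res.congr (iso_refl _) hQ.res_iso hM.res_iso)

end Step

end AltFour

namespace AltFour

open Submodule

/-- The projective cover of the lift of the `n`-th Heller module. -/
def coverMod (n : ℕ) : RepLattice R G :=
  if n % 3 = 0 then P₀.sum (freeMod R G (n / 3))
  else if n % 3 = 1 then P₁.sum (freeMod R G (n / 3)) else freeMod R G (n / 3 + 1)

lemma coverMod_zero (k : ℕ) : coverMod (3 * k) = P₀.sum (freeMod R G k) := by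
  rw [coverMod, if_pos (by omega), Nat.mul_div_cancel_left _ (by norm_num)]

lemma coverMod_one (k : ℕ) : coverMod (3 * k + 1) = P₁.sum (freeMod R G k) := by
  rw [coverMod, if_neg (by omega), if_pos (by omega), show (3 * k + 1) / 3 = k by omega]

lemma coverMod_two (k : ℕ) : coverMod (3 * k + 2) = freeMod R G (k + 1) := by
  rw [coverMod, if_neg (by omega), if_neg (by omega), show (3 * k + 2) / 3 = k by omega]

lemma isCover_coverMod (n : ℕ) : ∃ a c, a = n + 1 - 2 * ((n + 2) / 3) ∧ a + 2 * c = n + 1 ∧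
    IsCover a c (coverMod n) := by
  obtain ⟨k, rfl | rfl | rfl⟩ : ∃ k, n = 3 * k ∨ n = 3 * k + 1 ∨ n = 3 * k + 2 :=
    ⟨n / 3, by omega⟩
  · exact ⟨1 + k, 0 + k, by omega, by omega,
      coverMod_zero k ▸ isCover_P₀.sum (isCover_freeMod k)⟩
  · exact ⟨0 + k, 1 + k, by omega, by omega,
      coverMod_one k ▸ isCover_P₁.sum (isCover_freeMod k)⟩
  · exact ⟨k + 1, k + 1, by omega, by omega, coverMod_two k ▸ isCover_freeMod (k + 1)⟩

lemma isProj_coverMod (n : ℕ) : IsProj (coverMod n) := by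
  obtain ⟨_, _, -, -, h⟩ := isCover_coverMod n
  exact h.isProj

lemma IsHellerLift.exists_succ {n : ℕ} {M : RepLattice R G} (hM : IsHellerLift n M) :
    ∃ K, IsHellerLift (n + 1) K ∧ IsShortExact K (coverMod n) M := by
  obtain ⟨a, c, ha, hac, hQ⟩ := isCover_coverMod n
  obtain ⟨φ, hφ⟩ := hM.exists_surjective hQ ha hac
  have h : IsShortExact ((coverMod n).ofSub φ.ker) (coverMod n) M :=
    ⟨hom (Submodule.subtype _) fun _ _ => rfl, φ, Subtype.val_injective,
      fun x => ⟨fun hx => ⟨⟨x, hx⟩, rfl⟩, fun ⟨y, hy⟩ => hy ▸ y.2⟩, hφ⟩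
  exact ⟨_, hM.step hQ ha hac h, h⟩

/-- The lifts of the Heller modules, with their defining property. -/
def liftAux : (n : ℕ) → {M : RepLattice R G // IsHellerLift n M}
  | 0 => ⟨triv R G, isHellerLift_zero⟩
  | n + 1 => ⟨(liftAux n).2.exists_succ.choose, (liftAux n).2.exists_succ.choose_spec.1⟩

/-- The lift to `A₄` of the `n`-th Heller module, as an iterated kernel of projective covers. -/
def liftNat (n : ℕ) : RepLattice R G := (liftAux n).1

lemma isHellerLift_liftNat (n : ℕ) : IsHellerLift n (liftNat n) := (liftAux n).2

lemma isShortExact_liftNat (n : ℕ) :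
    IsShortExact (liftNat (n + 1)) (coverMod n) (liftNat n) :=
  (liftAux n).2.exists_succ.choose_spec.2

/-! ### Tensor products with projective lattices -/

/-- A vector in the image of `w₀` or `w₁`, tensored with the point fixed by `b`, is again such a
vector. These vectors generate the tensor product. -/
lemma tensor_P₀_iso {M Q : RepLattice R G} {a c : ℕ} (hQ : IsCover a c Q)
    (hM : (dbl M.V ⊔ omega M).idx = 2 ^ a) (hr : Module.finrank R M.V = a + 2 * c) :
    (M.tensor P₀).Iso Q := by
  refine ((iso_refl M).tensor P₀_iso).trans ?_
  set P := permMod R G (Fin 4)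
  obtain ⟨c', e, f, hc', he, hf, hU⟩ := exists_eigengenerators (M := M) (J := dbl M.V)
    (fun x hx => map_mem_dbl (M.ρ b) hx) le_rfl (idx_dbl M.V) hM
  obtain rfl : c' = c := by omega
  have hP : P.ρ b (bas 3) = bas 3 := permMod_ρ_bas b 3
  have hb : ∀ m : M.V, (M.tensor P).ρ b (m ⊗ₜ bas 3) = M.ρ b m ⊗ₜ bas 3 := fun m => by
    change M.ρ b m ⊗ₜ P.ρ b (bas 3) = _
    rw [hP]
  have hW : ∀ m : M.V, opW (M.tensor P) (m ⊗ₜ bas 3) = opW M m ⊗ₜ bas 3 := fun m => by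
    rw [opW_apply, ← ρ_b_b, hb, hb, ← TensorProduct.add_tmul, ← TensorProduct.add_tmul,
      opW_apply, ← ρ_b_b]
    rfl
  obtain ⟨φ, h1, h2⟩ := hQ.exists_hom (M.tensor P) (fun i => e i ⊗ₜ bas 3) (fun j => f j ⊗ₜ bas 3)
    (fun i => by rw [hW, he]) fun j => by rw [hW, hf, TensorProduct.zero_tmul]
  set W : Submodule R (M.tensor P).V := LinearMap.range φ.toLinearMap ⊔ dbl (M.tensor P).V
  have hWρ : ∀ g, ∀ x ∈ W, (M.tensor P).ρ g x ∈ W := by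
    intro g x hx
    obtain ⟨_, ⟨q, rfl⟩, y, hy, rfl⟩ := mem_sup.1 hx
    rw [map_add]
    exact add_mem (mem_sup_left ⟨Q.ρ g q, φ.isIntertwining _ _ g q⟩)
      (mem_sup_right (map_mem_dbl ((M.tensor P).ρ g) hy))
  have h3 : ∀ m : M.V, m ⊗ₜ bas 3 ∈ W := by
    let ι : M.V →ₗ[R] (M.tensor P).V := (TensorProduct.mk R M.V P.V).flip (bas 3)
    have := hU (W.comap ι) (fun m hm => ?_) (fun x hx => mem_sup_right (map_mem_dbl ι hx))
      (fun i => mem_sup_left (h1 i)) (fun j => mem_sup_left (h2 j))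
    · exact fun m => (this ▸ mem_top : m ∈ W.comap ι)
    · change M.ρ b m ⊗ₜ bas 3 ∈ W
      rw [← hb]
      exact hWρ b _ hm
  have htop : W = ⊤ := by
    rw [eq_top_iff, ← TensorProduct.span_tmul_eq_top, span_le]
    rintro _ ⟨m, p, rfl⟩
    change m ⊗ₜ p ∈ W
    induction p using MonoidAlgebra.induction_linear with
    | zero => rw [TensorProduct.tmul_zero]; exact zero_mem _
    | add x y hx hy => rw [TensorProduct.tmul_add]; exact add_mem hx hy
    | single i r =>
      have h4 := hWρ (τ i) _ (h3 (M.ρ (τ i)⁻¹ m))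
      have h5 : (M.tensor P).ρ (τ i) (M.ρ (τ i)⁻¹ m ⊗ₜ bas 3) =
          m ⊗ₜ MonoidAlgebra.single i 1 := by
        change M.ρ (τ i) (M.ρ (τ i)⁻¹ m) ⊗ₜ P.ρ (τ i) (bas 3) = _
        rw [← Module.End.mul_apply, ← map_mul, mul_inv_cancel, map_one, permMod_ρ_bas, τ_smul]
        rfl
      rw [h5] at h4
      have := W.smul_mem r h4
      rw [← TensorProduct.tmul_smul] at this
      simpa using this
  refine (iso_of_surjective φ (LinearMap.range_eq_top.1 (eq_top_of_sup_dbl htop)) ?_).symm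
  change _ = Module.finrank R (M.V ⊗[R] P.V)
  rw [Module.finrank_tensorProduct, hQ.finrank_eq, finrank_permMod, hr, Nat.card_eq_fintype_card,
    Fintype.card_fin, mul_comm]

lemma tensor_Γ_iso (M : RepLattice R G) :
    (M.tensor Γ).Iso (freeMod R G (Module.finrank R M.V)) := by
  change (M.tensor (permMod R G G)).Iso _
  set P := permMod R G G
  let B := Module.finBasis R M.V
  have hP : ∀ g, P.ρ g (bas (1 : G)) = bas g := fun g => by
    refine (permMod_ρ_bas g (1 : G)).trans ?_
    rw [smul_eq_mul, mul_one]
  let φ := Representation.freeLift (M.tensor P).ρ fun i => B i ⊗ₜ (bas (1 : G))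
  refine (iso_of_surjective (M := freeMod R G (Module.finrank R M.V)) (N := M.tensor P) φ ?_
    ?_).symm
  · refine LinearMap.range_eq_top.1 (?_ : LinearMap.range φ.toLinearMap = ⊤)
    set W := LinearMap.range φ.toLinearMap
    have h1 : ∀ m : M.V, m ⊗ₜ bas (1 : G) ∈ W := fun m => by
      have : (⊤ : Submodule R M.V) ≤
          W.comap ((TensorProduct.mk R M.V P.V).flip (bas (1 : G))) := by
        rw [← B.span_eq, span_le]
        rintro _ ⟨i, rfl⟩
        refine ⟨Finsupp.single i (MonoidAlgebra.single 1 1), ?_⟩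
        refine (Representation.freeLift_single_single _ i _ _ _).trans ?_
        rw [map_one, one_smul]
        rfl
      exact this mem_top
    rw [eq_top_iff, ← TensorProduct.span_tmul_eq_top, span_le]
    rintro _ ⟨m, p, rfl⟩
    change m ⊗ₜ p ∈ W
    induction p using MonoidAlgebra.induction_linear with
    | zero => rw [TensorProduct.tmul_zero]; exact zero_mem _
    | add x y hx hy => rw [TensorProduct.tmul_add]; exact add_mem hx hy
    | single g r =>
      obtain ⟨q, hq⟩ := h1 (M.ρ g⁻¹ m)
      have hq : φ q = M.ρ g⁻¹ m ⊗ₜ bas (1 : G) := hq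
      have h5 : φ ((freeMod R G (Module.finrank R M.V)).ρ g q) =
          m ⊗ₜ MonoidAlgebra.single g 1 := by
        rw [φ.isIntertwining, hq]
        change M.ρ g (M.ρ g⁻¹ m) ⊗ₜ P.ρ g (bas 1) = _
        rw [← Module.End.mul_apply, ← map_mul, mul_inv_cancel, map_one, hP]
        rfl
      have := W.smul_mem r ⟨_, h5⟩
      rw [← TensorProduct.tmul_smul] at this
      simpa using this
  · change _ = Module.finrank R (M.V ⊗[R] R[G])
    rw [Module.finrank_tensorProduct, finrank_freeMod,
      Module.finrank_eq_card_basis (MonoidAlgebra.basis G R), Nat.card_eq_fintype_card]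

lemma tensor_P₀_P₀ : (P₀.tensor P₀).Iso (P₀.sum (freeMod R G 1)) :=
  tensor_P₀_iso (isCover_P₀.sum (isCover_freeMod 1)) isCover_P₀.idx_omega isCover_P₀.finrank_eq

lemma Γ_iso_freeMod : Γ.Iso (freeMod R G 1) := (freeMod_one_iso R).symm

/-! ### Self-duality of the projective lattices -/

lemma P₀_dual : P₀.dual.Iso P₀ := (P₀_iso.dual.trans permMod_dual).trans P₀_iso.symm

lemma Γ_dual : Γ.dual.Iso Γ := permMod_dual (X := G)

lemma P₁_dual : P₁.dual.Iso P₁ := by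
  have h := ((dual_sum P₀ P₁).symm.trans Γ_iso.dual.symm).trans (Γ_dual.trans Γ_iso)
  rw [← isoClass_eq_iff, isoClass_sum, isoClass_sum, isoClass_eq_iff.2 P₀_dual] at h
  exact isoClass_eq_iff.1 (add_left_cancel h)

lemma freeMod_dual (k : ℕ) : (freeMod R G k).dual.Iso (freeMod R G k) := by
  induction k with
  | zero =>
    have : Subsingleton (freeMod R G 0).V := inferInstanceAs (Subsingleton (Fin 0 →₀ R[G]))
    have : Subsingleton (freeMod R G 0).dual.V :=
      inferInstanceAs (Subsingleton (Module.Dual R (freeMod R G 0).V))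
    exact iso_of_bijective 0 ⟨Function.injective_of_subsingleton _,
      fun y => ⟨0, Subsingleton.elim _ _⟩⟩
  | succ k ih =>
    refine (freeMod_add k 1).dual.trans ((dual_sum _ _).trans (Iso.trans ?_ (freeMod_add k 1).symm))
    exact ih.sum ((Γ_iso_freeMod.dual.symm.trans Γ_dual).trans Γ_iso_freeMod)

lemma coverMod_dual (n : ℕ) : (coverMod n).dual.Iso (coverMod n) := by
  rw [coverMod]
  split_ifs
  · exact (dual_sum _ _).trans (P₀_dual.sum (freeMod_dual _))
  · exact (dual_sum _ _).trans (P₁_dual.sum (freeMod_dual _))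
  · exact freeMod_dual _

end AltFour

namespace RepLattice

variable {k : Type} {G' : Type} [CommRing k] [Group G']

lemma IsIndecomposable.of_iso {M N : RepLattice k G'} (hM : M.IsIndecomposable) (h : M.Iso N) :
    N.IsIndecomposable := by
  refine ⟨?_, fun A B hAB => hM.2 A B (h.trans hAB)⟩
  obtain ⟨e⟩ := h
  have := hM.1
  exact e.symm.surjective.nontrivial

lemma triv_tensor (M : RepLattice k G') : ((triv k G').tensor M).Iso M :=
  isoClass_eq_iff.1 (one_mul M.isoClass)

lemma tensor_triv (M : RepLattice k G') : (M.tensor (triv k G')).Iso M :=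
  isoClass_eq_iff.1 (mul_one M.isoClass)

lemma triv_dual : (triv k G').dual.Iso (triv k G') :=
  ⟨.mk (LinearMap.ringLmapEquivSelf k k k) fun _ => rfl⟩

end RepLattice

namespace AltFour

open Submodule

/-! ### The lattice of rank two -/

/-- The cyclic group of order three, the quotient of `A₄` by the Klein four-group. -/
abbrev C : Type := Multiplicative (ZMod 3)

/-- The quotient map. -/
def χ : G →* C where
  toFun g := if g = 1 ∨ g = a₁ ∨ g = a₂ ∨ g = a₁ * a₂ then Multiplicative.ofAdd 0
    else if b * g = 1 ∨ b * g = a₁ ∨ b * g = a₂ ∨ b * g = a₁ * a₂ then Multiplicative.ofAdd 2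
    else Multiplicative.ofAdd 1
  map_one' := by decide
  map_mul' := by set_option maxRecDepth 100000 in decide

lemma χ_eq_one_iff : ∀ g, χ g = 1 ↔ g ∈ H := by
  have : ∀ g, χ g = 1 ↔ g = 1 ∨ g = a₁ ∨ g = a₂ ∨ g = a₁ * a₂ := by
    set_option maxRecDepth 100000 in decide
  intro g
  rw [this, mem_H_iff]

lemma χ_b_pow_surjective : ∀ c : C, ∃ j ∈ Finset.range 3, χ (b ^ j) = c := by
  set_option maxRecDepth 100000 in decide

/-- The group algebra of the quotient of order three, as a lattice over `A₄`. -/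
def quotMod : RepLattice R G where
  V := R[C]
  finite := Module.Finite.of_basis (MonoidAlgebra.basis C R)
  ρ := (Representation.leftRegular R C).comp χ

/-- The basis vectors of `quotMod`. -/
def quotBas (c : C) : quotMod.V := MonoidAlgebra.single c (1 : R)

lemma quotMod_ext {W : Type} [AddCommGroup W] [Module R W] {f g : quotMod.V →ₗ[R] W}
    (h : ∀ c, f (quotBas c) = g (quotBas c)) (x : quotMod.V) : f x = g x :=
  LinearMap.congr_fun (monoidAlgebra_ext (f := f) (g := g) h) x

lemma ρ_quotBas (g : G) (c : C) : quotMod.ρ g (quotBas c) = quotBas (χ g * c) :=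
  Representation.ofMulAction_single (χ g) c 1

lemma finrank_quotMod : Module.finrank R quotMod.V = 3 := by
  refine (Module.finrank_eq_card_basis (MonoidAlgebra.basis C R)).trans ?_
  decide

lemma span_quotBas : span R (Set.range quotBas) = ⊤ := (MonoidAlgebra.basis C R).span_eq

/-- The map from `quotMod` with prescribed values. -/
def quotLift {M : RepLattice R G} (v : C → M.V) (hv : ∀ g c, M.ρ g (v c) = v (χ g * c)) :
    quotMod.ρ.IntertwiningMap M.ρ :=
  hom (M := quotMod) (linLift R v) fun g => quotMod_ext (f := linLift R v ∘ₗ quotMod.ρ g)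
    (g := M.ρ g ∘ₗ linLift R v) fun c => by
      change linLift R v (quotMod.ρ g (quotBas c)) = M.ρ g (linLift R v (quotBas c))
      rw [ρ_quotBas, quotBas, quotBas]
      erw [linLift_single, linLift_single]
      rw [one_smul, one_smul, hv]

lemma quotLift_bas {M : RepLattice R G} (v : C → M.V) (hv) (c : C) :
    quotLift (M := M) v hv (quotBas c) = v c :=
  (linLift_single v c 1).trans (one_smul R _)

/-- The augmentation. -/
def quotAug : quotMod.ρ.IntertwiningMap (triv R G).ρ :=
  quotLift (M := triv R G) (fun _ => (1 : R)) fun _ _ => rfl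

lemma quotAug_bas (c : C) : quotAug (quotBas c) = (1 : R) := quotLift_bas (M := triv R G) _ _ c

/-- The projection to the fixed points, given by the action of `w₀`. -/
def quotProj : quotMod.ρ.IntertwiningMap quotMod.ρ :=
  hom (opW quotMod) fun g => quotMod_ext (f := opW quotMod ∘ₗ quotMod.ρ g)
    (g := quotMod.ρ g ∘ₗ opW quotMod) fun c => by
      change opW quotMod (quotMod.ρ g _) = quotMod.ρ g (opW quotMod _)
      simp only [opW_apply, ρ_quotBas, map_smul, map_add]
      simp only [← mul_assoc, mul_comm (χ g)]

lemma quotProj_bas (c : C) : quotProj (quotBas c) = quotProj (quotBas 1) := by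
  obtain ⟨j, -, rfl⟩ := χ_b_pow_surjective c
  have h : ∀ (j : ℕ) x, opW quotMod (quotMod.ρ (b ^ j) x) = opW quotMod x := fun j => by
    induction j with
    | zero => intro x; rw [pow_zero, map_one, Module.End.one_apply]
    | succ j ih => intro x; rw [pow_succ', map_mul, Module.End.mul_apply, opW_ρ_b, ih]
  have := h j (quotBas 1)
  rw [ρ_quotBas, mul_one] at this
  exact this

lemma quotProj_apply (x : quotMod.V) : quotProj x = (quotAug x : R) • quotProj (quotBas 1) :=
  quotMod_ext (f := quotProj.toLinearMap)
    (g := (LinearMap.toSpanSingleton R _ (quotProj (quotBas 1))) ∘ₗ quotAug.toLinearMap)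
    (fun c => by
      change quotProj (quotBas c) = (quotAug (quotBas c) : R) • quotProj (quotBas 1)
      rw [quotProj_bas, quotAug_bas, one_smul]) x

lemma quotAug_quotProj (x : quotMod.V) : quotAug (quotProj x) = quotAug x := by
  have h : opW (triv R G) (quotAug x) = quotAug x := opW_eq_self (M := triv R G) rfl
  rw [← h]
  exact (map_opW quotAug x)

/-- The lattice of rank two on which `H` acts trivially and `1 + b + b²` acts as zero. -/
def twoMod : RepLattice R G := quotMod.ofSub quotProj.ker

/-- The inclusion of `twoMod`. -/
def twoIncl : twoMod.ρ.IntertwiningMap quotMod.ρ :=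
  hom (M := twoMod) (Submodule.subtype _) fun _ _ => rfl

lemma twoIncl_injective : Function.Injective twoIncl := Subtype.val_injective

lemma quotProj_twoIncl (x : twoMod.V) : quotProj (twoIncl x) = 0 := x.2

lemma quotMod_iso : quotMod.Iso ((triv R G).sum twoMod) := by
  have hidem : ∀ x, quotProj (quotProj x) = quotProj x := fun x => opW_opW x
  let p : quotMod.ρ.IntertwiningMap twoMod.ρ :=
    hom (N := twoMod) (((LinearMap.id - quotProj.toLinearMap).codRestrict quotProj.ker.toSubmodule
      fun x => by
        change quotProj (x - quotProj x) = 0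
        rw [map_sub, hidem, sub_self])) fun g x => Subtype.ext <| by
          change quotMod.ρ g x - quotProj (quotMod.ρ g x) = quotMod.ρ g (x - quotProj x)
          rw [quotProj.isIntertwining, map_sub]
  have hp : ∀ x, twoIncl (p x) = x - quotProj x := fun x => rfl
  refine iso_of_bijective (M := quotMod) (N := (triv R G).sum twoMod) (quotAug.prod p)
    ⟨(injective_iff_map_eq_zero _).2 fun x hx => ?_, fun y => ?_⟩
  · have h1 : quotAug x = 0 := congrArg Prod.fst hx
    have h2 : p x = 0 := congrArg Prod.snd hx
    have h3 := hp x
    rw [h2, map_zero, quotProj_apply, h1] at h3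
    erw [zero_smul, sub_zero] at h3
    exact h3.symm
  · refine ⟨(y.1 : R) • quotProj (quotBas 1) + twoIncl y.2, Prod.ext ?_ (twoIncl_injective ?_)⟩
    · change quotAug _ = y.1
      rw [map_add, map_smul, quotAug_quotProj, ← quotAug_quotProj (twoIncl y.2), quotProj_twoIncl,
        map_zero, add_zero, quotAug_bas]
      exact mul_one (y.1 : R)
    · change twoIncl (p _) = _
      rw [hp, map_add, map_smul, hidem, quotProj_twoIncl, add_zero, add_sub_cancel_left]

lemma finrank_twoMod : Module.finrank R twoMod.V = 2 := by
  have h := quotMod_iso.finrank_eq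
  rw [finrank_quotMod] at h
  change 3 = Module.finrank R (R × twoMod.V) at h
  rw [Module.finrank_prod, Module.finrank_self] at h
  omega

lemma ρ_twoMod (h : H) (x : twoMod.V) : twoMod.ρ h x = x := twoIncl_injective <| by
  rw [twoIncl.isIntertwining]
  refine quotMod_ext (f := quotMod.ρ h) (g := LinearMap.id) (fun c => ?_) _
  rw [ρ_quotBas, (χ_eq_one_iff h).2 h.2, one_mul]
  rfl

lemma add_ρ_b_twoMod (x : twoMod.V) : x + twoMod.ρ b x + twoMod.ρ b (twoMod.ρ b x) = 0 :=
  add_add_eq_zero_of_mem_omega <| mem_omega.2 <| twoIncl_injective <| by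
    rw [map_opW, map_zero]
    exact quotProj_twoIncl x

/-- The lattice `twoMod` is indecomposable, since there is no primitive third root of unity in the
2-adic integers. -/
lemma isIndecomposable_twoMod : twoMod.IsIndecomposable := by
  refine ⟨Module.nontrivial_of_finrank_pos (R := R) (by rw [finrank_twoMod]; norm_num),
    fun A B h => ?_⟩
  by_contra! hAB
  obtain ⟨hA, hB⟩ := hAB
  have hr := h.finrank_eq
  change _ = Module.finrank R (A.V × B.V) at hr
  rw [finrank_twoMod, Module.finrank_prod] at hr
  have h1 : 0 < Module.finrank R A.V := Module.finrank_pos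
  have h2 : 0 < Module.finrank R B.V := Module.finrank_pos
  have hA1 : Module.finrank R A.V = 1 := by omega
  let v := Module.finBasisOfFinrankEq R A.V hA1
  obtain ⟨e⟩ := h
  have h0 : v 0 + A.ρ b (v 0) + A.ρ b (A.ρ b (v 0)) = 0 := by
    let π : twoMod.ρ.IntertwiningMap A.ρ :=
      (Representation.IntertwiningMap.fst R A.ρ B.ρ).comp e.toIntertwiningMap
    obtain ⟨x, hx⟩ : ∃ x, π x = v 0 := by
      refine ⟨e.symm (v 0, 0), ?_⟩
      change (e (e.symm (v 0, 0))).1 = v 0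
      rw [e.apply_symm_apply]
    have := congrArg π (add_ρ_b_twoMod x)
    rwa [map_zero π, map_add, map_add, π.isIntertwining, π.isIntertwining, π.isIntertwining, hx]
      at this
  obtain ⟨u, hu⟩ : ∃ u : R, A.ρ b (v 0) = u • v 0 :=
    ⟨v.repr (A.ρ b (v 0)) 0, by simpa using (v.sum_repr (A.ρ b (v 0))).symm⟩
  rw [hu, map_smul, hu, smul_smul] at h0
  have h3 : (1 + u + u * u) • v 0 = 0 := by rw [← h0]; module
  have h4 : 1 + u + u * u = 0 := (smul_eq_zero.1 h3).resolve_right (v.ne_zero 0)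
  refine PadicInt.not_two_dvd_one ?_
  rcases PadicInt.two_dvd_or_two_dvd_sub_one u with ⟨s, hs⟩ | ⟨s, hs⟩
  · exact ⟨-(s + s * u), by linear_combination h4 - (1 + u) * hs⟩
  · exact ⟨-(u + s * u), by linear_combination h4 - u * hs⟩

lemma isIndecomposable_triv : (triv R G).IsIndecomposable := by
  refine ⟨inferInstanceAs (Nontrivial R), fun A B h => ?_⟩
  by_contra! hAB
  obtain ⟨hA, hB⟩ := hAB
  have hr := h.finrank_eq
  change Module.finrank R R = Module.finrank R (A.V × B.V) at hr
  rw [Module.finrank_self, Module.finrank_prod] at hr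
  have h1 : 0 < Module.finrank R A.V := Module.finrank_pos
  have h2 : 0 < Module.finrank R B.V := Module.finrank_pos
  omega

lemma quotMod_tensor : (quotMod.tensor quotMod).Iso (quotMod.sum (quotMod.sum quotMod)) := by
  let f (d : C) : quotMod.ρ.IntertwiningMap (quotMod.tensor quotMod).ρ :=
    quotLift (M := quotMod.tensor quotMod) (fun c => quotBas c ⊗ₜ quotBas (c * d)) fun g c => by
      change quotMod.ρ g (quotBas c) ⊗ₜ quotMod.ρ g (quotBas (c * d)) = _
      rw [ρ_quotBas, ρ_quotBas, mul_assoc]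
  have hf : ∀ c d, f d (quotBas c) = quotBas c ⊗ₜ quotBas (c * d) := fun c d =>
    quotLift_bas (M := quotMod.tensor quotMod) _ _ c
  let F : (quotMod.sum (quotMod.sum quotMod)).ρ.IntertwiningMap (quotMod.tensor quotMod).ρ :=
    (f 1).comp (.fst R _ _) + ((f (χ b)).comp (.fst R _ _) +
      (f (χ (b ^ 2))).comp (.snd R _ _)).comp (.snd R quotMod.ρ (quotMod.sum quotMod).ρ)
  have hF : ∀ x y z, F (x, y, z) = f 1 x + (f (χ b) y + f (χ (b ^ 2)) z) := fun _ _ _ => rfl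
  refine (iso_of_surjective F (LinearMap.range_eq_top.1 (?_ : LinearMap.range F.toLinearMap = ⊤))
    ?_).symm
  · have h1 : ∀ c d, quotBas c ⊗ₜ quotBas d ∈ LinearMap.range F.toLinearMap := fun c d => by
      obtain ⟨j, hj, hd⟩ := χ_b_pow_surjective (c⁻¹ * d)
      obtain rfl : d = c * χ (b ^ j) := by rw [hd, mul_inv_cancel_left]
      fin_cases hj
      · exact ⟨(quotBas c, 0, 0), by
          change F _ = _
          rw [hF, map_zero, map_zero, add_zero, add_zero, hf]; simp⟩
      · exact ⟨(0, quotBas c, 0), by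
          change F _ = _
          rw [hF, map_zero, map_zero, add_zero, zero_add, hf]; simp⟩
      · exact ⟨(0, 0, quotBas c), by
          change F _ = _
          rw [hF, map_zero, map_zero, zero_add, zero_add, hf]⟩
    have h2 : ∀ x d, x ⊗ₜ quotBas d ∈ LinearMap.range F.toLinearMap := fun x d => by
      have h3 : span R (Set.range quotBas) ≤ (LinearMap.range F.toLinearMap).comap
          ((TensorProduct.mk R quotMod.V quotMod.V).flip (quotBas d)) := by
        rw [span_le]
        rintro _ ⟨c, rfl⟩
        exact h1 c d
      exact h3 (span_quotBas ▸ mem_top)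
    rw [eq_top_iff, ← TensorProduct.span_tmul_eq_top, span_le]
    rintro _ ⟨x, y, rfl⟩
    have h3 : span R (Set.range quotBas) ≤ (LinearMap.range F.toLinearMap).comap
        (TensorProduct.mk R quotMod.V quotMod.V x) := by
      rw [span_le]
      rintro _ ⟨d, rfl⟩
      exact h2 x d
    exact h3 (span_quotBas ▸ mem_top)
  · change Module.finrank R (quotMod.V × quotMod.V × quotMod.V) =
      Module.finrank R (quotMod.V ⊗[R] quotMod.V)
    rw [Module.finrank_tensorProduct, Module.finrank_prod, Module.finrank_prod, finrank_quotMod]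

lemma isoClass_twoMod_mul : twoMod.isoClass * twoMod.isoClass = 2 + twoMod.isoClass := by
  have h1 : quotMod.isoClass = 1 + twoMod.isoClass := isoClass_eq_iff.2 quotMod_iso
  have h2 : quotMod.isoClass * quotMod.isoClass =
      quotMod.isoClass + (quotMod.isoClass + quotMod.isoClass) := isoClass_eq_iff.2 quotMod_tensor
  rw [h1] at h2
  refine add_left_cancel (a := 1 + 2 * twoMod.isoClass) ?_
  calc _ = (1 + twoMod.isoClass) * (1 + twoMod.isoClass) := by ring
    _ = _ := h2
    _ = _ := by ring

end AltFour

namespace AltFour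

open Submodule

/-! ### Indecomposability -/

lemma exists_half {V W : Type} [AddCommGroup V] [Module R V] [AddCommGroup W] [Module R W]
    [Module.Free R W] (f : V →ₗ[R] W) (h : ∀ x, f x ∈ dbl W) :
    ∃ g : V →ₗ[R] W, ∀ x, (2 : R) • g x = f x := by
  choose g hg using fun x => mem_dbl.1 (h x)
  refine ⟨⟨⟨g, fun x y => dbl_cancel ?_⟩, fun r x => dbl_cancel ?_⟩, hg⟩
  · rw [smul_add, hg, hg, hg, map_add]
  · change (2 : R) • g (r • x) = (2 : R) • r • g x
    rw [hg, smul_comm, hg, map_smul]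

lemma norm_mem_dbl_dual {M : RepLattice R G} (h : ∀ m, norm (res M) m ∈ dbl M.V)
    (φ : M.dual.V) : norm (res M.dual) φ ∈ dbl M.dual.V := by
  obtain ⟨g, hg⟩ := exists_half (norm (res M)) h
  refine ⟨φ ∘ₗ g, LinearMap.ext fun x => ?_⟩
  have h1 : norm (res M.dual) φ = φ ∘ₗ norm (res M) := LinearMap.ext fun x => by
    have hinv : α₁⁻¹ = α₁ ∧ α₂⁻¹ = α₂ ∧ (α₁ * α₂)⁻¹ = α₁ * α₂ :=
      ⟨Subtype.ext (by decide : a₁⁻¹ = a₁), Subtype.ext (by decide : a₂⁻¹ = a₂),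
        Subtype.ext (by decide : (a₁ * a₂)⁻¹ = a₁ * a₂)⟩
    change φ x + φ ((res M).ρ α₁⁻¹ x) + φ ((res M).ρ α₂⁻¹ x) + φ ((res M).ρ (α₁ * α₂)⁻¹ x) =
      φ (norm (res M) x)
    rw [hinv.1, hinv.2.1, hinv.2.2, ← map_add, ← map_add, ← map_add, norm_apply]
  rw [h1]
  change (2 : R) • φ (g x) = φ (norm (res M) x)
  rw [← hg, map_smul]

lemma norm_mem_dbl_tensor {M X : RepLattice R G} (h : ∀ m, norm (res M) m ∈ dbl M.V)
    (hX : ∀ (h : H) x, X.ρ h x = x) (t : (M.tensor X).V) :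
    norm (res (M.tensor X)) t ∈ dbl (M.tensor X).V := by
  induction t using TensorProduct.induction_on with
  | zero => rw [map_zero]; exact zero_mem _
  | add x y hx hy => rw [map_add]; exact add_mem hx hy
  | tmul m x =>
    have h1 : norm (res (M.tensor X)) (m ⊗ₜ x) = norm (res M) m ⊗ₜ x := by
      change m ⊗ₜ x + (res M).ρ α₁ m ⊗ₜ X.ρ (α₁ : H) x + (res M).ρ α₂ m ⊗ₜ X.ρ (α₂ : H) x +
        (res M).ρ (α₁ * α₂) m ⊗ₜ X.ρ (α₁ * α₂ : H) x = _
      rw [hX, hX, hX, ← TensorProduct.add_tmul, ← TensorProduct.add_tmul,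
        ← TensorProduct.add_tmul, norm_apply]
    obtain ⟨u, hu⟩ := mem_dbl.1 (h m)
    rw [h1, ← hu]
    exact ⟨u ⊗ₜ x, rfl⟩

/-- If the norm of `H` is divisible by two on `M`, then no nonzero idempotent of `M` is a trace:
the image of an idempotent contains a vector that is fixed by `H` modulo two and not divisible
by two, whereas the trace of a map sends such a vector to a sum of norms modulo two. -/
lemma eq_zero_of_isTrace {M : RepLattice R G} (hM : ∀ m, norm (res M) m ∈ dbl M.V)
    {e : M.ρ.IntertwiningMap M.ρ} (he : ∀ x, e (e x) = e x) (h : IsTrace e) (x : M.V) :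
    e x = 0 := by
  have key : ∀ x, e x ∈ dbl M.V := by
    by_contra! hx
    obtain ⟨x, hx⟩ := hx
    have hXe : ∀ x, opX (res M) (e x) = e (opX (res M) x) := fun x => (map_opX (resHom e) x).symm
    have hYe : ∀ x, opY (res M) (e x) = e (opY (res M) x) := fun x => (map_opY (resHom e) x).symm
    obtain ⟨x, hx, hxX⟩ : ∃ x, e x ∉ dbl M.V ∧ opX (res M) (e x) ∈ dbl M.V := by
      by_cases h1 : opX (res M) (e x) ∈ dbl M.V
      · exact ⟨x, hx, h1⟩
      · refine ⟨opX (res M) x, by rwa [← hXe], ?_⟩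
        rw [← hXe, opX_opX]
        exact two_smul_mem_dbl _
    obtain ⟨x, hx, hxX, hxY⟩ : ∃ x, e x ∉ dbl M.V ∧ opX (res M) (e x) ∈ dbl M.V ∧
        opY (res M) (e x) ∈ dbl M.V := by
      by_cases h1 : opY (res M) (e x) ∈ dbl M.V
      · exact ⟨x, hx, hxX, h1⟩
      · refine ⟨opY (res M) x, by rwa [← hYe], ?_, ?_⟩
        · rw [← hYe, ← opY_opX]
          exact map_mem_dbl (opY (res M)).toLinearMap hxX
        · rw [← hYe, opY_opY]
          exact two_smul_mem_dbl _
    set v := e x with hv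
    have h1 : M.ρ a₁ v - v ∈ dbl M.V := hxX
    have h2 : M.ρ a₂ v - v ∈ dbl M.V := hxY
    have h3 : M.ρ (a₁ * a₂) v - v ∈ dbl M.V := by
      have := add_mem (map_mem_dbl (M.ρ a₁) h2) h1
      rwa [map_sub, sub_add_sub_cancel, ← Module.End.mul_apply, ← map_mul] at this
    obtain ⟨ψ, hψ⟩ := h
    apply hx
    rw [hv, ← he, ← hv, hψ, tr_apply, sum_eq_sum_b_pow]
    refine sum_mem fun j _ => ?_
    set u := M.ρ (b ^ j) (ψ (M.ρ (b ^ j)⁻¹ v)) with hu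
    have h4 : ∀ g : G, g⁻¹ = g → M.ρ g v - v ∈ dbl M.V →
        M.ρ (g * b ^ j) (ψ (M.ρ (g * b ^ j)⁻¹ v)) - M.ρ g u ∈ dbl M.V := fun g hg hgv => by
      have h5 := map_mem_dbl (M.ρ g ∘ₗ M.ρ (b ^ j) ∘ₗ ψ ∘ₗ M.ρ (b ^ j)⁻¹) hgv
      rw [map_sub] at h5
      have h6 : M.ρ (g * b ^ j) (ψ (M.ρ (g * b ^ j)⁻¹ v)) =
          (M.ρ g ∘ₗ M.ρ (b ^ j) ∘ₗ ψ ∘ₗ M.ρ (b ^ j)⁻¹) (M.ρ g v) := by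
        rw [mul_inv_rev, hg, map_mul, map_mul]
        rfl
      rw [h6]
      exact h5
    have h5 := add_mem (add_mem (add_mem (h4 a₁ (by decide) h1) (h4 a₂ (by decide) h2))
      (h4 (a₁ * a₂) (by decide) h3)) (hM u)
    convert h5 using 1
    rw [norm_apply]
    change u + _ + _ + _ = _ - M.ρ a₁ u + (_ - M.ρ a₂ u) + (_ - M.ρ (a₁ * a₂) u) +
      (u + M.ρ a₁ u + M.ρ a₂ u + M.ρ (a₁ * a₂) u)
    abel
  have hker : LinearMap.ker e.toLinearMap = ⊤ := by
    refine eq_top_of_sup_dbl (eq_top_iff.2 fun x _ => ?_)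
    rw [← sub_add_cancel x (e x)]
    refine add_mem (mem_sup_left ?_) (mem_sup_right (key x))
    change e (x - e x) = 0
    rw [map_sub, he, sub_self]
  exact (hker ▸ mem_top : x ∈ LinearMap.ker e.toLinearMap)

lemma isIndecomposable_of_isStablyLocal {M : RepLattice R G} [Nontrivial M.V]
    (hM : ∀ m, norm (res M) m ∈ dbl M.V) (h : IsStablyLocal M) : M.IsIndecomposable := by
  refine ⟨inferInstance, fun A B ⟨φ⟩ => ?_⟩
  let e : M.ρ.IntertwiningMap M.ρ := φ.symm.toIntertwiningMap.comp
    ((Representation.IntertwiningMap.inl R A.ρ B.ρ).comp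
      ((Representation.IntertwiningMap.fst R A.ρ B.ρ).comp φ.toIntertwiningMap))
  have hφ : ∀ x, φ (e x) = ((φ x).1, 0) := fun x => φ.apply_symm_apply _
  have he : ∀ x, e (e x) = e x := fun x => φ.injective <| by
    change φ (e (e x)) = φ (e x)
    rw [hφ, hφ]
  have h0 : IsTrace (e.comp e - e) := ⟨0, fun x => by
    rw [tr_zero]
    change e (e x) - e x = 0
    rw [he, sub_self]⟩
  rcases h e h0 with h1 | h1
  · have h2 := eq_zero_of_isTrace hM he h1
    refine Or.inl ⟨fun a a' => ?_⟩
    have h3 : ∀ a : A.V, a = 0 := fun a => by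
      have := hφ (φ.symm (a, 0))
      rw [h2, map_zero, φ.apply_symm_apply] at this
      exact (congrArg Prod.fst this).symm
    rw [h3 a, h3 a']
  · have h2 := eq_zero_of_isTrace hM (fun x => by
      change (x - e x) - e (x - e x) = x - e x
      rw [map_sub, he, sub_self, sub_zero]) h1
    refine Or.inr ⟨fun a a' => ?_⟩
    have h3 : ∀ a : B.V, a = 0 := fun a => by
      have h4 : φ.symm (0, a) - e (φ.symm (0, a)) = 0 := h2 _
      have := congrArg φ (sub_eq_zero.1 h4)
      rw [hφ, φ.apply_symm_apply] at this
      exact congrArg Prod.snd this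
    rw [h3 a, h3 a']

/-! ### The lifts for all integers -/

/-- The lift to `A₄` of the `n`-th Heller module, for all integers `n`. -/
def lift : ℤ → RepLattice R G
  | Int.ofNat n => liftNat n
  | Int.negSucc n => (liftNat (n + 1)).dual

lemma exists_isShortExact_lift (z : ℤ) : ∃ n Q, Iso Q (coverMod n) ∧
    IsShortExact (lift (z + 1)) Q (lift z) := by
  match z with
  | Int.ofNat n => exact ⟨n, _, iso_refl _, isShortExact_liftNat n⟩
  | Int.negSucc 0 => exact ⟨0, _, coverMod_dual 0, (isShortExact_liftNat 0).dual.congr triv_dual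
      (iso_refl _) (iso_refl _)⟩
  | Int.negSucc (n + 1) => exact ⟨n + 1, _, coverMod_dual _, (isShortExact_liftNat (n + 1)).dual⟩

lemma norm_mem_dbl_lift (z : ℤ) (m : (lift z).V) : norm (res (lift z)) m ∈ dbl (lift z).V := by
  match z with
  | Int.ofNat n => exact (isHellerLift_liftNat n).norm_mem m
  | Int.negSucc n => exact norm_mem_dbl_dual (isHellerLift_liftNat (n + 1)).norm_mem m

lemma res_lift_iso (z : ℤ) : (res (lift z)).Iso (heller R H z) := by
  match z with
  | Int.ofNat n => exact (isHellerLift_liftNat n).res_iso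
  | Int.negSucc n => exact (isHellerLift_liftNat (n + 1)).res_iso.dual

lemma finrank_lift_pos (z : ℤ) : 0 < Module.finrank R (lift z).V := by
  match z with
  | Int.ofNat n =>
    change 0 < Module.finrank R (liftNat n).V
    rw [(isHellerLift_liftNat n).finrank_eq]
    omega
  | Int.negSucc n =>
    change 0 < Module.finrank R ((liftNat (n + 1)).V →ₗ[R] R)
    rw [Module.finrank_linearMap_self, (isHellerLift_liftNat (n + 1)).finrank_eq]
    omega

lemma isStablyLocal_lift_tensor {X : RepLattice R G} (hX : X.IsIndecomposable) (z : ℤ) :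
    IsStablyLocal ((lift z).tensor X) := by
  have hstep : ∀ z, IsStablyLocal ((lift (z + 1)).tensor X) ↔ IsStablyLocal ((lift z).tensor X) :=
    fun z => by
      obtain ⟨n, Q, hQ, h⟩ := exists_isShortExact_lift z
      exact isStablyLocal_iff (((isProj_coverMod n).of_iso hQ).isRelProj.tensor X) (h.tensor X)
  induction z using Int.induction_on with
  | zero => exact (hX.of_iso (triv_tensor X).symm).isStablyLocal
  | succ n ih => exact (hstep _).2 ih
  | pred n ih => exact (hstep _).1 (by rwa [sub_add_cancel])

lemma isIndecomposable_lift_tensor {X : RepLattice R G} (hX : X.IsIndecomposable)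
    (hHX : ∀ (h : H) x, X.ρ h x = x) (z : ℤ) : ((lift z).tensor X).IsIndecomposable := by
  have : Nontrivial ((lift z).tensor X).V := by
    refine Module.nontrivial_of_finrank_pos (R := R) ?_
    change 0 < Module.finrank R ((lift z).V ⊗[R] X.V)
    rw [Module.finrank_tensorProduct]
    have := hX.1
    exact Nat.mul_pos (finrank_lift_pos z) Module.finrank_pos
  exact isIndecomposable_of_isStablyLocal (norm_mem_dbl_tensor (norm_mem_dbl_lift z) hHX)
    (isStablyLocal_lift_tensor hX z)

lemma isIndecomposable_lift (z : ℤ) : (lift z).IsIndecomposable :=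
  (isIndecomposable_lift_tensor isIndecomposable_triv (fun _ _ => rfl) z).of_iso (tensor_triv _)

/-! ### Induced lattices -/

/-- Induction of a restricted lattice is tensoring with the permutation lattice on the cosets. -/
lemma ind_equiv {D : RepLattice R G} {L : RepLattice R H} (h : (res D).Iso L) :
    Nonempty ((Representation.ind H.subtype L.ρ).Equiv (D.tensor quotMod).ρ) := by
  obtain ⟨e⟩ := h.symm
  have he : ∀ (x : H) a, D.ρ x (e a) = e (L.ρ x a) := fun x a =>
    (e.toIntertwiningMap.isIntertwining _ _ x a).symm
  have he' : ∀ (x : H) a, e.symm (D.ρ x a) = L.ρ x (e.symm a) := fun x a =>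
    e.symm.toIntertwiningMap.isIntertwining _ _ x a
  have hρ : ∀ (g g' : G) x, D.ρ g (D.ρ g' x) = D.ρ (g * g') x := fun g g' x => by
    rw [map_mul, Module.End.mul_apply]
  let mk := Representation.IndV.mk H.subtype L.ρ
  have hmk : ∀ (x : H) (g : G) a, mk ((x : G) * g) (L.ρ x a) = mk g a := fun x g a => by
    have := Representation.Coinvariants.mk_self_apply
      (Representation.tprod ((Representation.leftRegular R G).comp H.subtype) L.ρ) x
      (MonoidAlgebra.single g (1 : R) ⊗ₜ a)
    refine Eq.trans (congrArg (Representation.Coinvariants.mk _) ?_) this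
    change _ = Representation.leftRegular R G x (MonoidAlgebra.single g 1) ⊗ₜ L.ρ x a
    rw [Representation.ofMulAction_single]
    rfl
  let φ : R[G] →ₗ[R] L.V →ₗ[R] (D.tensor quotMod).V := linLift R fun g =>
    (TensorProduct.mk R D.V quotMod.V).flip (quotBas (χ g⁻¹)) ∘ₗ D.ρ g⁻¹ ∘ₗ
      e.toLinearEquiv.toLinearMap
  have hφ : ∀ g a, φ (MonoidAlgebra.single g 1) a = D.ρ g⁻¹ (e a) ⊗ₜ quotBas (χ g⁻¹) :=
    fun g a => by
      simp only [φ, linLift_single, one_smul]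
      rfl
  let Φ : Representation.IndV H.subtype L.ρ →ₗ[R] (D.tensor quotMod).V :=
    Representation.Coinvariants.lift _ (TensorProduct.lift φ) fun x => by
      refine TensorProduct.ext (monoidAlgebra_ext fun g => LinearMap.ext fun a => ?_)
      change φ (Representation.leftRegular R G x (MonoidAlgebra.single g 1)) (L.ρ x a) =
        φ (MonoidAlgebra.single g 1) a
      rw [Representation.ofMulAction_single, hφ, hφ, ← he, hρ, smul_eq_mul, mul_inv_rev,
        inv_mul_cancel_right, map_mul, (χ_eq_one_iff (x : G)⁻¹).2 (inv_mem x.2), mul_one]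
  have hΦ : ∀ g a, Φ (mk g a) = D.ρ g⁻¹ (e a) ⊗ₜ quotBas (χ g⁻¹) := hφ
  choose s hs using fun c => (χ_b_pow_surjective c)
  let σ : C → G := fun c => b ^ s c
  have hσ : ∀ c, χ (σ c) = c := fun c => (hs c).2
  let ψ : quotMod.V →ₗ[R] D.V →ₗ[R] Representation.IndV H.subtype L.ρ := linLift R fun c : C =>
    mk (σ c)⁻¹ ∘ₗ e.symm.toLinearEquiv.toLinearMap ∘ₗ D.ρ (σ c)⁻¹
  have hψ : ∀ d c, ψ (quotBas c) d = mk (σ c)⁻¹ (e.symm (D.ρ (σ c)⁻¹ d)) := fun d c => by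
    have : ψ (quotBas c) = mk (σ c)⁻¹ ∘ₗ e.symm.toLinearEquiv.toLinearMap ∘ₗ D.ρ (σ c)⁻¹ :=
      (linLift_single _ c 1).trans (one_smul R _)
    rw [this]
    rfl
  let Ψ : (D.tensor quotMod).V →ₗ[R] Representation.IndV H.subtype L.ρ :=
    TensorProduct.lift ψ.flip
  have hΨ : ∀ d c, Ψ (d ⊗ₜ quotBas c) = mk (σ c)⁻¹ (e.symm (D.ρ (σ c)⁻¹ d)) := hψ
  refine ⟨.mk (LinearEquiv.ofLinearMap Φ Ψ ?_ ?_) fun g => ?_⟩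
  · refine TensorProduct.ext <| LinearMap.ext fun d => LinearMap.ext <| quotMod_ext fun c => ?_
    change Φ (Ψ (d ⊗ₜ quotBas c)) = d ⊗ₜ quotBas c
    have h1 : e (e.symm (D.ρ (σ c)⁻¹ d)) = D.ρ (σ c)⁻¹ d := e.apply_symm_apply _
    rw [hΨ, hΦ, h1, hρ, inv_inv, mul_inv_cancel, map_one, hσ]
    rfl
  · refine Representation.IndV.hom_ext _ _ fun g => LinearMap.ext fun a => ?_
    change Ψ (Φ (mk g a)) = mk g a
    set t := σ (χ g⁻¹) with ht
    have hx : t⁻¹ * g⁻¹ ∈ H := by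
      rw [← χ_eq_one_iff, map_mul, map_inv, ht, hσ, inv_mul_cancel]
    rw [hΦ, hΨ, hρ, ← ht]
    have h1 := he' ⟨_, hx⟩ (e a)
    have h2 : e.symm (e a) = a := e.symm_apply_apply a
    have h3 := hmk ⟨_, hx⟩ g a
    rw [h2] at h1
    change e.symm (D.ρ (t⁻¹ * g⁻¹) (e a)) = _ at h1
    rw [h1, ← h3]
    change _ = mk (t⁻¹ * g⁻¹ * g) _
    rw [inv_mul_cancel_right]
  · refine Representation.IndV.hom_ext _ _ fun g' => LinearMap.ext fun a => ?_
    change Φ (Representation.ind H.subtype L.ρ g (mk g' a)) = (D.tensor quotMod).ρ g (Φ (mk g' a))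
    rw [Representation.ind_mk, hΦ, hΦ]
    change _ = D.ρ g (D.ρ g'⁻¹ (e a)) ⊗ₜ quotMod.ρ g (quotBas (χ g'⁻¹))
    rw [hρ, ρ_quotBas, mul_inv_rev, inv_inv, map_mul χ]

/-- The decomposition of the lattice induced from a Heller module. -/
lemma isHellerPair_lift (z : ℤ) : IsHellerPair z (lift z) ((lift z).tensor twoMod) where
  indecomposable_left := isIndecomposable_lift z
  indecomposable_right := isIndecomposable_lift_tensor isIndecomposable_twoMod ρ_twoMod z
  rank_left := (res_lift_iso z).finrank_eq
  rank_right := by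
    change Module.finrank R ((lift z).V ⊗[R] twoMod.V) = _
    rw [Module.finrank_tensorProduct, finrank_twoMod, mul_comm]
    exact congrArg (2 * ·) (res_lift_iso z).finrank_eq
  decomposition := by
    obtain ⟨e⟩ := ind_equiv (res_lift_iso z)
    have h : ((lift z).tensor quotMod).Iso ((lift z).sum ((lift z).tensor twoMod)) :=
      isoClass_eq_iff.1 <| by
        rw [isoClass_tensor, isoClass_sum, isoClass_tensor, isoClass_eq_iff.2 quotMod_iso,
          isoClass_sum, mul_add]
        exact congrArg (· + _) (mul_one _)
    exact h.map fun f => e.trans f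

/-- The summands of the induced lattice are unique, being distinguished by their rank. -/
lemma IsHellerPair.iso_lift {z : ℤ} {D E : RepLattice R G} (h : IsHellerPair z D E) :
    D.Iso (lift z) ∧ E.Iso ((lift z).tensor twoMod) := by
  have h' := isHellerPair_lift z
  obtain ⟨e⟩ := h.decomposition
  obtain ⟨e'⟩ := h'.decomposition
  have h1 : (D.sum E).Iso ((lift z).sum ((lift z).tensor twoMod)) := ⟨e.symm.trans e'⟩
  have hpos : 0 < Module.finrank R (heller R H z).V := by
    rw [← h'.rank_left]
    exact finrank_lift_pos z
  have hD : D.Iso (lift z) := by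
    refine (h.indecomposable_left.iso_or_iso h'.indecomposable_left h'.indecomposable_right
      h1).resolve_right fun h2 => ?_
    have := h2.finrank_eq
    rw [h.rank_left, h'.rank_right] at this
    omega
  refine ⟨hD, ?_⟩
  rw [← isoClass_eq_iff, isoClass_sum, isoClass_sum, isoClass_eq_iff.2 hD] at h1
  exact isoClass_eq_iff.1 (add_left_cancel h1)

end AltFour

namespace AltFour

open Submodule

/-! ### The representation ring -/

lemma isoClass_Γ : Γ.isoClass = P₀.isoClass + P₁.isoClass := isoClass_eq_iff.2 Γ_iso

lemma isoClass_freeMod (k : ℕ) : (freeMod R G k).isoClass = k * Γ.isoClass := by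
  induction k with
  | zero =>
    have : Subsingleton (freeMod R G 0).V := inferInstanceAs (Subsingleton (Fin 0 →₀ R[G]))
    rw [Nat.cast_zero, zero_mul]
    exact isoClass_eq_iff.2 (iso_of_bijective (M := freeMod R G 0) (N := zero R G) 0
      ⟨Function.injective_of_subsingleton _, fun y => ⟨0, Subsingleton.elim _ _⟩⟩)
  | succ k ih =>
    rw [isoClass_eq_iff.2 (freeMod_add k 1), isoClass_sum, ih,
      ← isoClass_eq_iff.2 Γ_iso_freeMod, Nat.cast_succ, add_one_mul]

lemma isoClass_mul_Γ (M : RepLattice R G) :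
    M.isoClass * Γ.isoClass = Module.finrank R M.V * Γ.isoClass := by
  rw [← isoClass_freeMod]
  exact isoClass_eq_iff.2 (tensor_Γ_iso M)

lemma isProj_tensor {Q : RepLattice R G} (hQ : IsProj Q) (X : RepLattice R G) :
    IsProj (Q.tensor X) := by
  obtain ⟨d, f, hf⟩ := Q.exists_isImageOfFree
  obtain ⟨s, hs⟩ := hQ _ _ f hf (.id _)
  have h : ((freeMod R G d).tensor X).Iso (freeMod R G (d * Module.finrank R X.V)) :=
    isoClass_eq_iff.1 <| by
      rw [isoClass_tensor, isoClass_freeMod, isoClass_freeMod, mul_assoc, mul_comm Γ.isoClass,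
        isoClass_mul_Γ, Nat.cast_mul, mul_assoc]
  refine ((isProj_freeMod _).of_iso h).of_retract (Q := (freeMod R G d).tensor X)
    (s.tensor (.id X.ρ)) (f.tensor (.id X.ρ)) fun t => ?_
  refine LinearMap.congr_fun (f := f.toLinearMap.rTensor X.V ∘ₗ s.toLinearMap.rTensor X.V)
    (g := LinearMap.id) (TensorProduct.ext' fun q x => ?_) t
  exact congrArg (· ⊗ₜ x) (hs q)

/-- Schanuel's lemma compares a sequence that ends in `B` with the tensor product of `B` and the
sequence `0 → Δ₁ → P₀ → R → 0`. -/
lemma isoClass_mul_liftNat_one {A Q B : RepLattice R G} (hQ : IsProj Q) (h : IsShortExact A Q B) :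
    B.isoClass * (liftNat 1).isoClass + Q.isoClass = A.isoClass + B.isoClass * P₀.isoClass := by
  have h1 := ((isShortExact_liftNat 0).tensor B).congr (iso_refl _) (iso_refl _) (triv_tensor B)
  have h2 := isoClass_eq_iff.2 (schanuel (isProj_tensor (isProj_coverMod 0) B) hQ h1 h)
  have h3 : (coverMod 0).isoClass = P₀.isoClass := by
    rw [show (0 : ℕ) = 3 * 0 from rfl, coverMod_zero, isoClass_sum, isoClass_freeMod,
      Nat.cast_zero, zero_mul, add_zero]
  rw [isoClass_sum, isoClass_sum, isoClass_tensor, isoClass_tensor, h3] at h2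
  rw [mul_comm, h2, mul_comm P₀.isoClass]

lemma isoClass_liftNat_mul (n : ℕ) :
    (liftNat n).isoClass * (liftNat 1).isoClass + (coverMod n).isoClass =
      (liftNat (n + 1)).isoClass + (liftNat n).isoClass * P₀.isoClass :=
  isoClass_mul_liftNat_one (isProj_coverMod n) (isShortExact_liftNat n)

lemma isoClass_liftNat_mul_P₀ {n a c : ℕ} {Q : RepLattice R G} (hQ : IsCover a c Q)
    (ha : a = 2 * (n / 3) + 1) (hc : a + 2 * c = 2 * n + 1) :
    (liftNat n).isoClass * P₀.isoClass = Q.isoClass := by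
  have h := isHellerLift_liftNat n
  exact isoClass_eq_iff.2 (tensor_P₀_iso hQ (by rw [h.idx_omega, ha]) (by rw [h.finrank_eq, hc]))

lemma tensor_liftNat_zero (k : ℕ) : ((liftNat (3 * k)).tensor (liftNat 1)).Iso
    ((liftNat (3 * k + 1)).sum (freeMod R G k)) := isoClass_eq_iff.1 <| by
  have h := isoClass_liftNat_mul (3 * k)
  rw [isoClass_liftNat_mul_P₀ (isCover_P₀.sum (isCover_freeMod (2 * k))) (by omega) (by omega),
    coverMod_zero] at h
  simp only [isoClass_sum, isoClass_tensor, isoClass_freeMod] at h ⊢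
  refine add_right_cancel (b := P₀.isoClass + k * Γ.isoClass) (h.trans ?_)
  push_cast
  ring

lemma tensor_liftNat_one (k : ℕ) : ((liftNat (3 * k + 1)).tensor (liftNat 1)).Iso
    (((liftNat (3 * k + 2)).sum P₀).sum (freeMod R G k)) := isoClass_eq_iff.1 <| by
  have h := isoClass_liftNat_mul (3 * k + 1)
  rw [isoClass_liftNat_mul_P₀ (isCover_freeMod (2 * k + 1)) (by omega) (by omega),
    coverMod_one] at h
  simp only [isoClass_sum, isoClass_tensor, isoClass_freeMod] at h ⊢
  refine add_right_cancel (b := P₁.isoClass + k * Γ.isoClass) (h.trans ?_)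
  push_cast
  rw [isoClass_Γ]
  ring

lemma tensor_liftNat_two (k : ℕ) : ((liftNat (3 * k + 2)).tensor (liftNat 1)).Iso
    (((liftNat (3 * k + 3)).sum P₁).sum (freeMod R G k)) := isoClass_eq_iff.1 <| by
  have h := isoClass_liftNat_mul (3 * k + 2)
  rw [isoClass_liftNat_mul_P₀ (isCover_P₁.sum (isCover_freeMod (2 * k + 1))) (by omega) (by omega),
    coverMod_two] at h
  simp only [isoClass_sum, isoClass_tensor, isoClass_freeMod] at h ⊢
  refine add_right_cancel (b := (k + 1 : ℕ) * Γ.isoClass) (h.trans ?_)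
  push_cast
  ring

/-! ### The representation algebra -/

/-- The homomorphism from the semiring of isomorphism classes to the representation algebra. -/
def clsHom : IsoClass R G →+* RepAlgebra R G :=
  (Algebra.TensorProduct.includeLeftRingHom : RepRing R G →+* RepRing R G ⊗[ℤ] ℚ).comp
    (toRepRing R G)

lemma cls_eq (M : RepLattice R G) : cls M = clsHom M.isoClass := rfl

lemma cls_Γ_mul_Γ : cls Γ * cls Γ = 12 * cls Γ := by
  have h : Module.finrank R Γ.V = 12 := by
    refine (Module.finrank_eq_card_basis (MonoidAlgebra.basis G R)).trans ?_
    set_option maxRecDepth 100000 in decide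
  rw [cls_eq, ← map_mul, isoClass_mul_Γ, h, map_mul, map_natCast]
  norm_num

lemma cls_Γ_mul_f₁ : cls Γ * f₁ = cls Γ := by
  have h : (12 : RepAlgebra R G) * (1 ⊗ₜ[ℤ] (1 / 12 : ℚ)) = 1 := by
    have h1 : (12 : RepAlgebra R G) = 12 • (1 ⊗ₜ[ℤ] (1 : ℚ)) := by
      rw [← Algebra.TensorProduct.one_def, nsmul_eq_mul, mul_one]
      norm_num
    rw [h1, smul_mul_assoc, Algebra.TensorProduct.tmul_mul_tmul, ← TensorProduct.tmul_smul,
      Algebra.TensorProduct.one_def]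
    norm_num
  rw [f₁, ← mul_assoc, cls_Γ_mul_Γ, mul_comm 12, mul_assoc, h, mul_one]

lemma cls_Γ_mul_f₃ : cls Γ * f₃ = 0 := by
  rw [f₃, mul_left_comm, mul_sub, mul_one, cls_Γ_mul_f₁, sub_self, mul_zero]

lemma cls_P₀_mul_f₃ : cls P₀ * f₃ = 0 := by
  have h : cls P₀ * cls P₀ = cls P₀ + cls Γ := by
    simp only [cls_eq, ← map_mul, ← map_add]
    rw [← isoClass_tensor, isoClass_eq_iff.2 tensor_P₀_P₀, isoClass_sum, isoClass_freeMod,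
      Nat.cast_one, one_mul]
  have h1 : cls P₀ * f₃ = -(cls Γ * (1 - f₁)) := by
    rw [f₃]
    linear_combination -(1 - f₁) * h
  rw [h1, mul_sub, mul_one, cls_Γ_mul_f₁, sub_self, neg_zero]

lemma cls_P₁_mul_f₃ : cls P₁ * f₃ = 0 := by
  have h : cls Γ = cls P₀ + cls P₁ := by
    simp only [cls_eq, ← map_add]
    rw [isoClass_Γ]
  have h1 := cls_Γ_mul_f₃
  rwa [h, add_mul, cls_P₀_mul_f₃, zero_add] at h1

lemma cls_coverMod_mul_f₃ (n : ℕ) : cls (coverMod n) * f₃ = 0 := by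
  have hfree : ∀ k, cls (freeMod R G k) * f₃ = 0 := fun k => by
    rw [cls_eq, isoClass_freeMod, map_mul, map_natCast, mul_assoc, ← cls_eq, cls_Γ_mul_f₃,
      mul_zero]
  have hsum : ∀ M N : RepLattice R G, cls (M.sum N) = cls M + cls N := fun M N => by
    rw [cls_eq, isoClass_sum, map_add, ← cls_eq, ← cls_eq]
  rw [coverMod]
  split_ifs
  · rw [hsum, add_mul, hfree, cls_P₀_mul_f₃, add_zero]
  · rw [hsum, add_mul, hfree, cls_P₁_mul_f₃, add_zero]
  · exact hfree _

lemma cls_lift_succ (z : ℤ) : cls (lift (z + 1)) * f₃ = cls (lift z) * cls (lift 1) * f₃ := by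
  obtain ⟨n, Q, hQ, h⟩ := exists_isShortExact_lift z
  have h1 := congrArg clsHom (isoClass_mul_liftNat_one ((isProj_coverMod n).of_iso hQ) h)
  rw [isoClass_eq_iff.2 hQ] at h1
  simp only [map_add, map_mul, ← cls_eq] at h1
  have h2 := congrArg (· * f₃) h1
  simp only [add_mul, mul_assoc, cls_coverMod_mul_f₃, cls_P₀_mul_f₃, mul_zero, add_zero] at h2
  rw [← h2, mul_assoc]
  rfl

lemma cls_lift_zero : cls (lift 0) = 1 := rfl

lemma cls_lift_mul (n m : ℤ) :
    cls (lift n) * cls (lift m) * f₃ = cls (lift (n + m)) * f₃ := by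
  have hinv : cls (lift (-1)) * cls (lift 1) * f₃ = f₃ := by
    rw [← cls_lift_succ, neg_add_cancel, cls_lift_zero, one_mul]
  induction m using Int.induction_on with
  | zero => rw [add_zero, cls_lift_zero, mul_one]
  | succ m ih =>
    rw [mul_assoc, cls_lift_succ, ← add_assoc, cls_lift_succ]
    linear_combination cls (lift 1) * ih
  | pred m ih =>
    have hpred : ∀ z, cls (lift (z - 1)) * f₃ = cls (lift z) * cls (lift (-1)) * f₃ := fun z => by
      have h := cls_lift_succ (z - 1)
      rw [sub_add_cancel] at h
      linear_combination -cls (lift (-1)) * h - cls (lift (z - 1)) * hinv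
    rw [mul_assoc, hpred, ← add_sub_assoc, hpred]
    linear_combination cls (lift (-1)) * ih

end AltFour

end

theorem lemma5 :
    (∀ n : ℤ, ∃ D E : RepLattice R G, IsHellerPair n D E) ∧
    ∀ Δ Δ' : ℤ → RepLattice R G, (∀ n, IsHellerPair n (Δ n) (Δ' n)) →
      (∀ k : ℕ, 1 ≤ k →
        IsShortExact (Δ (3 * k)) (freeMod R G k) (Δ (3 * k - 1))) ∧
      (∀ k : ℕ,
        IsShortExact (Δ (3 * k + 1)) (P₀.sum (freeMod R G k)) (Δ (3 * k))) ∧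
      (∀ k : ℕ,
        IsShortExact (Δ (3 * k + 2)) (P₁.sum (freeMod R G k)) (Δ (3 * k + 1))) ∧
      (∀ k : ℕ,
        ((Δ (3 * k)).tensor (Δ 1)).Iso ((Δ (3 * k + 1)).sum (freeMod R G k))) ∧
      (∀ k : ℕ,
        ((Δ (3 * k + 1)).tensor (Δ 1)).Iso
          (((Δ (3 * k + 2)).sum P₀).sum (freeMod R G k))) ∧
      (∀ k : ℕ,
        ((Δ (3 * k + 2)).tensor (Δ 1)).Iso
          (((Δ (3 * k + 3)).sum P₁).sum (freeMod R G k))) ∧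
      (∀ n m : ℤ, cls (Δ n) * cls (Δ m) * f₃ = cls (Δ (n + m)) * f₃) ∧
      cls (Δ' 0) * cls (Δ' 0) = 2 * cls (Δ 0) + cls (Δ' 0) := by
  refine ⟨fun n => ⟨_, _, isHellerPair_lift n⟩, fun Δ Δ' hΔ => ?_⟩
  have hiso : ∀ n, (Δ n).Iso (lift n) := fun n => (hΔ n).iso_lift.1
  have hiso' : ∀ n, (Δ' n).Iso ((lift n).tensor twoMod) := fun n => (hΔ n).iso_lift.2
  have hnat : ∀ (z : ℤ) (n : ℕ), z = n → (liftNat n).Iso (Δ z) := fun z n h => h ▸ (hiso n).symm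
  have hcls : ∀ n, cls (Δ n) = cls (lift n) := fun n => by
    rw [cls_eq, cls_eq, isoClass_eq_iff.2 (hiso n)]
  refine ⟨fun k hk => ?_, fun k => ?_, fun k => ?_, fun k => ?_, fun k => ?_, fun k => ?_,
    fun n m => ?_, ?_⟩
  · obtain ⟨j, rfl⟩ := Nat.exists_eq_add_of_le' hk
    exact (coverMod_two j ▸ isShortExact_liftNat (3 * j + 2)).congr
      (hnat _ _ (by push_cast; ring)) (iso_refl _) (hnat _ _ (by push_cast; ring))
  · exact (coverMod_zero k ▸ isShortExact_liftNat (3 * k)).congr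
      (hnat _ _ (by push_cast; ring)) (iso_refl _) (hnat _ _ (by push_cast; ring))
  · exact (coverMod_one k ▸ isShortExact_liftNat (3 * k + 1)).congr
      (hnat _ _ (by push_cast; ring)) (iso_refl _) (hnat _ _ (by push_cast; ring))
  · exact (((hnat _ _ (by push_cast; ring)).symm.tensor (hnat 1 1 rfl).symm).trans
      (tensor_liftNat_zero k)).trans ((hnat _ _ (by push_cast; ring)).sum (iso_refl _))
  · exact (((hnat _ _ (by push_cast; ring)).symm.tensor (hnat 1 1 rfl).symm).trans
      (tensor_liftNat_one k)).trans
      (((hnat _ _ (by push_cast; ring)).sum (iso_refl _)).sum (iso_refl _))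
  · exact (((hnat _ _ (by push_cast; ring)).symm.tensor (hnat 1 1 rfl).symm).trans
      (tensor_liftNat_two k)).trans
      (((hnat _ _ (by push_cast; ring)).sum (iso_refl _)).sum (iso_refl _))
  · rw [hcls, hcls, hcls, cls_lift_mul]
  · have h : cls (Δ' 0) = clsHom twoMod.isoClass := by
      rw [cls_eq, isoClass_eq_iff.2 ((hiso' 0).trans (triv_tensor twoMod))]
    rw [h, hcls, cls_lift_zero, ← map_mul, isoClass_twoMod_mul, map_add, map_ofNat, mul_one]
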